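/- Let $\mathcal E$ be a locally cartesian closed category with a terminal object (equivalently: a category with finite limits in which every pullback functor $u^*:\mathcal E/J\to\mathcal E/I$ has a right adjoint $\Pi_u$; its left adjoint is denoted $\Sigma_u$). **Conventions.** Slices are tensored over $\mathcal E$ by $K\otimes(a:A\to I)=(K\times A\to A\to I)$; a strong functor between slices is a functor $P$ with a tensorial strength $K\otimes P(a)\to P(K\otimes a)$, and a strong natural transformation is one compatible with the strengths. The functors $\Sigma_u,u^*,\Pi_u$ have canonical strengths. A polynomial is a diagram $F=(I\xleftarrow{s}B\xrightarrow{f}A\xrightarrow{t}J)$; its extension is the strong functor $\Sigma_t\Pi_f s^*:\mathcal E/I\to\mathcal E/J$; a polynomial functor is a strong functor isomorphic, as a strong functor, to the extension of a polynomial. A double category is understood in the pseudo sense (vertical composition strict, horizontal composition associative and unital up to coherent invertible squares); it is a framed bicategory if the functor $(\partial_0,\partial_1):\mathbb D_1\to\mathbb D_0\times\mathbb D_0$ from horizontal arrows and squares to pairs of objects is a bifibration. Its cartesian (resp. opcartesian) lifts of a pair $(u,v)$ of vertical arrows are called transporter (resp. cotransporter) lifts. A framed biequivalence is here a double functor (pseudo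 in the horizontal direction) which is the identity on objects and vertical arrows and an equivalence on categories of horizontal arrows and squares. **Statement.** (1) There is a double category $\mathrm{PolyFun}$ with objects the slices of $\mathcal E$, horizontal arrows the polynomial functors, vertical arrows the dependent sum functors $\Sigma_u:\mathcal E/I'\to\mathcal E/I$ ($u:I'\to I$ in $\mathcal E$), and squares with horizontal boundary $P':\mathcal E/I'\to\mathcal E/J'$, $P:\mathcal E/I\to\mathcal E/J$ and vertical boundary $\Sigma_u,\Sigma_v$ the strong natural transformations $\Sigma_vP'\Rightarrow P\Sigma_u$, with composition and pasting of strong functors and transformations (in particular these classes are closed under the compositions). It is a framed bicategory. For $u:I'\to I$, $v:J'\to J$ and a polynomial functor $P:\mathcal E/I\to\mathcal E/J$, the functor $v^*P\Sigma_u$ (base change) is polynomial, and the square $\Sigma_vv^*P\Sigma_u\Rightarrow P\Sigma_u$ given by the counit of $\Sigma_v\dashv v^*$ is a transporter lift of $(u,v)$ to $P$; for a polynomial functor $P':\mathcal E/I'\to\mathcal E/J'$, the functor $\Sigma_vP'u^*$ (cobase change) is polynomial, and the square $\Sigma_vP'\Rightarrow\Sigma_vP'u^*\Sigma_u$ given by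 the unit of $\Sigma_u\dashv u^*$ is a cotransporter lift of $(u,v)$ to $P'$. (2) Let $F'=(I'\xleftarrow{s'}B'\xrightarrow{f'}A'\xrightarrow{t'}J')$ and $F=(I\xleftarrow{s}B\xrightarrow{f}A\xrightarrow{t}J)$ be polynomials with extensions $P',P$. Every square $\Sigma_vP'\Rightarrow P\Sigma_u$ is represented by a diagram consisting of $\alpha:A'\to A$ with $t\alpha=vt'$, a pullback $B\xleftarrow{\beta}D\xrightarrow{\pi}A'$ of $B\xrightarrow{f}A\xleftarrow{\alpha}A'$, and $\gamma:D\to B'$ with $f'\gamma=\pi$ and $us'\gamma=s\beta$: in the internal language, it sends $(a',(x_{b'})_{b'\in B'_{a'}})$ to $(\alpha(a'),(x_{\gamma(b,a')})_{b\in B_{\alpha(a')}})$. Two diagrams represent the same square if and only if they have the same $\alpha$ and there is an isomorphism between their objects $D$ compatible with $\beta$ and $\gamma$ (i.e. they differ only in the choice of the pullback). (3) Consequently there is a framed bicategory $\mathrm{Poly}$ with objects the objects of $\mathcal E$, vertical arrows the arrows of $\mathcal E$, horizontal arrows the polynomials, composed by substitution, with the identity polynomials as units, and squares the diagrams of (2)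 up to choice of pullback, composed vertically by pullback of the middle objects $D$; and extension, with the canonical isomorphisms comparing the extension of a composite (resp. identity) polynomial with the composite (resp. identity) functor, is a framed biequivalence $\mathrm{Poly}\simeq\mathrm{PolyFun}$. (4) The same holds for the cartesian fragment. Polynomial functors and those squares $\Sigma_vP'\Rightarrow P\Sigma_u$ all of whose naturality squares are pullbacks form a framed bicategory, a sub-double category of $\mathrm{PolyFun}$, with the same base change and cobase change lifts. The cartesian squares between the extensions of $F'$ and $F$ are the ones represented by diagrams $\beta:B'\to B$, $\alpha:A'\to A$ with $us'=s\beta$, $t\alpha=vt'$ and $B\xleftarrow{\beta}B'\xrightarrow{f'}A'$ a pullback of $f$ and $\alpha$, and each is represented by exactly one such diagram. Polynomials and these diagrams, with vertical composition by pasting, form a framed bicategory, and extension is a framed biequivalence from it to the cartesian fragment of $\mathrm{PolyFun}$. -/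

import Mathlib

open CategoryTheory Limits

universe w' w v u

namespace PolyDouble

noncomputable section

/-! ### Double categories -/

/-- The underlying data of a (pseudo) double category whose category of objects and vertical arrows
is `O`: horizontal arrows, squares
```
  I' --M'--> J'
  |u         |v
  I --M--->  J
```
horizontal identities and horizontal composites (in diagrammatic order) of horizontal arrows. -/
structure DoubleGraph (O : Type u) [Category.{v} O] where
  Hor : O → O → Type w
  Sq : ∀ {I' J' I J : O}, (I' ⟶ I) → (J' ⟶ J) → Hor I' J' → Hor I J → Type w'
  hid : ∀ I : O, Hor I I
  hcomp : ∀ {I J K : O}, Hor I J → Hor J K → Hor I K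

/-- A (pseudo) double category: a pseudo-category in `Cat`, with category of objects `O`. Vertical
composition of squares is strictly associative and unital, horizontal composition is a functor, and
is associative and unital up to coherent invertible globular squares. Squares whose boundaries agree
only propositionally (e.g. `𝟙 I ≫ u = u`) are compared by heterogeneous equality. -/
structure DoubleCat {O : Type u} [Category.{v} O] (G : DoubleGraph.{w', w} O) where
  vid : ∀ {I J : O} (M : G.Hor I J), G.Sq (𝟙 I) (𝟙 J) M M
  vcomp : ∀ {I₁ J₁ I₂ J₂ I₃ J₃ : O} {u : I₁ ⟶ I₂} {v : J₁ ⟶ J₂} {u' : I₂ ⟶ I₃} {v' : J₂ ⟶ J₃}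
    {L : G.Hor I₁ J₁} {M : G.Hor I₂ J₂} {N : G.Hor I₃ J₃},
    G.Sq u v L M → G.Sq u' v' M N → G.Sq (u ≫ u') (v ≫ v') L N
  vid_vcomp : ∀ {I' J' I J : O} {u : I' ⟶ I} {v : J' ⟶ J} {M : G.Hor I' J'} {N : G.Hor I J}
    (σ : G.Sq u v M N), vcomp (vid M) σ ≍ σ
  vcomp_vid : ∀ {I' J' I J : O} {u : I' ⟶ I} {v : J' ⟶ J} {M : G.Hor I' J'} {N : G.Hor I J}
    (σ : G.Sq u v M N), vcomp σ (vid N) ≍ σ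
  vcomp_assoc : ∀ {I₁ J₁ I₂ J₂ I₃ J₃ I₄ J₄ : O} {u : I₁ ⟶ I₂} {v : J₁ ⟶ J₂} {u' : I₂ ⟶ I₃}
    {v' : J₂ ⟶ J₃} {u'' : I₃ ⟶ I₄} {v'' : J₃ ⟶ J₄}
    {L : G.Hor I₁ J₁} {M : G.Hor I₂ J₂} {N : G.Hor I₃ J₃} {P : G.Hor I₄ J₄}
    (σ : G.Sq u v L M) (τ : G.Sq u' v' M N) (ρ : G.Sq u'' v'' N P),
    vcomp (vcomp σ τ) ρ ≍ vcomp σ (vcomp τ ρ)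
  hidSq : ∀ {I' I : O} (u : I' ⟶ I), G.Sq u u (G.hid I') (G.hid I)
  hidSq_id : ∀ I : O, hidSq (𝟙 I) = vid (G.hid I)
  hidSq_comp : ∀ {I₁ I₂ I₃ : O} (u : I₁ ⟶ I₂) (u' : I₂ ⟶ I₃),
    hidSq (u ≫ u') = vcomp (hidSq u) (hidSq u')
  hcompSq : ∀ {I' J' K' I J K : O} {u : I' ⟶ I} {v : J' ⟶ J} {w : K' ⟶ K}
    {M' : G.Hor I' J'} {N' : G.Hor J' K'} {M : G.Hor I J} {N : G.Hor J K},
    G.Sq u v M' M → G.Sq v w N' N → G.Sq u w (G.hcomp M' N') (G.hcomp M N)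
  hcompSq_vid : ∀ {I J K : O} (M : G.Hor I J) (N : G.Hor J K),
    hcompSq (vid M) (vid N) = vid (G.hcomp M N)
  interchange : ∀ {I₁ J₁ K₁ I₂ J₂ K₂ I₃ J₃ K₃ : O} {u : I₁ ⟶ I₂} {v : J₁ ⟶ J₂} {w : K₁ ⟶ K₂}
    {u' : I₂ ⟶ I₃} {v' : J₂ ⟶ J₃} {w' : K₂ ⟶ K₃}
    {M₁ : G.Hor I₁ J₁} {N₁ : G.Hor J₁ K₁} {M₂ : G.Hor I₂ J₂} {N₂ : G.Hor J₂ K₂}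
    {M₃ : G.Hor I₃ J₃} {N₃ : G.Hor J₃ K₃}
    (σ : G.Sq u v M₁ M₂) (σ' : G.Sq v w N₁ N₂) (τ : G.Sq u' v' M₂ M₃) (τ' : G.Sq v' w' N₂ N₃),
    hcompSq (vcomp σ τ) (vcomp σ' τ') = vcomp (hcompSq σ σ') (hcompSq τ τ')
  assoc : ∀ {I J K L : O} (M : G.Hor I J) (N : G.Hor J K) (P : G.Hor K L),
    G.Sq (𝟙 I) (𝟙 L) (G.hcomp (G.hcomp M N) P) (G.hcomp M (G.hcomp N P))
  assocInv : ∀ {I J K L : O} (M : G.Hor I J) (N : G.Hor J K) (P : G.Hor K L),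
    G.Sq (𝟙 I) (𝟙 L) (G.hcomp M (G.hcomp N P)) (G.hcomp (G.hcomp M N) P)
  assoc_assocInv : ∀ {I J K L : O} (M : G.Hor I J) (N : G.Hor J K) (P : G.Hor K L),
    vcomp (assoc M N P) (assocInv M N P) ≍ vid (G.hcomp (G.hcomp M N) P)
  assocInv_assoc : ∀ {I J K L : O} (M : G.Hor I J) (N : G.Hor J K) (P : G.Hor K L),
    vcomp (assocInv M N P) (assoc M N P) ≍ vid (G.hcomp M (G.hcomp N P))
  assoc_naturality : ∀ {I' J' K' L' I J K L : O} {u : I' ⟶ I} {v : J' ⟶ J} {w : K' ⟶ K}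
    {x : L' ⟶ L} {M' : G.Hor I' J'} {N' : G.Hor J' K'} {P' : G.Hor K' L'}
    {M : G.Hor I J} {N : G.Hor J K} {P : G.Hor K L}
    (σ : G.Sq u v M' M) (τ : G.Sq v w N' N) (ρ : G.Sq w x P' P),
    vcomp (hcompSq (hcompSq σ τ) ρ) (assoc M N P) ≍
      vcomp (assoc M' N' P') (hcompSq σ (hcompSq τ ρ))
  leftUnit : ∀ {I J : O} (M : G.Hor I J), G.Sq (𝟙 I) (𝟙 J) (G.hcomp (G.hid I) M) M
  leftUnitInv : ∀ {I J : O} (M : G.Hor I J), G.Sq (𝟙 I) (𝟙 J) M (G.hcomp (G.hid I) M)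
  leftUnit_leftUnitInv : ∀ {I J : O} (M : G.Hor I J),
    vcomp (leftUnit M) (leftUnitInv M) ≍ vid (G.hcomp (G.hid I) M)
  leftUnitInv_leftUnit : ∀ {I J : O} (M : G.Hor I J),
    vcomp (leftUnitInv M) (leftUnit M) ≍ vid M
  leftUnit_naturality : ∀ {I' J' I J : O} {u : I' ⟶ I} {v : J' ⟶ J} {M' : G.Hor I' J'}
    {M : G.Hor I J} (σ : G.Sq u v M' M),
    vcomp (hcompSq (hidSq u) σ) (leftUnit M) ≍ vcomp (leftUnit M') σ
  rightUnit : ∀ {I J : O} (M : G.Hor I J), G.Sq (𝟙 I) (𝟙 J) (G.hcomp M (G.hid J)) M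
  rightUnitInv : ∀ {I J : O} (M : G.Hor I J), G.Sq (𝟙 I) (𝟙 J) M (G.hcomp M (G.hid J))
  rightUnit_rightUnitInv : ∀ {I J : O} (M : G.Hor I J),
    vcomp (rightUnit M) (rightUnitInv M) ≍ vid (G.hcomp M (G.hid J))
  rightUnitInv_rightUnit : ∀ {I J : O} (M : G.Hor I J),
    vcomp (rightUnitInv M) (rightUnit M) ≍ vid M
  rightUnit_naturality : ∀ {I' J' I J : O} {u : I' ⟶ I} {v : J' ⟶ J} {M' : G.Hor I' J'}
    {M : G.Hor I J} (σ : G.Sq u v M' M),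
    vcomp (hcompSq σ (hidSq v)) (rightUnit M) ≍ vcomp (rightUnit M') σ
  pentagon : ∀ {I J K L P : O} (A : G.Hor I J) (B : G.Hor J K) (C : G.Hor K L) (D : G.Hor L P),
    vcomp (hcompSq (assoc A B C) (vid D))
        (vcomp (assoc A (G.hcomp B C) D) (hcompSq (vid A) (assoc B C D))) ≍
      vcomp (assoc (G.hcomp A B) C D) (assoc A B (G.hcomp C D))
  triangle : ∀ {I J K : O} (M : G.Hor I J) (N : G.Hor J K),
    vcomp (assoc M (G.hid J) N) (hcompSq (vid M) (leftUnit N)) ≍ hcompSq (rightUnit M) (vid N)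

variable {O : Type u} [Category.{v} O]

/-- Objects of the category `𝔻₁` of horizontal arrows and squares of a double category `𝔻`. -/
structure DoubleCat.Total {G : DoubleGraph.{w', w} O} (D : DoubleCat G) where
  src : O
  tgt : O
  hor : G.Hor src tgt

/-- Morphisms of `𝔻₁`: squares. -/
@[ext]
structure DoubleCat.Total.Hom {G : DoubleGraph.{w', w} O} {D : DoubleCat G} (M N : D.Total) where
  left : M.src ⟶ N.src
  right : M.tgt ⟶ N.tgt
  sq : G.Sq left right M.hor N.hor

instance DoubleCat.Total.category {G : DoubleGraph.{w', w} O} (D : DoubleCat G) :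
    Category D.Total where
  Hom := DoubleCat.Total.Hom
  id M := ⟨𝟙 _, 𝟙 _, D.vid M.hor⟩
  comp σ τ := ⟨σ.left ≫ τ.left, σ.right ≫ τ.right, D.vcomp σ.sq τ.sq⟩
  id_comp σ := DoubleCat.Total.Hom.ext (Category.id_comp _) (Category.id_comp _) (D.vid_vcomp σ.sq)
  comp_id σ := DoubleCat.Total.Hom.ext (Category.comp_id _) (Category.comp_id _) (D.vcomp_vid σ.sq)
  assoc σ τ ρ := DoubleCat.Total.Hom.ext (Category.assoc _ _ _) (Category.assoc _ _ _)
    (D.vcomp_assoc σ.sq τ.sq ρ.sq)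

/-- The functor `(∂₀, ∂₁) : 𝔻₁ ⥤ 𝔻₀ × 𝔻₀`. -/
def DoubleCat.endpoints {G : DoubleGraph.{w', w} O} (D : DoubleCat G) : D.Total ⥤ O × O where
  obj M := (M.src, M.tgt)
  map σ := Prod.mkHom σ.left σ.right

/-- The horizontal arrow `M`, as an object of `𝔻₁`. -/
def DoubleCat.ofHor {G : DoubleGraph.{w', w} O} (D : DoubleCat G) {I J : O} (M : G.Hor I J) :
    D.Total := ⟨I, J, M⟩

/-- The square `σ`, as a morphism of `𝔻₁`. -/
def DoubleCat.ofSq {G : DoubleGraph.{w', w} O} (D : DoubleCat G) {I' J' I J : O} {u : I' ⟶ I}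
    {v : J' ⟶ J} {M : G.Hor I' J'} {N : G.Hor I J} (σ : G.Sq u v M N) : D.ofHor M ⟶ D.ofHor N :=
  DoubleCat.Total.Hom.mk u v σ

/-- The square `σ` is a transporter lift of `(u, v)` to `N`. -/
def DoubleCat.IsTransporter {G : DoubleGraph.{w', w} O} (D : DoubleCat G) {I' J' I J : O}
    {u : I' ⟶ I} {v : J' ⟶ J} {M : G.Hor I' J'} {N : G.Hor I J} (σ : G.Sq u v M N) : Prop :=
  D.endpoints.IsStronglyCartesian (Prod.mkHom u v : (I', J') ⟶ (I, J)) (D.ofSq σ)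

/-- The square `σ` is a cotransporter lift of `(u, v)` to `M`. -/
def DoubleCat.IsCotransporter {G : DoubleGraph.{w', w} O} (D : DoubleCat G) {I' J' I J : O}
    {u : I' ⟶ I} {v : J' ⟶ J} {M : G.Hor I' J'} {N : G.Hor I J} (σ : G.Sq u v M N) : Prop :=
  D.endpoints.IsStronglyCocartesian (Prod.mkHom u v : (I', J') ⟶ (I, J)) (D.ofSq σ)

/-- A double category is a framed bicategory if `(∂₀, ∂₁) : 𝔻₁ ⥤ 𝔻₀ × 𝔻₀` is a bifibration. -/
structure DoubleCat.IsFramed {G : DoubleGraph.{w', w} O} (D : DoubleCat G) : Prop where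
  exists_transporter : ∀ (N : D.Total) {R : O × O} (f : R ⟶ D.endpoints.obj N),
    ∃ (M : D.Total) (σ : M ⟶ N), D.endpoints.IsStronglyCartesian f σ
  exists_cotransporter : ∀ (M : D.Total) {S : O × O} (f : D.endpoints.obj M ⟶ S),
    ∃ (N : D.Total) (σ : M ⟶ N), D.endpoints.IsStronglyCocartesian f σ

universe w₂' w₂

/-- A (pseudo) double functor which is the identity on objects and vertical arrows and sends a
horizontal arrow `M` to `hor M`: it preserves vertical composition strictly, and horizontal
composition and identities up to coherent invertible globular squares. -/
structure DoubleFunctor {G : DoubleGraph.{w', w} O} (D : DoubleCat G)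
    {H : DoubleGraph.{w₂', w₂} O} (D' : DoubleCat H)
    (hor : ∀ {I J : O}, G.Hor I J → H.Hor I J) where
  sq : ∀ {I' J' I J : O} {u : I' ⟶ I} {v : J' ⟶ J} {M : G.Hor I' J'} {N : G.Hor I J},
    G.Sq u v M N → H.Sq u v (hor M) (hor N)
  sq_vid : ∀ {I J : O} (M : G.Hor I J), sq (D.vid M) = D'.vid (hor M)
  sq_vcomp : ∀ {I₁ J₁ I₂ J₂ I₃ J₃ : O} {u : I₁ ⟶ I₂} {v : J₁ ⟶ J₂} {u' : I₂ ⟶ I₃} {v' : J₂ ⟶ J₃}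
    {L : G.Hor I₁ J₁} {M : G.Hor I₂ J₂} {N : G.Hor I₃ J₃} (σ : G.Sq u v L M) (τ : G.Sq u' v' M N),
    sq (D.vcomp σ τ) = D'.vcomp (sq σ) (sq τ)
  mapComp : ∀ {I J K : O} (M : G.Hor I J) (N : G.Hor J K),
    H.Sq (𝟙 I) (𝟙 K) (hor (G.hcomp M N)) (H.hcomp (hor M) (hor N))
  mapCompInv : ∀ {I J K : O} (M : G.Hor I J) (N : G.Hor J K),
    H.Sq (𝟙 I) (𝟙 K) (H.hcomp (hor M) (hor N)) (hor (G.hcomp M N))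
  mapComp_mapCompInv : ∀ {I J K : O} (M : G.Hor I J) (N : G.Hor J K),
    D'.vcomp (mapComp M N) (mapCompInv M N) ≍ D'.vid (hor (G.hcomp M N))
  mapCompInv_mapComp : ∀ {I J K : O} (M : G.Hor I J) (N : G.Hor J K),
    D'.vcomp (mapCompInv M N) (mapComp M N) ≍ D'.vid (H.hcomp (hor M) (hor N))
  mapComp_naturality : ∀ {I' J' K' I J K : O} {u : I' ⟶ I} {v : J' ⟶ J} {w : K' ⟶ K}
    {M' : G.Hor I' J'} {N' : G.Hor J' K'} {M : G.Hor I J} {N : G.Hor J K}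
    (σ : G.Sq u v M' M) (τ : G.Sq v w N' N),
    D'.vcomp (sq (D.hcompSq σ τ)) (mapComp M N) ≍
      D'.vcomp (mapComp M' N') (D'.hcompSq (sq σ) (sq τ))
  mapId : ∀ I : O, H.Sq (𝟙 I) (𝟙 I) (hor (G.hid I)) (H.hid I)
  mapIdInv : ∀ I : O, H.Sq (𝟙 I) (𝟙 I) (H.hid I) (hor (G.hid I))
  mapId_mapIdInv : ∀ I : O, D'.vcomp (mapId I) (mapIdInv I) ≍ D'.vid (hor (G.hid I))
  mapIdInv_mapId : ∀ I : O, D'.vcomp (mapIdInv I) (mapId I) ≍ D'.vid (H.hid I)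
  mapId_naturality : ∀ {I' I : O} (u : I' ⟶ I),
    D'.vcomp (sq (D.hidSq u)) (mapId I) ≍ D'.vcomp (mapId I') (D'.hidSq u)
  map_assoc : ∀ {I J K L : O} (M : G.Hor I J) (N : G.Hor J K) (P : G.Hor K L),
    D'.vcomp (sq (D.assoc M N P))
        (D'.vcomp (mapComp M (G.hcomp N P)) (D'.hcompSq (D'.vid (hor M)) (mapComp N P))) ≍
      D'.vcomp (mapComp (G.hcomp M N) P)
        (D'.vcomp (D'.hcompSq (mapComp M N) (D'.vid (hor P))) (D'.assoc (hor M) (hor N) (hor P)))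
  map_leftUnit : ∀ {I J : O} (M : G.Hor I J),
    sq (D.leftUnit M) ≍ D'.vcomp (mapComp (G.hid I) M)
      (D'.vcomp (D'.hcompSq (mapId I) (D'.vid (hor M))) (D'.leftUnit (hor M)))
  map_rightUnit : ∀ {I J : O} (M : G.Hor I J),
    sq (D.rightUnit M) ≍ D'.vcomp (mapComp M (G.hid J))
      (D'.vcomp (D'.hcompSq (D'.vid (hor M)) (mapId J)) (D'.rightUnit (hor M)))

/-- The functor `𝔻₁ ⥤ 𝔻'₁` underlying a double functor. -/
def DoubleFunctor.total {G : DoubleGraph.{w', w} O} {D : DoubleCat G}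
    {H : DoubleGraph.{w₂', w₂} O} {D' : DoubleCat H}
    {hor : ∀ {I J : O}, G.Hor I J → H.Hor I J} (Φ : DoubleFunctor D D' hor) :
    D.Total ⥤ D'.Total where
  obj M := D'.ofHor (hor M.hor)
  map σ := D'.ofSq (Φ.sq σ.sq)
  map_id M := DoubleCat.Total.Hom.ext rfl rfl (heq_of_eq (Φ.sq_vid M.hor))
  map_comp σ τ := DoubleCat.Total.Hom.ext rfl rfl (heq_of_eq (Φ.sq_vcomp σ.sq τ.sq))

/-- A double functor which is the identity on objects and vertical arrows is an equivalence of
double categories (a framed biequivalence, when the double categories are framed bicategories) if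
the functor between the categories of horizontal arrows and squares is an equivalence. -/
def DoubleFunctor.IsFramedBiequivalence {G : DoubleGraph.{w', w} O} {D : DoubleCat G}
    {H : DoubleGraph.{w₂', w₂} O} {D' : DoubleCat H}
    {hor : ∀ {I J : O}, G.Hor I J → H.Hor I J} (Φ : DoubleFunctor D D' hor) : Prop :=
  Φ.total.IsEquivalence

/-! ### Sub-double categories -/

/-- Classes of horizontal arrows and of squares of a double category, containing all the structural
horizontal arrows and squares and closed under both compositions. -/
structure DoubleCat.IsSub {G : DoubleGraph.{w', w} O} (D : DoubleCat G)
    (p : ∀ {I J : O}, G.Hor I J → Prop)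
    (q : ∀ {I' J' I J : O} {u : I' ⟶ I} {v : J' ⟶ J} {M : G.Hor I' J'} {N : G.Hor I J},
      G.Sq u v M N → Prop) : Prop where
  hid : ∀ I : O, p (G.hid I)
  hcomp : ∀ {I J K : O} (M : G.Hor I J) (N : G.Hor J K), p M → p N → p (G.hcomp M N)
  vid : ∀ {I J : O} (M : G.Hor I J), p M → q (D.vid M)
  vcomp : ∀ {I₁ J₁ I₂ J₂ I₃ J₃ : O} {u : I₁ ⟶ I₂} {v : J₁ ⟶ J₂} {u' : I₂ ⟶ I₃} {v' : J₂ ⟶ J₃}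
    {L : G.Hor I₁ J₁} {M : G.Hor I₂ J₂} {N : G.Hor I₃ J₃} (σ : G.Sq u v L M) (τ : G.Sq u' v' M N),
    p L → p M → p N → q σ → q τ → q (D.vcomp σ τ)
  hidSq : ∀ {I' I : O} (u : I' ⟶ I), q (D.hidSq u)
  hcompSq : ∀ {I' J' K' I J K : O} {u : I' ⟶ I} {v : J' ⟶ J} {w : K' ⟶ K}
    {M' : G.Hor I' J'} {N' : G.Hor J' K'} {M : G.Hor I J} {N : G.Hor J K}
    (σ : G.Sq u v M' M) (τ : G.Sq v w N' N), p M' → p N' → p M → p N → q σ → q τ →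
    q (D.hcompSq σ τ)
  assoc : ∀ {I J K L : O} (M : G.Hor I J) (N : G.Hor J K) (P : G.Hor K L), p M → p N → p P →
    q (D.assoc M N P)
  assocInv : ∀ {I J K L : O} (M : G.Hor I J) (N : G.Hor J K) (P : G.Hor K L), p M → p N → p P →
    q (D.assocInv M N P)
  leftUnit : ∀ {I J : O} (M : G.Hor I J), p M → q (D.leftUnit M)
  leftUnitInv : ∀ {I J : O} (M : G.Hor I J), p M → q (D.leftUnitInv M)
  rightUnit : ∀ {I J : O} (M : G.Hor I J), p M → q (D.rightUnit M)
  rightUnitInv : ∀ {I J : O} (M : G.Hor I J), p M → q (D.rightUnitInv M)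

section Sub

variable {G : DoubleGraph.{w', w} O} {D : DoubleCat G} {p : ∀ {I J : O}, G.Hor I J → Prop}
  {q : ∀ {I' J' I J : O} {u : I' ⟶ I} {v : J' ⟶ J} {M : G.Hor I' J'} {N : G.Hor I J},
    G.Sq u v M N → Prop}

/-- The horizontal arrows satisfying `p` and the squares between them satisfying `q`. -/
def DoubleCat.IsSub.graph (h : D.IsSub p q) : DoubleGraph.{w', w} O where
  Hor I J := {M : G.Hor I J // p M}
  Sq u v M N := {σ : G.Sq u v M.1 N.1 // q σ}
  hid I := ⟨G.hid I, h.hid I⟩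
  hcomp M N := ⟨G.hcomp M.1 N.1, h.hcomp _ _ M.2 N.2⟩

theorem DoubleCat.IsSub.sq_heq (_h : D.IsSub p q) {I' J' I J : O} {u u' : I' ⟶ I} {v v' : J' ⟶ J}
    {M : G.Hor I' J'} {N : G.Hor I J} (hu : u = u') (hv : v = v') {σ : G.Sq u v M N}
    {τ : G.Sq u' v' M N} (hσ : q σ) (hτ : q τ) (e : σ ≍ τ) :
    (⟨σ, hσ⟩ : {σ : G.Sq u v M N // q σ}) ≍ (⟨τ, hτ⟩ : {σ : G.Sq u' v' M N // q σ}) := by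
  subst hu; subst hv; obtain rfl := eq_of_heq e; rfl

/-- The sub-double category on the horizontal arrows satisfying `p` and the squares between them
satisfying `q`. -/
def DoubleCat.IsSub.doubleCat (h : D.IsSub p q) : DoubleCat h.graph where
  vid M := ⟨D.vid M.1, h.vid _ M.2⟩
  vcomp {_ _ _ _ _ _ _ _ _ _ L M N} σ τ :=
    ⟨D.vcomp σ.1 τ.1, h.vcomp _ _ L.2 M.2 N.2 σ.2 τ.2⟩
  vid_vcomp σ := h.sq_heq (by simp) (by simp) _ σ.2 (D.vid_vcomp σ.1)
  vcomp_vid σ := h.sq_heq (by simp) (by simp) _ σ.2 (D.vcomp_vid σ.1)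
  vcomp_assoc σ τ ρ := h.sq_heq (by simp) (by simp) _ _ (D.vcomp_assoc σ.1 τ.1 ρ.1)
  hidSq u := ⟨D.hidSq u, h.hidSq u⟩
  hidSq_id I := Subtype.ext (D.hidSq_id I)
  hidSq_comp u u' := Subtype.ext (D.hidSq_comp u u')
  hcompSq {_ _ _ _ _ _ _ _ _ M' N' M N} σ τ :=
    ⟨D.hcompSq σ.1 τ.1, h.hcompSq _ _ M'.2 N'.2 M.2 N.2 σ.2 τ.2⟩
  hcompSq_vid M N := Subtype.ext (D.hcompSq_vid M.1 N.1)
  interchange σ σ' τ τ' := Subtype.ext (D.interchange σ.1 σ'.1 τ.1 τ'.1)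
  assoc M N P := ⟨D.assoc M.1 N.1 P.1, h.assoc _ _ _ M.2 N.2 P.2⟩
  assocInv M N P := ⟨D.assocInv M.1 N.1 P.1, h.assocInv _ _ _ M.2 N.2 P.2⟩
  assoc_assocInv M N P := h.sq_heq (by simp) (by simp) _ _ (D.assoc_assocInv M.1 N.1 P.1)
  assocInv_assoc M N P := h.sq_heq (by simp) (by simp) _ _ (D.assocInv_assoc M.1 N.1 P.1)
  assoc_naturality σ τ ρ := h.sq_heq (by simp) (by simp) _ _ (D.assoc_naturality σ.1 τ.1 ρ.1)
  leftUnit M := ⟨D.leftUnit M.1, h.leftUnit _ M.2⟩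
  leftUnitInv M := ⟨D.leftUnitInv M.1, h.leftUnitInv _ M.2⟩
  leftUnit_leftUnitInv M := h.sq_heq (by simp) (by simp) _ _ (D.leftUnit_leftUnitInv M.1)
  leftUnitInv_leftUnit M := h.sq_heq (by simp) (by simp) _ _ (D.leftUnitInv_leftUnit M.1)
  leftUnit_naturality σ := h.sq_heq (by simp) (by simp) _ _ (D.leftUnit_naturality σ.1)
  rightUnit M := ⟨D.rightUnit M.1, h.rightUnit _ M.2⟩
  rightUnitInv M := ⟨D.rightUnitInv M.1, h.rightUnitInv _ M.2⟩
  rightUnit_rightUnitInv M := h.sq_heq (by simp) (by simp) _ _ (D.rightUnit_rightUnitInv M.1)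
  rightUnitInv_rightUnit M := h.sq_heq (by simp) (by simp) _ _ (D.rightUnitInv_rightUnit M.1)
  rightUnit_naturality σ := h.sq_heq (by simp) (by simp) _ _ (D.rightUnit_naturality σ.1)
  pentagon A B C E := h.sq_heq (by simp) (by simp) _ _ (D.pentagon A.1 B.1 C.1 E.1)
  triangle M N := h.sq_heq (by simp) (by simp) _ _ (D.triangle M.1 N.1)

end Sub


set_option linter.unusedSectionVars false


/-! ### Strong functors between slices -/

variable {E : Type u} [Category.{v} E] [HasFiniteLimits E]

/-- The tensor `K ⊗ a = (K × A ⟶ A ⟶ I)` of `a : A ⟶ I` in `E/I` with `K` in `E`. -/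
abbrev tens {I : E} (K : E) (a : Over I) : Over I :=
  Over.mk ((prod.snd : K ⨯ a.left ⟶ a.left) ≫ a.hom)

def tensMap {I : E} {K L : E} (k : K ⟶ L) {a b : Over I} (f : a ⟶ b) : tens K a ⟶ tens L b :=
  Over.homMk (prod.map k f.left) (by simp [tens])

/-- The unit isomorphism `1 ⊗ a ≅ a`. -/
def tensUnit {I : E} (a : Over I) : tens (⊤_ E) a ⟶ a :=
  Over.homMk (prod.snd : (⊤_ E) ⨯ a.left ⟶ a.left) (by simp [tens])

/-- The associativity isomorphism `(K × L) ⊗ a ≅ K ⊗ (L ⊗ a)`. -/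
def tensAssoc {I : E} (K L : E) (a : Over I) : tens (K ⨯ L) a ⟶ tens K (tens L a) :=
  Over.homMk (prod.associator K L a.left).hom (by
    show (prod.associator K L a.left).hom ≫ prod.snd ≫ prod.snd ≫ a.hom = prod.snd ≫ a.hom
    simp [prod.lift_snd_assoc])

@[simp] theorem tens_left {I : E} (K : E) (a : Over I) : (tens K a).left = (K ⨯ a.left) := rfl

theorem tens_hom {I : E} (K : E) (a : Over I) : (tens K a).hom = prod.snd ≫ a.hom := rfl

@[simp] theorem tensMap_left {I : E} {K L : E} (k : K ⟶ L) {a b : Over I} (f : a ⟶ b) :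
    (tensMap k f).left = prod.map k f.left := rfl

@[simp] theorem tensUnit_left {I : E} (a : Over I) : (tensUnit a).left = prod.snd := rfl

@[simp] theorem tensAssoc_left {I : E} (K L : E) (a : Over I) :
    (tensAssoc K L a).left = (prod.associator K L a.left).hom := rfl

theorem tensMap_id {I : E} (K : E) (a : Over I) : tensMap (𝟙 K) (𝟙 a) = 𝟙 (tens K a) :=
  Over.OverMorphism.ext (by simp)

theorem tensMap_comp {I : E} {K L M : E} (k : K ⟶ L) (l : L ⟶ M) {a b c : Over I} (f : a ⟶ b)
    (g : b ⟶ c) : tensMap (k ≫ l) (f ≫ g) = tensMap k f ≫ tensMap l g :=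
  Over.OverMorphism.ext (by simp)

/-- A tensorial strength on a functor between slices. -/
structure Strength {I J : E} (F : Over I ⥤ Over J) where
  app : ∀ (K : E) (a : Over I), tens K (F.obj a) ⟶ F.obj (tens K a)
  naturality : ∀ {K L : E} (k : K ⟶ L) {a b : Over I} (f : a ⟶ b),
    tensMap k (F.map f) ≫ app L b = app K a ≫ F.map (tensMap k f)
  unit : ∀ a : Over I, app (⊤_ E) a ≫ F.map (tensUnit a) = tensUnit (F.obj a)
  assoc : ∀ (K L : E) (a : Over I),
    app (K ⨯ L) a ≫ F.map (tensAssoc K L a) =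
      tensAssoc K L (F.obj a) ≫ tensMap (𝟙 K) (app L a) ≫ app K (tens L a)

/-- A strong functor `E/I ⥤ E/J`. -/
structure StrongFunctor (I J : E) where
  functor : Over I ⥤ Over J
  strength : Strength functor

/-- Strong natural transformations: those compatible with the strengths. -/
def IsStrong {I J : E} {P Q : StrongFunctor I J} (φ : P.functor ⟶ Q.functor) : Prop :=
  ∀ (K : E) (a : Over I),
    P.strength.app K a ≫ φ.app (tens K a) = tensMap (𝟙 K) (φ.app a) ≫ Q.strength.app K a

/-- The identity strong functor. -/
def StrongFunctor.id (I : E) : StrongFunctor I I where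
  functor := 𝟭 (Over I)
  strength :=
    { app := fun K a => 𝟙 (tens K a)
      naturality := fun k a b f => by simp
      unit := fun a => by simp
      assoc := fun K L a => by simp [tensMap_id] }

/-- The composite (in diagrammatic order) of strong functors. -/
def StrongFunctor.comp {I J K : E} (P : StrongFunctor I J) (Q : StrongFunctor J K) :
    StrongFunctor I K where
  functor := P.functor ⋙ Q.functor
  strength :=
    { app := fun K a => Q.strength.app K (P.functor.obj a) ≫ Q.functor.map (P.strength.app K a)
      naturality := fun {K L} k a b f => by
        have h := Q.strength.naturality k (P.functor.map f)
        simp only [Functor.comp_map, Functor.comp_obj, reassoc_of% h, Category.assoc,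
          ← Functor.map_comp, P.strength.naturality]
      unit := fun a => by
        simp only [Functor.comp_map, Category.assoc, ← Functor.map_comp, P.strength.unit]
        exact Q.strength.unit _
      assoc := fun K L a => by
        have h := Q.strength.naturality (𝟙 K) (P.strength.app L a)
        have h' := Q.strength.assoc K L (P.functor.obj a)
        have e : tensMap (𝟙 K) (Q.strength.app L (P.functor.obj a) ≫
              Q.functor.map (P.strength.app L a)) =
            tensMap (𝟙 K) (Q.strength.app L (P.functor.obj a)) ≫
              tensMap (𝟙 K) (Q.functor.map (P.strength.app L a)) := by
          rw [← tensMap_comp, Category.comp_id]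
        simp only [Functor.comp_map, Functor.comp_obj, Category.assoc, ← Functor.map_comp,
          P.strength.assoc, e, reassoc_of% h]
        simp only [Functor.map_comp, reassoc_of% h'] }

/-- The dependent sum functor `Σ_u : E/I ⥤ E/J` with its canonical strength. -/
def sumS {I J : E} (u : I ⟶ J) : StrongFunctor I J where
  functor := Over.map u
  strength :=
    { app := fun K a => Over.homMk (𝟙 (K ⨯ a.left)) (by simp [tens])
      naturality := fun {K L} k {a b} f => by
        ext
        show prod.map k f.left ≫ 𝟙 (L ⨯ b.left) = 𝟙 (K ⨯ a.left) ≫ prod.map k f.left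
        simp
      unit := fun a => by
        ext
        show 𝟙 ((⊤_ E) ⨯ a.left) ≫ (prod.snd : (⊤_ E) ⨯ a.left ⟶ a.left) = prod.snd
        simp
      assoc := fun K L a => by
        ext
        show 𝟙 ((K ⨯ L) ⨯ a.left) ≫ (prod.associator K L a.left).hom =
          (prod.associator K L a.left).hom ≫ prod.map (𝟙 K) (𝟙 (L ⨯ a.left)) ≫
            𝟙 (K ⨯ (L ⨯ a.left))
        simp }

/-- The component `(K × A) ×_J I ⟶ K × (A ×_J I)` of the inverse of the strength of `f^*`. -/
def pullTensLeft {I J : E} (f : I ⟶ J) (K : E) (a : Over J) :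
    pullback (tens K a).hom f ⟶ K ⨯ pullback a.hom f :=
  prod.lift (pullback.fst (tens K a).hom f ≫ prod.fst)
    (pullback.lift (pullback.fst (tens K a).hom f ≫ prod.snd) (pullback.snd _ _)
      (by simpa [tens_hom] using pullback.condition (f := (tens K a).hom) (g := f)))

theorem pullTensLeft_fst {I J : E} (f : I ⟶ J) (K : E) (a : Over J) :
    pullTensLeft f K a ≫ prod.fst = pullback.fst (tens K a).hom f ≫ prod.fst :=
  prod.lift_fst _ _

theorem pullTensLeft_snd_fst {I J : E} (f : I ⟶ J) (K : E) (a : Over J) :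
    pullTensLeft f K a ≫ prod.snd ≫ pullback.fst a.hom f =
      pullback.fst (tens K a).hom f ≫ prod.snd := by
  rw [pullTensLeft, prod.lift_snd_assoc, pullback.lift_fst]

theorem pullTensLeft_snd_snd {I J : E} (f : I ⟶ J) (K : E) (a : Over J) :
    pullTensLeft f K a ≫ prod.snd ≫ pullback.snd a.hom f = pullback.snd (tens K a).hom f := by
  rw [pullTensLeft, prod.lift_snd_assoc, pullback.lift_snd]

/-- The map `f^*(K ⊗ a) ⟶ K ⊗ f^* a`, the inverse of the strength of `f^*`. -/
def pullTens {I J : E} (f : I ⟶ J) (K : E) (a : Over J) :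
    (Over.pullback f).obj (tens K a) ⟶ tens K ((Over.pullback f).obj a) :=
  Over.homMk (pullTensLeft f K a) (pullTensLeft_snd_snd f K a)

/-- The component `K × (A ×_J I) ⟶ (K × A) ×_J I` of the strength of `f^*`. -/
def pullStrength {I J : E} (f : I ⟶ J) (K : E) (a : Over J) :
    K ⨯ pullback a.hom f ⟶ pullback (tens K a).hom f :=
  pullback.lift (prod.map (𝟙 K) (pullback.fst a.hom f)) (prod.snd ≫ pullback.snd a.hom f)
    (by simp [pullback.condition])

theorem pullStrength_fst {I J : E} (f : I ⟶ J) (K : E) (a : Over J) :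
    pullStrength f K a ≫ pullback.fst (tens K a).hom f =
      prod.map (𝟙 K) (pullback.fst a.hom f) := pullback.lift_fst _ _ _

theorem pullStrength_snd {I J : E} (f : I ⟶ J) (K : E) (a : Over J) :
    pullStrength f K a ≫ pullback.snd (tens K a).hom f = prod.snd ≫ pullback.snd a.hom f :=
  pullback.lift_snd _ _ _


/-- The action of `f^*` on a morphism `g : a ⟶ b`, as a map `A ×_J I ⟶ B ×_J I`. -/
def pullMap {I J : E} (f : I ⟶ J) {a b : Over J} (g : a ⟶ b) :
    pullback a.hom f ⟶ pullback b.hom f := ((Over.pullback f).map g).left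

theorem pullMap_fst {I J : E} (f : I ⟶ J) {a b : Over J} (g : a ⟶ b) :
    pullMap f g ≫ pullback.fst b.hom f = pullback.fst a.hom f ≫ g.left := pullback.lift_fst _ _ _

theorem pullMap_snd {I J : E} (f : I ⟶ J) {a b : Over J} (g : a ⟶ b) :
    pullMap f g ≫ pullback.snd b.hom f = pullback.snd a.hom f := pullback.lift_snd _ _ _

/-- The pullback functor `f^* : E/J ⥤ E/I` with its canonical strength. -/
def pullS {I J : E} (f : I ⟶ J) : StrongFunctor J I where
  functor := Over.pullback f
  strength :=
    { app := fun K a => Over.homMk (pullStrength f K a) (pullStrength_snd f K a)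
      naturality := fun {K L} k {a b} g => by
        ext
        show prod.map k (pullMap f g) ≫ pullStrength f L b =
          pullStrength f K a ≫ pullMap f (tensMap k g)
        apply pullback.hom_ext
        · simp only [Category.assoc, pullStrength_fst, pullMap_fst]
          rw [reassoc_of% (pullStrength_fst f K a)]
          simp [pullMap_fst]
        · simp only [Category.assoc, pullStrength_snd, pullMap_snd]
          simp [pullMap_snd]
      unit := fun a => by
        ext
        show pullStrength f (⊤_ E) a ≫ pullMap f (tensUnit a) = prod.snd
        apply pullback.hom_ext
        · rw [Category.assoc, pullMap_fst, reassoc_of% (pullStrength_fst f (⊤_ E) a)]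
          simp
        · rw [Category.assoc, pullMap_snd, pullStrength_snd]
      assoc := fun K L a => by
        ext
        show pullStrength f (K ⨯ L) a ≫ pullMap f (tensAssoc K L a) =
          (prod.associator K L (pullback a.hom f)).hom ≫
            prod.map (𝟙 K) (pullStrength f L a) ≫ pullStrength f K (tens L a)
        apply pullback.hom_ext
        · simp only [Category.assoc, pullMap_fst, pullStrength_fst]
          rw [reassoc_of% (pullStrength_fst f (K ⨯ L) a)]
          show prod.map (𝟙 (K ⨯ L)) (pullback.fst a.hom f) ≫ (prod.associator K L a.left).hom =
            (prod.associator K L (pullback a.hom f)).hom ≫ prod.map (𝟙 K) (pullStrength f L a) ≫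
              prod.map (𝟙 K) (pullback.fst (tens L a).hom f)
          rw [prod.map_map, pullStrength_fst]
          simp
        · simp only [Category.assoc, pullMap_snd, pullStrength_snd]
          rw [prod.map_snd_assoc, pullStrength_snd]
          simp [prod.lift_snd_assoc] }

theorem tensUnit_naturality {I : E} {a b : Over I} (g : a ⟶ b) :
    tensMap (𝟙 (⊤_ E)) g ≫ tensUnit b = tensUnit a ≫ g := by
  ext
  show prod.map (𝟙 (⊤_ E)) g.left ≫ prod.snd = prod.snd ≫ g.left
  simp

theorem tensAssoc_naturality {I : E} (K L : E) {a b : Over I} (g : a ⟶ b) :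
    tensMap (𝟙 (K ⨯ L)) g ≫ tensAssoc K L b =
      tensAssoc K L a ≫ tensMap (𝟙 K) (tensMap (𝟙 L) g) := by
  ext
  show prod.map (𝟙 (K ⨯ L)) g.left ≫ (prod.associator K L b.left).hom =
    (prod.associator K L a.left).hom ≫ prod.map (𝟙 K) (prod.map (𝟙 L) g.left)
  simp

theorem pullTens_naturality {I J : E} (f : I ⟶ J) {K L : E} (k : K ⟶ L) {a b : Over J}
    (g : a ⟶ b) : (Over.pullback f).map (tensMap k g) ≫ pullTens f L b =
      pullTens f K a ≫ tensMap k ((Over.pullback f).map g) := by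
  ext
  show pullMap f (tensMap k g) ≫ pullTensLeft f L b = pullTensLeft f K a ≫ prod.map k (pullMap f g)
  apply prod.hom_ext
  · rw [Category.assoc, pullTensLeft_fst, reassoc_of% (pullMap_fst f (tensMap k g)),
      Category.assoc, prod.map_fst, reassoc_of% (pullTensLeft_fst f K a)]
    simp
  · rw [Category.assoc, Category.assoc, prod.map_snd]
    apply pullback.hom_ext
    · rw [Category.assoc, Category.assoc, pullTensLeft_snd_fst, reassoc_of% (pullMap_fst f (tensMap k g)),
        Category.assoc, Category.assoc, pullMap_fst, reassoc_of% (pullTensLeft_snd_fst f K a)]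
      simp
    · rw [Category.assoc, Category.assoc, pullTensLeft_snd_snd, pullMap_snd, Category.assoc,
        Category.assoc,
        pullMap_snd, pullTensLeft_snd_snd]

theorem pullTens_unit {I J : E} (f : I ⟶ J) (a : Over J) :
    pullTens f (⊤_ E) a ≫ tensUnit _ = (Over.pullback f).map (tensUnit a) := by
  ext
  show pullTensLeft f (⊤_ E) a ≫ prod.snd = pullMap f (tensUnit a)
  apply pullback.hom_ext
  · rw [Category.assoc, pullTensLeft_snd_fst, pullMap_fst]
    rfl
  · rw [Category.assoc, pullTensLeft_snd_snd, pullMap_snd]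

theorem pullTens_assoc {I J : E} (f : I ⟶ J) (K L : E) (a : Over J) :
    (Over.pullback f).map (tensAssoc K L a) ≫ pullTens f K (tens L a) ≫
      tensMap (𝟙 K) (pullTens f L a) = pullTens f (K ⨯ L) a ≫ tensAssoc K L _ := by
  have e₁ (M : E) : (prod.associator K L M).hom ≫ prod.fst = prod.fst ≫ prod.fst := by
    simp [prod.lift_fst]
  have e₂ (M : E) : (prod.associator K L M).hom ≫ prod.snd ≫ prod.fst = prod.fst ≫ prod.snd := by
    simp [prod.lift_snd_assoc, prod.lift_fst]
  have e₃ (M : E) : (prod.associator K L M).hom ≫ prod.snd ≫ prod.snd = prod.snd := by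
    simp [prod.lift_snd_assoc, prod.lift_snd]
  have h : pullMap f (tensAssoc K L a) ≫ pullback.fst (tens K (tens L a)).hom f =
    pullback.fst (tens (K ⨯ L) a).hom f ≫ (prod.associator K L a.left).hom := pullMap_fst _ _
  ext
  show pullMap f (tensAssoc K L a) ≫ pullTensLeft f K (tens L a) ≫
    prod.map (𝟙 K) (pullTensLeft f L a) =
      pullTensLeft f (K ⨯ L) a ≫ (prod.associator K L (pullback a.hom f)).hom
  apply prod.hom_ext
  · simp only [Category.assoc, prod.map_fst, Category.comp_id, pullTensLeft_fst, e₁]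
    rw [reassoc_of% h, reassoc_of% (pullTensLeft_fst f (K ⨯ L) a)]
    show _ ≫ (prod.associator K L a.left).hom ≫ (prod.fst : K ⨯ (L ⨯ a.left) ⟶ K) = _
    rw [e₁]
  · simp only [Category.assoc, prod.map_snd]
    apply prod.hom_ext
    · simp only [Category.assoc, pullTensLeft_fst, e₂]
      rw [reassoc_of% (pullTensLeft_snd_fst f K (tens L a)), reassoc_of% h,
        reassoc_of% (pullTensLeft_fst f (K ⨯ L) a)]
      show _ ≫ (prod.associator K L a.left).hom ≫ (prod.snd : K ⨯ (L ⨯ a.left) ⟶ _) ≫ prod.fst = _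
      rw [e₂]
    · simp only [Category.assoc, e₃]
      apply pullback.hom_ext
      · simp only [Category.assoc]
        rw [pullTensLeft_snd_fst, reassoc_of% (pullTensLeft_snd_fst f K (tens L a)),
          reassoc_of% h, pullTensLeft_snd_fst]
        show _ ≫ (prod.associator K L a.left).hom ≫ (prod.snd : K ⨯ (L ⨯ a.left) ⟶ _) ≫
          prod.snd = _
        rw [e₃]
      · simp only [Category.assoc, pullTensLeft_snd_snd, pullMap_snd]

/-! ### The double category of strong functors -/

/-- A square
```
  E/I' --P'--> E/J'
   |Σ_u         |Σ_v
  E/I --P--->  E/J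
```
is a strong natural transformation `Σ_v P' ⟶ P Σ_u`. -/
structure StrongSquare {I' J' I J : E} (u : I' ⟶ I) (v : J' ⟶ J) (P' : StrongFunctor I' J')
    (P : StrongFunctor I J) where
  nat : P'.functor ⋙ Over.map v ⟶ Over.map u ⋙ P.functor
  strong : IsStrong (P := P'.comp (sumS v)) (Q := (sumS u).comp P) nat

/-- The map `K ⊗ Σ_u a ⟶ Σ_u (K ⊗ a)`. -/
def sumTens {I J : E} (u : I ⟶ J) (K : E) (a : Over I) :
    tens K ((Over.map u).obj a) ⟶ (Over.map u).obj (tens K a) := (sumS u).strength.app K a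

theorem sumTens_left {I J : E} (u : I ⟶ J) (K : E) (a : Over I) :
    (sumTens u K a).left = 𝟙 (K ⨯ a.left) := rfl

theorem isStrong_iff {I' J' I J : E} {u : I' ⟶ I} {v : J' ⟶ J} {P' : StrongFunctor I' J'}
    {P : StrongFunctor I J} (φ : P'.functor ⋙ Over.map v ⟶ Over.map u ⋙ P.functor) :
    IsStrong (P := P'.comp (sumS v)) (Q := (sumS u).comp P) φ ↔
      ∀ (K : E) (a : Over I'), (P'.strength.app K a).left ≫ (φ.app (tens K a)).left =
        prod.map (𝟙 K) (φ.app a).left ≫ (P.strength.app K ((Over.map u).obj a)).left ≫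
          (P.functor.map (sumTens u K a)).left := by
  constructor
  · intro h K a
    have := congrArg Over.Hom.left (h K a)
    refine Eq.trans ?_ this
    show _ = (𝟙 (K ⨯ (P'.functor.obj a).left) ≫ (P'.strength.app K a).left) ≫ _
    rw [Category.id_comp]
  · intro h K a
    ext
    refine Eq.trans ?_ (h K a)
    show (𝟙 (K ⨯ (P'.functor.obj a).left) ≫ (P'.strength.app K a).left) ≫
      (φ.app (tens K a)).left = (P'.strength.app K a).left ≫ (φ.app (tens K a)).left
    rw [Category.id_comp]

/-- Squares with the same horizontal boundary and with propositionally equal vertical boundaries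
are equal if their components are. -/
theorem StrongSquare.heq {I' J' I J : E} {u u₁ : I' ⟶ I} {v v₁ : J' ⟶ J}
    {P' : StrongFunctor I' J'} {P : StrongFunctor I J} (hu : u = u₁) (hv : v = v₁)
    (σ : StrongSquare u v P' P) (τ : StrongSquare u₁ v₁ P' P)
    (h : ∀ X : Over I', (σ.nat.app X).left ≫
      (P.functor.map ((Over.mapCongr u u₁ hu).hom.app X)).left = (τ.nat.app X).left) :
    σ ≍ τ := by
  subst hu; subst hv
  have : σ.nat = τ.nat := by
    ext X
    simpa using h X
  cases σ; cases τ; cases this; rfl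

theorem StrongSquare.ext {I' J' I J : E} {u : I' ⟶ I} {v : J' ⟶ J}
    {P' : StrongFunctor I' J'} {P : StrongFunctor I J} (σ τ : StrongSquare u v P' P)
    (h : ∀ X : Over I', (σ.nat.app X).left = (τ.nat.app X).left) : σ = τ := by
  have : σ.nat = τ.nat := by
    ext X
    exact h X
  cases σ; cases τ; cases this; rfl

/-- Two composites of images under a functor between slices agree if the composites agree. -/
theorem map_left_comp {C : Type u} [Category.{v} C] {I J : C} (F : Over I ⥤ Over J) {a b c : Over I} (f : a ⟶ b) (g : b ⟶ c)
    (h : a ⟶ c) (e : f.left ≫ g.left = h.left) :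
    (F.map f).left ≫ (F.map g).left = (F.map h).left := by
  rw [← Over.comp_left, ← F.map_comp]
  congr 2
  ext
  exact e

/-- Variant of `map_left_comp` for commutative squares. -/
theorem map_left_comm {C : Type u} [Category.{v} C] {I J : C} (F : Over I ⥤ Over J)
    {a b b' c : Over I} (f : a ⟶ b) (g : b ⟶ c) (f' : a ⟶ b') (g' : b' ⟶ c)
    (e : f.left ≫ g.left = f'.left ≫ g'.left) :
    (F.map f).left ≫ (F.map g).left = (F.map f').left ≫ (F.map g').left := by
  rw [map_left_comp F f g (f ≫ g) rfl, map_left_comp F f' g' (f ≫ g) e.symm]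

theorem nat_left {C : Type u} [Category.{v} C] {I J : C} {F G : Over I ⥤ Over J} (φ : F ⟶ G)
    {X Y : Over I} (f : X ⟶ Y) :
    (F.map f).left ≫ (φ.app Y).left = (φ.app X).left ≫ (G.map f).left :=
  congrArg Over.Hom.left (φ.naturality f)

theorem Strength.naturality_left {I J : E} {F : Over I ⥤ Over J} (τ : Strength F) {K L : E}
    (k : K ⟶ L) {a b : Over I} (f : a ⟶ b) :
    prod.map k (F.map f).left ≫ (τ.app L b).left =
      (τ.app K a).left ≫ (F.map (tensMap k f)).left :=
  congrArg Over.Hom.left (τ.naturality k f)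

theorem prod_map_id_comp (K : E) {X Y Z : E} (f : X ⟶ Y) (g : Y ⟶ Z) :
    prod.map (𝟙 K) (f ≫ g) = prod.map (𝟙 K) f ≫ prod.map (𝟙 K) g := by
  simp

/-- The underlying data of the double category of all strong functors between slices of `E`:
horizontal arrows from `I` to `J` are strong functors `E/I ⥤ E/J`, and the vertical arrow
`u : I ⟶ J` stands for the dependent sum functor `Σ_u : E/I ⥤ E/J`. -/
def strongGraph (E : Type u) [Category.{v} E] [HasFiniteLimits E] :
    DoubleGraph.{max u v, max u v} E where
  Hor I J := StrongFunctor I J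
  Sq u v P' P := StrongSquare u v P' P
  hid I := StrongFunctor.id I
  hcomp P Q := P.comp Q

/-- The vertical identity square on `P`: the isomorphism `Σ_1 P ≅ P ≅ P Σ_1`. -/
def vidSquare {I J : E} (P : StrongFunctor I J) : StrongSquare (𝟙 I) (𝟙 J) P P where
  nat :=
    { app := fun X => (Over.mapId J).hom.app (P.functor.obj X) ≫
        P.functor.map ((Over.mapId I).inv.app X)
      naturality := fun X Y f => by
        ext
        show (P.functor.map f).left ≫ 𝟙 _ ≫ (P.functor.map ((Over.mapId I).inv.app Y)).left =
          (𝟙 _ ≫ (P.functor.map ((Over.mapId I).inv.app X)).left) ≫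
            (P.functor.map ((Over.map (𝟙 I)).map f)).left
        rw [Category.id_comp, Category.id_comp]
        apply map_left_comm
        simp }
  strong := (isStrong_iff _).2 fun K a => by
    show (P.strength.app K a).left ≫ 𝟙 _ ≫ (P.functor.map ((Over.mapId I).inv.app (tens K a))).left
      = prod.map (𝟙 K) (𝟙 _ ≫ (P.functor.map ((Over.mapId I).inv.app a)).left) ≫
        (P.strength.app K ((Over.map (𝟙 I)).obj a)).left ≫
          (P.functor.map (sumTens (𝟙 I) K a)).left
    rw [Category.id_comp, Category.id_comp, reassoc_of% (P.strength.naturality_left (𝟙 K)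
      ((Over.mapId I).inv.app a))]
    congr 1
    refine (map_left_comp _ _ _ _ ?_).symm
    simp [sumTens_left]

/-- The vertical composite of two squares: the pasting
`Σ_v' Σ_v L ⟶ Σ_v' M Σ_u ⟶ N Σ_u' Σ_u`. -/
def vcompSquare {I₁ J₁ I₂ J₂ I₃ J₃ : E} {u : I₁ ⟶ I₂} {v : J₁ ⟶ J₂} {u' : I₂ ⟶ I₃} {v' : J₂ ⟶ J₃}
    {L : StrongFunctor I₁ J₁} {M : StrongFunctor I₂ J₂} {N : StrongFunctor I₃ J₃}
    (σ : StrongSquare u v L M) (τ : StrongSquare u' v' M N) :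
    StrongSquare (u ≫ u') (v ≫ v') L N where
  nat :=
    { app := fun X => (Over.mapComp v v').hom.app (L.functor.obj X) ≫
        (Over.map v').map (σ.nat.app X) ≫ τ.nat.app ((Over.map u).obj X) ≫
          N.functor.map ((Over.mapComp u u').inv.app X)
      naturality := fun X Y f => by
        ext
        show (L.functor.map f).left ≫ 𝟙 _ ≫ (σ.nat.app Y).left ≫
            (τ.nat.app ((Over.map u).obj Y)).left ≫
            (N.functor.map ((Over.mapComp u u').inv.app Y)).left =
          (𝟙 _ ≫ (σ.nat.app X).left ≫ (τ.nat.app ((Over.map u).obj X)).left ≫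
            (N.functor.map ((Over.mapComp u u').inv.app X)).left) ≫
            (N.functor.map ((Over.map (u ≫ u')).map f)).left
        have h₁ : (L.functor.map f).left ≫ (σ.nat.app Y).left =
          (σ.nat.app X).left ≫ (M.functor.map ((Over.map u).map f)).left := nat_left σ.nat f
        have h₂ : (M.functor.map ((Over.map u).map f)).left ≫
            (τ.nat.app ((Over.map u).obj Y)).left = (τ.nat.app ((Over.map u).obj X)).left ≫
              (N.functor.map ((Over.map u').map ((Over.map u).map f))).left :=
          nat_left τ.nat ((Over.map u).map f)
        simp only [Category.id_comp, Category.assoc]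
        rw [reassoc_of% h₁, reassoc_of% h₂]
        congr 2
        apply map_left_comm
        simp }
  strong := (isStrong_iff _).2 fun K a => by
    show (L.strength.app K a).left ≫ 𝟙 _ ≫ (σ.nat.app (tens K a)).left ≫
        (τ.nat.app ((Over.map u).obj (tens K a))).left ≫
        (N.functor.map ((Over.mapComp u u').inv.app (tens K a))).left =
      prod.map (𝟙 K) (𝟙 _ ≫ (σ.nat.app a).left ≫ (τ.nat.app ((Over.map u).obj a)).left ≫
        (N.functor.map ((Over.mapComp u u').inv.app a)).left) ≫
      (N.strength.app K ((Over.map (u ≫ u')).obj a)).left ≫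
        (N.functor.map (sumTens (u ≫ u') K a)).left
    have hσ := (isStrong_iff _).1 σ.strong K a
    have hτ := (isStrong_iff _).1 τ.strong K ((Over.map u).obj a)
    have e : (M.functor.map (sumTens u K a)).left ≫
        (τ.nat.app ((Over.map u).obj (tens K a))).left =
      (τ.nat.app (tens K ((Over.map u).obj a))).left ≫
        (N.functor.map ((Over.map u').map (sumTens u K a))).left := nat_left τ.nat (sumTens u K a)
    rw [Category.id_comp, Category.id_comp, reassoc_of% hσ, reassoc_of% e, reassoc_of% hτ,
      prod_map_id_comp, prod_map_id_comp, Category.assoc, Category.assoc,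
      reassoc_of% (N.strength.naturality_left (𝟙 K) ((Over.mapComp u u').inv.app a))]
    congr 3
    rw [map_left_comp N.functor (tensMap (𝟙 K) ((Over.mapComp u u').inv.app a))
        (sumTens (u ≫ u') K a) ((sumTens u' K ((Over.map u).obj a) ≫
          (Over.map u').map (sumTens u K a)) ≫ (Over.mapComp u u').inv.app (tens K a))
        (by simp [sumTens_left]),
      N.functor.map_comp, N.functor.map_comp, Over.comp_left, Over.comp_left, Category.assoc]

/-- The horizontal identity square `Σ_u ⟶ Σ_u`. -/
def hidSquare {I' I : E} (u : I' ⟶ I) :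
    StrongSquare u u (StrongFunctor.id I') (StrongFunctor.id I) where
  nat :=
    { app := fun X => 𝟙 ((Over.map u).obj X)
      naturality := fun X Y f => by
        show (Over.map u).map f ≫ 𝟙 _ = 𝟙 _ ≫ (Over.map u).map f
        rw [Category.comp_id, Category.id_comp] }
  strong := (isStrong_iff _).2 fun K a => by
    show 𝟙 _ ≫ 𝟙 _ = prod.map (𝟙 K) (𝟙 _) ≫ 𝟙 _ ≫ 𝟙 _
    simp

/-- The horizontal composite of two squares: the pasting `Σ_w N' M' ⟶ N Σ_v M' ⟶ N M Σ_u`. -/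
def hcompSquare {I' J' K' I J K : E} {u : I' ⟶ I} {v : J' ⟶ J} {w : K' ⟶ K}
    {M' : StrongFunctor I' J'} {N' : StrongFunctor J' K'} {M : StrongFunctor I J}
    {N : StrongFunctor J K} (σ : StrongSquare u v M' M) (τ : StrongSquare v w N' N) :
    StrongSquare u w (M'.comp N') (M.comp N) where
  nat :=
    { app := fun X => τ.nat.app (M'.functor.obj X) ≫ N.functor.map (σ.nat.app X)
      naturality := fun X Y f => by
        ext
        show (N'.functor.map (M'.functor.map f)).left ≫
            (τ.nat.app (M'.functor.obj Y)).left ≫ (N.functor.map (σ.nat.app Y)).left =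
          ((τ.nat.app (M'.functor.obj X)).left ≫ (N.functor.map (σ.nat.app X)).left) ≫
            (N.functor.map (M.functor.map ((Over.map u).map f))).left
        have h : (N'.functor.map (M'.functor.map f)).left ≫
            (τ.nat.app (M'.functor.obj Y)).left = (τ.nat.app (M'.functor.obj X)).left ≫
              (N.functor.map ((Over.map v).map (M'.functor.map f))).left :=
          nat_left τ.nat (M'.functor.map f)
        rw [reassoc_of% h, Category.assoc]
        congr 1
        exact map_left_comm _ _ _ _ _ (nat_left σ.nat f) }
  strong := (isStrong_iff _).2 fun K a => by
    show ((N'.strength.app K (M'.functor.obj a)).left ≫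
        (N'.functor.map (M'.strength.app K a)).left) ≫
        (τ.nat.app (M'.functor.obj (tens K a))).left ≫
          (N.functor.map (σ.nat.app (tens K a))).left =
      prod.map (𝟙 K) ((τ.nat.app (M'.functor.obj a)).left ≫ (N.functor.map (σ.nat.app a)).left) ≫
        ((N.strength.app K (M.functor.obj ((Over.map u).obj a))).left ≫
          (N.functor.map (M.strength.app K ((Over.map u).obj a))).left) ≫
        (N.functor.map (M.functor.map (sumTens u K a))).left
    have hσ := (isStrong_iff _).1 σ.strong K a
    have hτ := (isStrong_iff _).1 τ.strong K (M'.functor.obj a)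
    have e : (N'.functor.map (M'.strength.app K a)).left ≫
        (τ.nat.app (M'.functor.obj (tens K a))).left =
      (τ.nat.app (tens K (M'.functor.obj a))).left ≫
        (N.functor.map ((Over.map v).map (M'.strength.app K a))).left :=
      nat_left τ.nat (M'.strength.app K a)
    rw [Category.assoc, reassoc_of% e, reassoc_of% hτ, prod_map_id_comp, Category.assoc,
      Category.assoc, reassoc_of% (N.strength.naturality_left (𝟙 K) (σ.nat.app a))]
    congr 2
    rw [map_left_comp N.functor ((Over.map v).map (M'.strength.app K a)) (σ.nat.app (tens K a))
        (_ ≫ _) rfl,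
      map_left_comp N.functor (M.strength.app K ((Over.map u).obj a))
        (M.functor.map (sumTens u K a)) (_ ≫ _) rfl]
    apply map_left_comm
    rw [sumTens_left]
    exact (Category.id_comp _).trans hσ

/-- A square with identity vertical boundary, given by a strong natural transformation `P ⟶ Q`. -/
def globSquare {I J : E} {P Q : StrongFunctor I J} (φ : P.functor ⟶ Q.functor)
    (hφ : IsStrong (P := P) (Q := Q) φ) : StrongSquare (𝟙 I) (𝟙 J) P Q where
  nat :=
    { app := fun X => (Over.mapId J).hom.app (P.functor.obj X) ≫ φ.app X ≫
        Q.functor.map ((Over.mapId I).inv.app X)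
      naturality := fun X Y f => by
        ext
        show (P.functor.map f).left ≫ 𝟙 _ ≫ (φ.app Y).left ≫
            (Q.functor.map ((Over.mapId I).inv.app Y)).left =
          (𝟙 _ ≫ (φ.app X).left ≫ (Q.functor.map ((Over.mapId I).inv.app X)).left) ≫
            (Q.functor.map ((Over.map (𝟙 I)).map f)).left
        simp only [Category.id_comp, Category.assoc]
        rw [reassoc_of% (nat_left φ f)]
        congr 1
        apply map_left_comm
        simp }
  strong := (isStrong_iff _).2 fun K a => by
    show (P.strength.app K a).left ≫ 𝟙 _ ≫ (φ.app (tens K a)).left ≫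
        (Q.functor.map ((Over.mapId I).inv.app (tens K a))).left
      = prod.map (𝟙 K) (𝟙 _ ≫ (φ.app a).left ≫ (Q.functor.map ((Over.mapId I).inv.app a)).left) ≫
        (Q.strength.app K ((Over.map (𝟙 I)).obj a)).left ≫
          (Q.functor.map (sumTens (𝟙 I) K a)).left
    have h : (P.strength.app K a).left ≫ (φ.app (tens K a)).left =
      prod.map (𝟙 K) (φ.app a).left ≫ (Q.strength.app K a).left := congrArg Over.Hom.left (hφ K a)
    rw [Category.id_comp, Category.id_comp, reassoc_of% h, prod_map_id_comp, Category.assoc,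
      reassoc_of% (Q.strength.naturality_left (𝟙 K) ((Over.mapId I).inv.app a))]
    congr 2
    refine (map_left_comp _ _ _ _ ?_).symm
    simp [sumTens_left]

theorem vidSquare_app {I J : E} (P : StrongFunctor I J) (X : Over I) :
    ((vidSquare P).nat.app X).left = (P.functor.map ((Over.mapId I).inv.app X)).left :=
  Category.id_comp _

theorem vcompSquare_app {I₁ J₁ I₂ J₂ I₃ J₃ : E} {u : I₁ ⟶ I₂} {v : J₁ ⟶ J₂} {u' : I₂ ⟶ I₃}
    {v' : J₂ ⟶ J₃} {L : StrongFunctor I₁ J₁} {M : StrongFunctor I₂ J₂} {N : StrongFunctor I₃ J₃}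
    (σ : StrongSquare u v L M) (τ : StrongSquare u' v' M N) (X : Over I₁) :
    ((vcompSquare σ τ).nat.app X).left =
      (σ.nat.app X).left ≫ (τ.nat.app ((Over.map u).obj X)).left ≫
        (N.functor.map ((Over.mapComp u u').inv.app X)).left :=
  Category.id_comp _

theorem hidSquare_app {I' I : E} (u : I' ⟶ I) (X : Over I') :
    ((hidSquare u).nat.app X).left = 𝟙 X.left := rfl

theorem hcompSquare_app {I' J' K' I J K : E} {u : I' ⟶ I} {v : J' ⟶ J} {w : K' ⟶ K}
    {M' : StrongFunctor I' J'} {N' : StrongFunctor J' K'} {M : StrongFunctor I J}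
    {N : StrongFunctor J K} (σ : StrongSquare u v M' M) (τ : StrongSquare v w N' N) (X : Over I') :
    ((hcompSquare σ τ).nat.app X).left = (τ.nat.app (M'.functor.obj X)).left ≫
      (N.functor.map (σ.nat.app X)).left := rfl

theorem globSquare_app {I J : E} {P Q : StrongFunctor I J} (φ : P.functor ⟶ Q.functor)
    (hφ : IsStrong (P := P) (Q := Q) φ) (X : Over I) : ((globSquare φ hφ).nat.app X).left =
      (φ.app X).left ≫ (Q.functor.map ((Over.mapId I).inv.app X)).left :=
  Category.id_comp _

theorem isStrong_of_left {I J : E} {P Q : StrongFunctor I J} (φ : P.functor ⟶ Q.functor)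
    (h : ∀ (K : E) (a : Over I), (P.strength.app K a).left ≫ (φ.app (tens K a)).left =
      prod.map (𝟙 K) (φ.app a).left ≫ (Q.strength.app K a).left) :
    IsStrong (P := P) (Q := Q) φ := fun K a => Over.OverMorphism.ext (h K a)

/-- The associativity square, with identity components. -/
def assocSquare {I J K L : E} (M : StrongFunctor I J) (N : StrongFunctor J K)
    (P : StrongFunctor K L) :
    StrongSquare (𝟙 I) (𝟙 L) ((M.comp N).comp P) (M.comp (N.comp P)) :=
  globSquare (P := (M.comp N).comp P) (Q := M.comp (N.comp P))
    (𝟙 (M.functor ⋙ N.functor ⋙ P.functor)) (isStrong_of_left _ fun X a => by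
      show (P.strength.app X _ ≫ P.functor.map (N.strength.app X _ ≫
        N.functor.map (M.strength.app X a))).left ≫ 𝟙 _ = prod.map (𝟙 X) (𝟙 _) ≫
        ((P.strength.app X _ ≫ P.functor.map (N.strength.app X _)) ≫
          P.functor.map (N.functor.map (M.strength.app X a))).left
      rw [Category.comp_id, prod.map_id_id, Category.id_comp, Functor.map_comp, Category.assoc])

def assocInvSquare {I J K L : E} (M : StrongFunctor I J) (N : StrongFunctor J K)
    (P : StrongFunctor K L) :
    StrongSquare (𝟙 I) (𝟙 L) (M.comp (N.comp P)) ((M.comp N).comp P) :=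
  globSquare (P := M.comp (N.comp P)) (Q := (M.comp N).comp P)
    (𝟙 (M.functor ⋙ N.functor ⋙ P.functor)) (isStrong_of_left _ fun X a => by
      show ((P.strength.app X _ ≫ P.functor.map (N.strength.app X _)) ≫
          P.functor.map (N.functor.map (M.strength.app X a))).left ≫ 𝟙 _ =
        prod.map (𝟙 X) (𝟙 _) ≫ (P.strength.app X _ ≫ P.functor.map (N.strength.app X _ ≫
          N.functor.map (M.strength.app X a))).left
      rw [Category.comp_id, prod.map_id_id, Category.id_comp, Functor.map_comp, Category.assoc])

/-- The left unit square, with identity components. -/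
def leftUnitSquare {I J : E} (M : StrongFunctor I J) :
    StrongSquare (𝟙 I) (𝟙 J) ((StrongFunctor.id I).comp M) M :=
  globSquare (P := (StrongFunctor.id I).comp M) (Q := M) (𝟙 M.functor)
    (isStrong_of_left _ fun X a => by
      show (M.strength.app X a ≫ M.functor.map (𝟙 (tens X a))).left ≫ 𝟙 _ =
        prod.map (𝟙 X) (𝟙 _) ≫ (M.strength.app X a).left
      rw [Category.comp_id, prod.map_id_id, Category.id_comp,
        CategoryTheory.Functor.map_id, Category.comp_id])

def leftUnitInvSquare {I J : E} (M : StrongFunctor I J) :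
    StrongSquare (𝟙 I) (𝟙 J) M ((StrongFunctor.id I).comp M) :=
  globSquare (P := M) (Q := (StrongFunctor.id I).comp M) (𝟙 M.functor)
    (isStrong_of_left _ fun X a => by
      show (M.strength.app X a).left ≫ 𝟙 _ =
        prod.map (𝟙 X) (𝟙 _) ≫ (M.strength.app X a ≫ M.functor.map (𝟙 (tens X a))).left
      rw [Category.comp_id, prod.map_id_id, Category.id_comp,
        CategoryTheory.Functor.map_id, Category.comp_id])

/-- The right unit square, with identity components. -/
def rightUnitSquare {I J : E} (M : StrongFunctor I J) :
    StrongSquare (𝟙 I) (𝟙 J) (M.comp (StrongFunctor.id J)) M :=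
  globSquare (P := M.comp (StrongFunctor.id J)) (Q := M) (𝟙 M.functor)
    (isStrong_of_left _ fun X a => by
      show (𝟙 (tens X (M.functor.obj a)) ≫ M.strength.app X a).left ≫ 𝟙 _ =
        prod.map (𝟙 X) (𝟙 _) ≫ (M.strength.app X a).left
      rw [Category.comp_id, prod.map_id_id, Category.id_comp, Category.id_comp])

def rightUnitInvSquare {I J : E} (M : StrongFunctor I J) :
    StrongSquare (𝟙 I) (𝟙 J) M (M.comp (StrongFunctor.id J)) :=
  globSquare (P := M) (Q := M.comp (StrongFunctor.id J)) (𝟙 M.functor)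
    (isStrong_of_left _ fun X a => by
      show (M.strength.app X a).left ≫ 𝟙 _ =
        prod.map (𝟙 X) (𝟙 _) ≫ (𝟙 (tens X (M.functor.obj a)) ≫ M.strength.app X a).left
      rw [Category.comp_id, prod.map_id_id, Category.id_comp, Category.id_comp])

theorem map_left_id {C : Type u} [Category.{v} C] {I J : C} (F : Over I ⥤ Over J)
    {a : Over I} (f : a ⟶ a) (e : f.left = 𝟙 _) : (F.map f).left = 𝟙 _ := by
  have : f = 𝟙 a := Over.OverMorphism.ext e
  rw [this, F.map_id]
  rfl

theorem vid_vcompSquare {I' J' I J : E} {u : I' ⟶ I} {v : J' ⟶ J} {M : StrongFunctor I' J'}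
    {N : StrongFunctor I J} (σ : StrongSquare u v M N) : vcompSquare (vidSquare M) σ ≍ σ :=
  StrongSquare.heq (Category.id_comp _) (Category.id_comp _) _ _ fun X => by
    have h : (M.functor.map ((Over.mapId I').inv.app X)).left ≫
        (σ.nat.app ((Over.map (𝟙 I')).obj X)).left = (σ.nat.app X).left ≫
          (N.functor.map ((Over.map u).map ((Over.mapId I').inv.app X))).left := nat_left σ.nat _
    rw [vcompSquare_app, vidSquare_app, reassoc_of% h, Category.assoc, Category.assoc,
      map_left_comp N.functor _ _ (_ ≫ _) rfl, map_left_comp N.functor _ _ (_ ≫ _) rfl,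
      map_left_id N.functor _ (by simp)]
    exact Category.comp_id _

theorem vcomp_vidSquare {I' J' I J : E} {u : I' ⟶ I} {v : J' ⟶ J} {M : StrongFunctor I' J'}
    {N : StrongFunctor I J} (σ : StrongSquare u v M N) : vcompSquare σ (vidSquare N) ≍ σ :=
  StrongSquare.heq (Category.comp_id _) (Category.comp_id _) _ _ fun X => by
    rw [vcompSquare_app, vidSquare_app, Category.assoc, Category.assoc,
      map_left_comp N.functor _ _ (_ ≫ _) rfl, map_left_comp N.functor _ _ (_ ≫ _) rfl,
      map_left_id N.functor _ (by simp)]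
    exact Category.comp_id _

theorem vcompSquare_assoc {I₁ J₁ I₂ J₂ I₃ J₃ I₄ J₄ : E} {u : I₁ ⟶ I₂} {v : J₁ ⟶ J₂} {u' : I₂ ⟶ I₃}
    {v' : J₂ ⟶ J₃} {u'' : I₃ ⟶ I₄} {v'' : J₃ ⟶ J₄} {L : StrongFunctor I₁ J₁}
    {M : StrongFunctor I₂ J₂} {N : StrongFunctor I₃ J₃} {P : StrongFunctor I₄ J₄}
    (σ : StrongSquare u v L M) (τ : StrongSquare u' v' M N) (ρ : StrongSquare u'' v'' N P) :
    vcompSquare (vcompSquare σ τ) ρ ≍ vcompSquare σ (vcompSquare τ ρ) :=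
  StrongSquare.heq (Category.assoc _ _ _) (Category.assoc _ _ _) _ _ fun X => by
    have h : (N.functor.map ((Over.mapComp u u').inv.app X)).left ≫
        (ρ.nat.app ((Over.map (u ≫ u')).obj X)).left =
      (ρ.nat.app ((Over.map u').obj ((Over.map u).obj X))).left ≫
          (P.functor.map ((Over.map u'').map ((Over.mapComp u u').inv.app X))).left :=
      nat_left ρ.nat _
    simp only [vcompSquare_app, Category.assoc]
    rw [reassoc_of% h]
    congr 3
    rw [map_left_comp P.functor _ _ (_ ≫ _) rfl, map_left_comp P.functor _ _ (_ ≫ _) rfl]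
    apply Eq.symm
    apply map_left_comp
    simp

theorem hidSquare_id (I : E) : hidSquare (𝟙 I) = vidSquare (StrongFunctor.id I) :=
  StrongSquare.ext _ _ fun X => by
    rw [hidSquare_app, vidSquare_app]
    rfl

theorem hidSquare_comp {I₁ I₂ I₃ : E} (u : I₁ ⟶ I₂) (u' : I₂ ⟶ I₃) :
    hidSquare (u ≫ u') = vcompSquare (hidSquare u) (hidSquare u') :=
  StrongSquare.ext _ _ fun X => by
    rw [hidSquare_app, vcompSquare_app, hidSquare_app, hidSquare_app]
    show 𝟙 X.left = 𝟙 X.left ≫ 𝟙 X.left ≫ 𝟙 X.left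
    simp

theorem hcompSquare_vid {I J K : E} (M : StrongFunctor I J) (N : StrongFunctor J K) :
    hcompSquare (vidSquare M) (vidSquare N) = vidSquare (M.comp N) :=
  StrongSquare.ext _ _ fun X => by
    rw [hcompSquare_app, vidSquare_app, vidSquare_app]
    apply map_left_comp
    rw [vidSquare_app]
    exact Category.id_comp _

theorem square_interchange {I₁ J₁ K₁ I₂ J₂ K₂ I₃ J₃ K₃ : E} {u : I₁ ⟶ I₂} {v : J₁ ⟶ J₂}
    {w : K₁ ⟶ K₂} {u' : I₂ ⟶ I₃} {v' : J₂ ⟶ J₃} {w' : K₂ ⟶ K₃} {M₁ : StrongFunctor I₁ J₁}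
    {N₁ : StrongFunctor J₁ K₁} {M₂ : StrongFunctor I₂ J₂} {N₂ : StrongFunctor J₂ K₂}
    {M₃ : StrongFunctor I₃ J₃} {N₃ : StrongFunctor J₃ K₃} (σ : StrongSquare u v M₁ M₂)
    (σ' : StrongSquare v w N₁ N₂) (τ : StrongSquare u' v' M₂ M₃) (τ' : StrongSquare v' w' N₂ N₃) :
    hcompSquare (vcompSquare σ τ) (vcompSquare σ' τ') =
      vcompSquare (hcompSquare σ σ') (hcompSquare τ τ') :=
  StrongSquare.ext _ _ fun X => by
    have h : (N₂.functor.map (σ.nat.app X)).left ≫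
        (τ'.nat.app (M₂.functor.obj ((Over.map u).obj X))).left =
      (τ'.nat.app ((Over.map v).obj (M₁.functor.obj X))).left ≫
          (N₃.functor.map ((Over.map v').map (σ.nat.app X))).left :=
      nat_left τ'.nat _
    rw [hcompSquare_app, vcompSquare_app, vcompSquare_app, hcompSquare_app, hcompSquare_app]
    show ((σ'.nat.app (M₁.functor.obj X)).left ≫
        (τ'.nat.app ((Over.map v).obj (M₁.functor.obj X))).left ≫
        (N₃.functor.map ((Over.mapComp v v').inv.app (M₁.functor.obj X))).left) ≫
        (N₃.functor.map ((vcompSquare σ τ).nat.app X)).left =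
      ((σ'.nat.app (M₁.functor.obj X)).left ≫ (N₂.functor.map (σ.nat.app X)).left) ≫
        ((τ'.nat.app (M₂.functor.obj ((Over.map u).obj X))).left ≫
          (N₃.functor.map (τ.nat.app ((Over.map u).obj X))).left) ≫
        (N₃.functor.map (M₃.functor.map ((Over.mapComp u u').inv.app X))).left
    simp only [Category.assoc]
    rw [reassoc_of% h]
    congr 2
    rw [map_left_comp N₃.functor (τ.nat.app ((Over.map u).obj X))
        (M₃.functor.map ((Over.mapComp u u').inv.app X)) (_ ≫ _) rfl]
    apply map_left_comm
    rw [vcompSquare_app]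
    exact Category.id_comp _

theorem globSquare_heq_vid {I J : E} {P Q : StrongFunctor I J} (φ : P.functor ⟶ Q.functor)
    (hφ : IsStrong (P := P) (Q := Q) φ) (ψ : Q.functor ⟶ P.functor)
    (hψ : IsStrong (P := Q) (Q := P) ψ) (h : φ ≫ ψ = 𝟙 _) :
    vcompSquare (globSquare φ hφ) (globSquare ψ hψ) ≍ vidSquare P :=
  StrongSquare.heq (Category.comp_id _) (Category.comp_id _) _ _ fun X => by
    have h₂ : (Q.functor.map ((Over.mapId I).inv.app X)).left ≫
        (ψ.app ((Over.map (𝟙 I)).obj X)).left = (ψ.app X).left ≫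
          (P.functor.map ((Over.mapId I).inv.app X)).left := nat_left ψ _
    have h₃ : (φ.app X).left ≫ (ψ.app X).left = 𝟙 _ := by
      rw [← Over.comp_left, ← NatTrans.comp_app, h]
      rfl
    rw [vcompSquare_app, vidSquare_app, globSquare_app, globSquare_app]
    simp only [Category.assoc]
    rw [reassoc_of% h₂, reassoc_of% h₃,
      map_left_comp P.functor _ _ (_ ≫ _) rfl, map_left_comp P.functor _ _ (_ ≫ _) rfl]
    apply map_left_comp
    simp

theorem globSquare_naturality {I' J' I J : E} {u : I' ⟶ I} {v : J' ⟶ J}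
    {P' Q' : StrongFunctor I' J'} {P Q : StrongFunctor I J} (σ : StrongSquare u v P' P)
    (τ : StrongSquare u v Q' Q) (φ : P.functor ⟶ Q.functor)
    (hφ : IsStrong (P := P) (Q := Q) φ) (φ' : P'.functor ⟶ Q'.functor)
    (hφ' : IsStrong (P := P') (Q := Q') φ')
    (h : ∀ X : Over I', (σ.nat.app X).left ≫ (φ.app ((Over.map u).obj X)).left =
      (φ'.app X).left ≫ (τ.nat.app X).left) :
    vcompSquare σ (globSquare φ hφ) ≍ vcompSquare (globSquare φ' hφ') τ :=
  StrongSquare.heq ((Category.comp_id u).trans (Category.id_comp u).symm)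
    ((Category.comp_id v).trans (Category.id_comp v).symm) _ _ fun X => by
    have h₂ : (Q'.functor.map ((Over.mapId I').inv.app X)).left ≫
        (τ.nat.app ((Over.map (𝟙 I')).obj X)).left = (τ.nat.app X).left ≫
          (Q.functor.map ((Over.map u).map ((Over.mapId I').inv.app X))).left := nat_left τ.nat _
    rw [vcompSquare_app, vcompSquare_app, globSquare_app, globSquare_app]
    simp only [Category.assoc]
    rw [reassoc_of% h₂, reassoc_of% (h X)]
    congr 2
    rw [map_left_comp Q.functor _ _ (_ ≫ _) rfl, map_left_comp Q.functor _ _ (_ ≫ _) rfl]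
    apply Eq.symm
    apply map_left_comp
    simp

/-- Morphisms of the form `eqToHom`. -/
def IsEqToHom {C : Type u} [Category.{v} C] {X Y : C} (f : X ⟶ Y) : Prop :=
  ∃ h : X = Y, f = eqToHom h

theorem IsEqToHom.id {C : Type u} [Category.{v} C] (X : C) : IsEqToHom (𝟙 X) := ⟨rfl, rfl⟩

theorem IsEqToHom.comp {C : Type u} [Category.{v} C] {X Y Z : C} {f : X ⟶ Y} {g : Y ⟶ Z}
    (hf : IsEqToHom f) (hg : IsEqToHom g) : IsEqToHom (f ≫ g) := by
  obtain ⟨rfl, rfl⟩ := hf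
  obtain ⟨rfl, rfl⟩ := hg
  exact ⟨rfl, by simp⟩

theorem IsEqToHom.map {C : Type u} [Category.{v} C] {I J : C} (F : Over I ⥤ Over J) {X Y : Over I} {f : X ⟶ Y}
    (hf : IsEqToHom f) : IsEqToHom (F.map f) := by
  obtain ⟨rfl, rfl⟩ := hf
  exact ⟨rfl, by simp⟩

theorem IsEqToHom.of_left {C : Type u} [Category.{v} C] {I A : C} {x y : A ⟶ I} (h : x = y) (f : Over.mk x ⟶ Over.mk y)
    (e : f.left = 𝟙 A) : IsEqToHom f := by
  subst h
  exact ⟨rfl, Over.OverMorphism.ext e⟩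

theorem isEqToHom_mapId_hom {C : Type u} [Category.{v} C] {I : C} (X : Over I) : IsEqToHom ((Over.mapId I).hom.app X) :=
  IsEqToHom.of_left (Category.comp_id X.hom) _ rfl

theorem isEqToHom_mapId_inv {C : Type u} [Category.{v} C] {I : C} (X : Over I) : IsEqToHom ((Over.mapId I).inv.app X) :=
  IsEqToHom.of_left (Category.comp_id X.hom).symm _ rfl

theorem isEqToHom_mapComp_hom {C : Type u} [Category.{v} C] {I J K : C} (u : I ⟶ J) (u' : J ⟶ K) (X : Over I) :
    IsEqToHom ((Over.mapComp u u').hom.app X) :=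
  IsEqToHom.of_left (Category.assoc _ _ _).symm _ rfl

theorem isEqToHom_mapComp_inv {C : Type u} [Category.{v} C] {I J K : C} (u : I ⟶ J) (u' : J ⟶ K) (X : Over I) :
    IsEqToHom ((Over.mapComp u u').inv.app X) :=
  IsEqToHom.of_left (Category.assoc _ _ _) _ rfl

theorem IsEqToHom.eq {C : Type u} [Category.{v} C] {X Y : C} {f g : X ⟶ Y} (hf : IsEqToHom f)
    (hg : IsEqToHom g) : f = g := by
  obtain ⟨rfl, rfl⟩ := hf
  obtain ⟨_, rfl⟩ := hg
  rfl

/-- Squares all of whose components are structural identifications. -/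
def StrongSquare.IsStructural {I' J' I J : E} {u : I' ⟶ I} {v : J' ⟶ J}
    {P' : StrongFunctor I' J'} {P : StrongFunctor I J} (σ : StrongSquare u v P' P) : Prop :=
  ∀ X, IsEqToHom (σ.nat.app X)

theorem StrongSquare.IsStructural.heq {I' J' I J : E} {u u₁ : I' ⟶ I} {v v₁ : J' ⟶ J}
    {P' : StrongFunctor I' J'} {P : StrongFunctor I J} {σ : StrongSquare u v P' P}
    {τ : StrongSquare u₁ v₁ P' P} (hσ : σ.IsStructural) (hτ : τ.IsStructural) (hu : u = u₁)
    (hv : v = v₁) : σ ≍ τ := by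
  subst hu; subst hv
  exact heq_of_eq (StrongSquare.ext _ _ fun X => congrArg Over.Hom.left ((hσ X).eq (hτ X)))

theorem vidSquare_isStructural {I J : E} (P : StrongFunctor I J) : (vidSquare P).IsStructural :=
  fun X => (isEqToHom_mapId_hom _).comp ((isEqToHom_mapId_inv X).map P.functor)

theorem vcompSquare_isStructural {I₁ J₁ I₂ J₂ I₃ J₃ : E} {u : I₁ ⟶ I₂} {v : J₁ ⟶ J₂} {u' : I₂ ⟶ I₃}
    {v' : J₂ ⟶ J₃} {L : StrongFunctor I₁ J₁} {M : StrongFunctor I₂ J₂} {N : StrongFunctor I₃ J₃}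
    {σ : StrongSquare u v L M} {τ : StrongSquare u' v' M N} (hσ : σ.IsStructural)
    (hτ : τ.IsStructural) : (vcompSquare σ τ).IsStructural :=
  fun X => (isEqToHom_mapComp_hom _ _ _).comp (((hσ X).map (Over.map v')).comp
    ((hτ _).comp ((isEqToHom_mapComp_inv u u' X).map N.functor)))

theorem hcompSquare_isStructural {I' J' K' I J K : E} {u : I' ⟶ I} {v : J' ⟶ J} {w : K' ⟶ K}
    {M' : StrongFunctor I' J'} {N' : StrongFunctor J' K'} {M : StrongFunctor I J}
    {N : StrongFunctor J K} {σ : StrongSquare u v M' M} {τ : StrongSquare v w N' N}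
    (hσ : σ.IsStructural) (hτ : τ.IsStructural) : (hcompSquare σ τ).IsStructural :=
  fun X => (hτ _).comp ((hσ X).map N.functor)

theorem globSquare_isStructural {I J : E} {P Q : StrongFunctor I J} (φ : P.functor ⟶ Q.functor)
    (hφ : IsStrong (P := P) (Q := Q) φ) (h : ∀ X, IsEqToHom (φ.app X)) :
    (globSquare φ hφ).IsStructural :=
  fun X => (isEqToHom_mapId_hom _).comp ((h X).comp ((isEqToHom_mapId_inv X).map Q.functor))

theorem assocSquare_isStructural {I J K L : E} (M : StrongFunctor I J) (N : StrongFunctor J K)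
    (P : StrongFunctor K L) : (assocSquare M N P).IsStructural :=
  globSquare_isStructural _ _ fun _ => IsEqToHom.id _

theorem leftUnitSquare_isStructural {I J : E} (M : StrongFunctor I J) :
    (leftUnitSquare M).IsStructural :=
  globSquare_isStructural _ _ fun _ => IsEqToHom.id _

theorem rightUnitSquare_isStructural {I J : E} (M : StrongFunctor I J) :
    (rightUnitSquare M).IsStructural :=
  globSquare_isStructural _ _ fun _ => IsEqToHom.id _

theorem assocSquare_naturality {I' J' K' L' I J K L : E} {u : I' ⟶ I} {v : J' ⟶ J} {w : K' ⟶ K}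
    {x : L' ⟶ L} {M' : StrongFunctor I' J'} {N' : StrongFunctor J' K'} {P' : StrongFunctor K' L'}
    {M : StrongFunctor I J} {N : StrongFunctor J K} {P : StrongFunctor K L}
    (σ : StrongSquare u v M' M) (τ : StrongSquare v w N' N) (ρ : StrongSquare w x P' P) :
    vcompSquare (hcompSquare (hcompSquare σ τ) ρ) (assocSquare M N P) ≍
      vcompSquare (assocSquare M' N' P') (hcompSquare σ (hcompSquare τ ρ)) :=
  globSquare_naturality _ _ _ _ _ _ fun X => by
    refine (Category.comp_id _).trans (Eq.trans ?_ (Category.id_comp _).symm)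
    rw [hcompSquare_app, hcompSquare_app]
    show (ρ.nat.app (N'.functor.obj (M'.functor.obj X))).left ≫
        (P.functor.map (τ.nat.app (M'.functor.obj X) ≫ N.functor.map (σ.nat.app X))).left =
      ((ρ.nat.app (N'.functor.obj (M'.functor.obj X))).left ≫
        (P.functor.map (τ.nat.app (M'.functor.obj X))).left) ≫
          (P.functor.map (N.functor.map (σ.nat.app X))).left
    rw [Category.assoc, map_left_comp P.functor (τ.nat.app (M'.functor.obj X)) _ (_ ≫ _) rfl]

theorem leftUnitSquare_naturality {I' J' I J : E} {u : I' ⟶ I} {v : J' ⟶ J}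
    {M' : StrongFunctor I' J'} {M : StrongFunctor I J} (σ : StrongSquare u v M' M) :
    vcompSquare (hcompSquare (hidSquare u) σ) (leftUnitSquare M) ≍
      vcompSquare (leftUnitSquare M') σ :=
  globSquare_naturality _ _ _ _ _ _ fun X => by
    refine (Category.comp_id _).trans (Eq.trans ?_ (Category.id_comp _).symm)
    show (σ.nat.app X).left ≫ (M.functor.map (𝟙 ((Over.map u).obj X))).left = _
    rw [map_left_id M.functor _ rfl]
    exact Category.comp_id _

theorem rightUnitSquare_naturality {I' J' I J : E} {u : I' ⟶ I} {v : J' ⟶ J}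
    {M' : StrongFunctor I' J'} {M : StrongFunctor I J} (σ : StrongSquare u v M' M) :
    vcompSquare (hcompSquare σ (hidSquare v)) (rightUnitSquare M) ≍
      vcompSquare (rightUnitSquare M') σ :=
  globSquare_naturality _ _ _ _ _ _ fun X => by
    refine (Category.comp_id _).trans (Eq.trans ?_ (Category.id_comp _).symm)
    exact Category.id_comp _

/-- The double category of strong functors between slices of `E`. -/
def strongDouble (E : Type u) [Category.{v} E] [HasFiniteLimits E] : DoubleCat (strongGraph E) where
  vid P := vidSquare P
  vcomp σ τ := vcompSquare σ τ
  vid_vcomp σ := vid_vcompSquare σ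
  vcomp_vid σ := vcomp_vidSquare σ
  vcomp_assoc σ τ ρ := vcompSquare_assoc σ τ ρ
  hidSq u := hidSquare u
  hidSq_id I := hidSquare_id I
  hidSq_comp u u' := hidSquare_comp u u'
  hcompSq σ τ := hcompSquare σ τ
  hcompSq_vid M N := hcompSquare_vid M N
  interchange σ σ' τ τ' := square_interchange σ σ' τ τ'
  assoc M N P := assocSquare M N P
  assocInv M N P := assocInvSquare M N P
  assoc_assocInv M N P := globSquare_heq_vid _ _ _ _ (Category.comp_id _)
  assocInv_assoc M N P := globSquare_heq_vid _ _ _ _ (Category.comp_id _)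
  assoc_naturality σ τ ρ := assocSquare_naturality σ τ ρ
  leftUnit M := leftUnitSquare M
  leftUnitInv M := leftUnitInvSquare M
  leftUnit_leftUnitInv M := globSquare_heq_vid _ _ _ _ (Category.comp_id _)
  leftUnitInv_leftUnit M := globSquare_heq_vid _ _ _ _ (Category.comp_id _)
  leftUnit_naturality σ := leftUnitSquare_naturality σ
  rightUnit M := rightUnitSquare M
  rightUnitInv M := rightUnitInvSquare M
  rightUnit_rightUnitInv M := globSquare_heq_vid _ _ _ _ (Category.comp_id _)
  rightUnitInv_rightUnit M := globSquare_heq_vid _ _ _ _ (Category.comp_id _)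
  rightUnit_naturality σ := rightUnitSquare_naturality σ
  pentagon A B C D := StrongSquare.IsStructural.heq
    (vcompSquare_isStructural
      (hcompSquare_isStructural (assocSquare_isStructural A B C) (vidSquare_isStructural D))
      (vcompSquare_isStructural (assocSquare_isStructural A (B.comp C) D)
        (hcompSquare_isStructural (vidSquare_isStructural A) (assocSquare_isStructural B C D))))
    (vcompSquare_isStructural (assocSquare_isStructural (A.comp B) C D)
      (assocSquare_isStructural A B (C.comp D))) (by simp) (by simp)
  triangle M N := StrongSquare.IsStructural.heq
    (vcompSquare_isStructural (assocSquare_isStructural M (StrongFunctor.id _) N)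
      (hcompSquare_isStructural (vidSquare_isStructural M) (leftUnitSquare_isStructural N)))
    (hcompSquare_isStructural (rightUnitSquare_isStructural M) (vidSquare_isStructural N))
    (by simp) (by simp)

/-- A category with finite limits is locally cartesian closed if all pullback functors have right
adjoints. -/
class IsLCC (E : Type u) [Category.{v} E] [HasFiniteLimits E] : Prop where
  isLeftAdjoint : ∀ {I J : E} (f : I ⟶ J), (Over.pullback f).IsLeftAdjoint

attribute [instance] IsLCC.isLeftAdjoint

variable [IsLCC E]
/-- The dependent product functor `Π_f : E/I ⥤ E/J`. -/
def dprod {I J : E} (f : I ⟶ J) : Over I ⥤ Over J := (Over.pullback f).rightAdjoint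

def dprodAdj {I J : E} (f : I ⟶ J) : Over.pullback f ⊣ dprod f :=
  Adjunction.ofIsLeftAdjoint (Over.pullback f)

/-- The dependent product functor `Π_f : E/I ⥤ E/J` with its canonical strength: the component
`K ⊗ Π_f y ⟶ Π_f (K ⊗ y)` is the transpose of
`f^* (K ⊗ Π_f y) ≅ K ⊗ f^* Π_f y ⟶ K ⊗ y`. -/
def prodS {I J : E} (f : I ⟶ J) : StrongFunctor I J where
  functor := dprod f
  strength :=
    { app := fun K y => (dprodAdj f).homEquiv _ _
        (pullTens f K ((dprod f).obj y) ≫ tensMap (𝟙 K) ((dprodAdj f).counit.app y))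
      naturality := fun {K L} k {a b} g => by
        rw [← Adjunction.homEquiv_naturality_left, ← Adjunction.homEquiv_naturality_right]
        congr 1
        rw [← Category.assoc, pullTens_naturality, Category.assoc, Category.assoc,
          ← tensMap_comp, ← tensMap_comp]
        simp
      unit := fun a => by
        rw [← Adjunction.homEquiv_naturality_right, Category.assoc, tensUnit_naturality,
          reassoc_of% (pullTens_unit f ((dprod f).obj a)), Adjunction.homEquiv_naturality_left,
          ← Adjunction.homEquiv_symm_id, Equiv.apply_symm_apply, Category.comp_id]
      assoc := fun K L a => by
        rw [← Adjunction.homEquiv_naturality_right, Category.assoc, tensAssoc_naturality,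
          ← reassoc_of% (pullTens_assoc f K L ((dprod f).obj a)), ← tensMap_comp, Category.comp_id,
          ← Adjunction.homEquiv_naturality_left, ← Adjunction.homEquiv_naturality_left,
          reassoc_of% (pullTens_naturality f (𝟙 K)), ← tensMap_comp, Category.comp_id,
          ← Adjunction.homEquiv_counit, Equiv.symm_apply_apply] }


/-! ### Polynomials and their extensions -/

/-- A polynomial `I ←s- B -f→ A -t→ J`. -/
structure PolyDiagram (I J : E) where
  B : E
  A : E
  s : B ⟶ I
  f : B ⟶ A
  t : A ⟶ J

/-- The extension `Σ_t Π_f s^* : E/I ⥤ E/J` of a polynomial, with its canonical strength. -/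
def PolyDiagram.ext {I J : E} (F : PolyDiagram I J) : StrongFunctor I J :=
  ((pullS F.s).comp (prodS F.f)).comp (sumS F.t)

section Elements

/-! We work with generalised elements of `Σ_t Π_f s^* X`, i.e. with pairs `(a, φ)` where `a` is a
generalised element of `A` and `φ` sends `b` with `f b = a` to an element of `X` over `s b`. -/

variable {I J : E} (F : PolyDiagram I J) (X : Over I)

/-- The domain of `Σ_t Π_f s^* X`. -/
abbrev PolyDiagram.dom : E := ((dprod F.f).obj ((Over.pullback F.s).obj X)).left

/-- The map `(a, φ) ↦ a`. -/
abbrev PolyDiagram.shape : F.dom X ⟶ F.A := ((dprod F.f).obj ((Over.pullback F.s).obj X)).hom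

variable {F X}

/-- The map `((a, φ), b) ↦ φ b`. -/
def evalAt {Z : E} (y : Z ⟶ F.dom X) (b : Z ⟶ F.B) (h : y ≫ F.shape X = b ≫ F.f) :
    Z ⟶ X.left :=
  pullback.lift y b h ≫
    ((dprodAdj F.f).counit.app ((Over.pullback F.s).obj X)).left ≫ pullback.fst X.hom F.s

/-- Given `z ↦ a z` and `(z, b) ↦ φ z b`, the map `z ↦ (a z, b ↦ φ z b)`. -/
def lam {Z : E} (a : Z ⟶ F.A) (φ : pullback a F.f ⟶ X.left)
    (h : φ ≫ X.hom = pullback.snd a F.f ≫ F.s) : Z ⟶ F.dom X :=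
  ((dprodAdj F.f).homEquiv (Over.mk a) ((Over.pullback F.s).obj X)
    (Over.homMk (pullback.lift φ (pullback.snd a F.f) h) (pullback.lift_snd _ _ _))).left

theorem lam_shape {Z : E} (a : Z ⟶ F.A) (φ : pullback a F.f ⟶ X.left)
    (h : φ ≫ X.hom = pullback.snd a F.f ≫ F.s) : lam a φ h ≫ F.shape X = a :=
  Over.w _

theorem evalAt_hom {Z : E} (y : Z ⟶ F.dom X) (b : Z ⟶ F.B) (h : y ≫ F.shape X = b ≫ F.f) :
    evalAt y b h ≫ X.hom = b ≫ F.s := by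
  have e : ((dprodAdj F.f).counit.app ((Over.pullback F.s).obj X)).left ≫ pullback.snd X.hom F.s =
    pullback.snd (F.shape X) F.f := Over.w ((dprodAdj F.f).counit.app ((Over.pullback F.s).obj X))
  rw [evalAt, Category.assoc, Category.assoc, pullback.condition, reassoc_of% e,
    pullback.lift_snd_assoc]

theorem comp_evalAt {Z' Z : E} (g : Z' ⟶ Z) (y : Z ⟶ F.dom X) (b : Z ⟶ F.B)
    (h : y ≫ F.shape X = b ≫ F.f) :
    g ≫ evalAt y b h = evalAt (g ≫ y) (g ≫ b) (by simp only [Category.assoc, h]) := by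
  rw [evalAt, evalAt, ← Category.assoc]
  congr 1
  apply pullback.hom_ext
  · rw [Category.assoc, pullback.lift_fst, pullback.lift_fst]
  · rw [Category.assoc, pullback.lift_snd, pullback.lift_snd]

theorem evalAt_congr {Z : E} {y y' : Z ⟶ F.dom X} {b b' : Z ⟶ F.B}
    (h : y ≫ F.shape X = b ≫ F.f) (hy : y = y') (hb : b = b') :
    evalAt y b h = evalAt y' b' (by rw [← hy, ← hb, h]) := by
  subst hy; subst hb; rfl

/-- Evaluating a transpose. -/
theorem evalAt_transpose {Z : E} {a : Over F.A}
    (φ : (Over.pullback F.f).obj a ⟶ (Over.pullback F.s).obj X) (z : Z ⟶ a.left) (b : Z ⟶ F.B)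
    (h : z ≫ a.hom = b ≫ F.f)
    (h' : (z ≫ ((dprodAdj F.f).homEquiv a _ φ).left) ≫ F.shape X = b ≫ F.f) :
    evalAt (z ≫ ((dprodAdj F.f).homEquiv a _ φ).left) b h' =
      pullback.lift z b h ≫ φ.left ≫ pullback.fst X.hom F.s := by
  have e : pullMap F.f ((dprodAdj F.f).homEquiv a _ φ) ≫
      ((dprodAdj F.f).counit.app ((Over.pullback F.s).obj X)).left = φ.left :=
    congrArg Over.Hom.left (((dprodAdj F.f).homEquiv_counit (g := (dprodAdj F.f).homEquiv a _ φ)).symm.trans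
      (((dprodAdj F.f).homEquiv a _).symm_apply_apply φ))
  rw [evalAt, ← e, Category.assoc, ← Category.assoc (pullback.lift z b h)]
  congr 1
  apply pullback.hom_ext
  · rw [Category.assoc]
    erw [pullMap_fst]
    rw [pullback.lift_fst, pullback.lift_fst_assoc]
  · rw [Category.assoc]
    erw [pullMap_snd]
    rw [pullback.lift_snd, pullback.lift_snd]

theorem evalAt_lam {Z' Z : E} (a : Z ⟶ F.A) (φ : pullback a F.f ⟶ X.left)
    (h : φ ≫ X.hom = pullback.snd a F.f ≫ F.s) (z : Z' ⟶ Z) (b : Z' ⟶ F.B)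
    (h' : (z ≫ lam a φ h) ≫ F.shape X = b ≫ F.f) (h'' : z ≫ a = b ≫ F.f) :
    evalAt (z ≫ lam a φ h) b h' = pullback.lift z b h'' ≫ φ := by
  refine (evalAt_transpose (F := F) (X := X) (a := Over.mk a) _ z b h'' h').trans ?_
  congr 1
  exact pullback.lift_fst _ _ _

/-- Elements of `Σ_t Π_f s^* X` agree if they have the same values. -/
theorem dom_ext {Z : E} {y y' : Z ⟶ F.dom X} (h : y ≫ F.shape X = y' ≫ F.shape X)
    (e : ∀ {Z' : E} (z : Z' ⟶ Z) (b : Z' ⟶ F.B) (hb : (z ≫ y) ≫ F.shape X = b ≫ F.f),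
      evalAt (z ≫ y) b hb =
        evalAt (z ≫ y') b (by rw [← hb, Category.assoc, Category.assoc, h])) : y = y' := by
  let a : Over F.A := Over.mk (y ≫ F.shape X)
  let g : a ⟶ (dprod F.f).obj ((Over.pullback F.s).obj X) := Over.homMk y rfl
  let g' : a ⟶ (dprod F.f).obj ((Over.pullback F.s).obj X) := Over.homMk y' h.symm
  suffices g = g' from congrArg Over.Hom.left this
  apply ((dprodAdj F.f).homEquiv _ _).symm.injective
  obtain ⟨φ, hφ⟩ := ((dprodAdj F.f).homEquiv _ _).surjective g
  obtain ⟨φ', hφ'⟩ := ((dprodAdj F.f).homEquiv _ _).surjective g'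
  rw [← hφ, ← hφ', Equiv.symm_apply_apply, Equiv.symm_apply_apply]
  have c : pullback.fst a.hom F.f ≫ a.hom = pullback.snd a.hom F.f ≫ F.f := pullback.condition
  have hy : ((dprodAdj F.f).homEquiv _ _ φ).left = y := congrArg Over.Hom.left hφ
  have hy' : ((dprodAdj F.f).homEquiv _ _ φ').left = y' := congrArg Over.Hom.left hφ'
  have c₁ : (pullback.fst a.hom F.f ≫ ((dprodAdj F.f).homEquiv _ _ φ).left) ≫ F.shape X =
      pullback.snd a.hom F.f ≫ F.f := by
    rw [Category.assoc, hy]; exact c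
  have c₂ : (pullback.fst a.hom F.f ≫ ((dprodAdj F.f).homEquiv _ _ φ').left) ≫ F.shape X =
      pullback.snd a.hom F.f ≫ F.f := by
    rw [Category.assoc, hy', ← h]; exact c
  have k₁ := evalAt_transpose φ (pullback.fst a.hom F.f) (pullback.snd a.hom F.f) c c₁
  have k₂ := evalAt_transpose φ' (pullback.fst a.hom F.f) (pullback.snd a.hom F.f) c c₂
  have i : pullback.lift (pullback.fst a.hom F.f) (pullback.snd a.hom F.f) c = 𝟙 _ := by
    apply pullback.hom_ext <;> simp
  rw [i, Category.id_comp] at k₁ k₂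
  ext
  apply pullback.hom_ext
  · rw [← k₁, ← k₂]
    have := e (pullback.fst a.hom F.f) (pullback.snd a.hom F.f) (by rw [Category.assoc]; exact c)
    refine (evalAt_congr _ (by rw [hy]) rfl).trans (this.trans (evalAt_congr _ (by rw [hy']) rfl))
  · exact (Over.w φ).trans (Over.w φ').symm

variable (F)

/-- The action of `Σ_t Π_f s^*` on a morphism `g`, `(a, φ) ↦ (a, g φ)`. -/
abbrev PolyDiagram.mapDom {X Y : Over I} (g : X ⟶ Y) : F.dom X ⟶ F.dom Y :=
  ((dprod F.f).map ((Over.pullback F.s).map g)).left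

theorem mapDom_shape {X Y : Over I} (g : X ⟶ Y) : F.mapDom g ≫ F.shape Y = F.shape X :=
  Over.w _

theorem evalAt_mapDom {Z : E} {X Y : Over I} (g : X ⟶ Y) (y : Z ⟶ F.dom X) (b : Z ⟶ F.B)
    (h : (y ≫ F.mapDom g) ≫ F.shape Y = b ≫ F.f) (h' : y ≫ F.shape X = b ≫ F.f) :
    evalAt (y ≫ F.mapDom g) b h = evalAt y b h' ≫ g.left := by
  have e := congrArg Over.Hom.left ((dprodAdj F.f).counit.naturality ((Over.pullback F.s).map g))
  have e' : pullMap F.f ((dprod F.f).map ((Over.pullback F.s).map g)) ≫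
      ((dprodAdj F.f).counit.app ((Over.pullback F.s).obj Y)).left =
    ((dprodAdj F.f).counit.app ((Over.pullback F.s).obj X)).left ≫ pullMap F.s g := e
  rw [evalAt, evalAt, Category.assoc, Category.assoc, ← pullMap_fst, ← reassoc_of% e',
    ← Category.assoc (pullback.lift y b h')]
  congr 1
  apply pullback.hom_ext
  · rw [Category.assoc]
    erw [pullMap_fst]
    rw [pullback.lift_fst, pullback.lift_fst_assoc]
  · rw [Category.assoc]
    erw [pullMap_snd]
    rw [pullback.lift_snd, pullback.lift_snd]

/-- The strength of `Σ_t Π_f s^*`, `(k, (a, φ)) ↦ (a, b ↦ (k, φ b))`. -/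
def PolyDiagram.strDom (K : E) (X : Over I) : K ⨯ F.dom X ⟶ F.dom (tens K X) :=
  ((prodS F.f).strength.app K ((Over.pullback F.s).obj X)).left ≫
    ((dprod F.f).map ((pullS F.s).strength.app K X)).left

theorem ext_strength_left (K : E) (X : Over I) :
    (F.ext.strength.app K X).left = F.strDom K X := by
  show 𝟙 _ ≫ (((prodS F.f).strength.app K ((Over.pullback F.s).obj X)) ≫
    ((dprod F.f).map ((pullS F.s).strength.app K X))).left = _
  rw [Category.id_comp]
  rfl

theorem strDom_shape (K : E) (X : Over I) :
    F.strDom K X ≫ F.shape (tens K X) = prod.snd ≫ F.shape X := by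
  have h₁ := Over.w ((dprod F.f).map ((pullS F.s).strength.app K X))
  have h₂ := Over.w ((prodS F.f).strength.app K ((Over.pullback F.s).obj X))
  exact (Category.assoc _ _ _).trans ((congrArg _ h₁).trans h₂)

theorem evalAt_strDom {Z : E} {K : E} {X : Over I} (z : Z ⟶ K ⨯ F.dom X) (b : Z ⟶ F.B)
    (h : (z ≫ F.strDom K X) ≫ F.shape (tens K X) = b ≫ F.f)
    (h' : (z ≫ prod.snd) ≫ F.shape X = b ≫ F.f) :
    evalAt (z ≫ F.strDom K X) b h =
      prod.lift (z ≫ prod.fst) (evalAt (z ≫ prod.snd) b h') := by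
  let st : tens K ((Over.pullback F.s).obj X) ⟶ (Over.pullback F.s).obj (tens K X) :=
    (pullS F.s).strength.app K X
  let ct : (Over.pullback F.f).obj (tens K ((dprod F.f).obj ((Over.pullback F.s).obj X))) ⟶
      tens K ((Over.pullback F.s).obj X) :=
    pullTens F.f K ((dprod F.f).obj ((Over.pullback F.s).obj X)) ≫
        tensMap (𝟙 K) ((dprodAdj F.f).counit.app ((Over.pullback F.s).obj X))
  have e : F.strDom K X = ((dprodAdj F.f).homEquiv _ _ (ct ≫ st)).left :=
    (congrArg Over.Hom.left ((dprodAdj F.f).homEquiv_naturality_right ct st)).symm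
  have hc : z ≫ prod.snd ≫ F.shape X = b ≫ F.f := by rw [← h', Category.assoc]
  refine (evalAt_congr _ (congrArg (z ≫ ·) e) rfl).trans
    ((evalAt_transpose (F := F) (X := tens K X) (ct ≫ st) z b hc _).trans ?_)
  show pullback.lift z b hc ≫ ((pullTensLeft F.f K _ ≫ prod.map (𝟙 K) _) ≫ pullStrength F.s K X) ≫
    pullback.fst (tens K X).hom F.s = _
  rw [Category.assoc, Category.assoc, pullStrength_fst]
  apply prod.hom_ext
  · simp only [Category.assoc, prod.map_fst, Category.comp_id, prod.lift_fst]
    rw [pullTensLeft_fst]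
    exact pullback.lift_fst_assoc _ _ _ _
  · simp only [Category.assoc, prod.map_snd, prod.lift_snd]
    rw [evalAt, prod.map_snd_assoc]
    simp only [← Category.assoc]
    congr 2
    apply pullback.hom_ext
    · simp only [Category.assoc]
      erw [pullTensLeft_snd_fst]
      rw [pullback.lift_fst]
      exact pullback.lift_fst_assoc _ _ _ _
    · simp only [Category.assoc]
      erw [pullTensLeft_snd_snd]
      rw [pullback.lift_snd]
      exact pullback.lift_snd _ _ _

end Elements


/-! ### Squares between extensions represented by diagrams -/

/-- The square between extensions with components given by the maps `φ X`. -/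
def extSquare {I' J' I J : E} {u : I' ⟶ I} {v : J' ⟶ J} {F' : PolyDiagram I' J'}
    {F : PolyDiagram I J} (φ : ∀ X : Over I', F'.dom X ⟶ F.dom ((Over.map u).obj X))
    (hφ : ∀ X : Over I', φ X ≫ F.shape _ ≫ F.t = F'.shape X ≫ F'.t ≫ v)
    (nat : ∀ {X Y : Over I'} (g : X ⟶ Y),
      F'.mapDom g ≫ φ Y = φ X ≫ F.mapDom ((Over.map u).map g))
    (str : ∀ (K : E) (X : Over I'), F'.strDom K X ≫ φ (tens K X) =
      prod.map (𝟙 K) (φ X) ≫ F.strDom K ((Over.map u).obj X) ≫ F.mapDom (sumTens u K X)) :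
    StrongSquare u v F'.ext F.ext where
  nat :=
    { app := fun X => Over.homMk (φ X) ((hφ X).trans (Category.assoc _ _ _).symm)
      naturality := fun X Y g => Over.OverMorphism.ext (nat g) }
  strong := (isStrong_iff _).2 fun K X => by
    rw [ext_strength_left, ext_strength_left]
    exact str K X

/-- A diagram
```
  I' <--s'-- B' ---f'--> A' --t'--> J'
  |          ↑           ‖          |
  u          D --------> A'         v
  ↓          ↓           ↓          ↓
  I <---s--- B ----f---> A ---t---> J
```
in which the lower middle square is a pullback. -/
structure SqDiagram {I' J' I J : E} (u : I' ⟶ I) (v : J' ⟶ J) (F' : PolyDiagram I' J')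
    (F : PolyDiagram I J) where
  D : E
  toB' : D ⟶ F'.B
  toA' : D ⟶ F'.A
  toB : D ⟶ F.B
  onA : F'.A ⟶ F.A
  isPullback : IsPullback toB toA' F.f onA
  comm : toB' ≫ F'.f = toA'
  comm_left : toB' ≫ F'.s ≫ u = toB ≫ F.s
  comm_right : onA ≫ F.t = F'.t ≫ v

namespace SqDiagram

variable {I' J' I J : E} {u : I' ⟶ I} {v : J' ⟶ J} {F' : PolyDiagram I' J'} {F : PolyDiagram I J}

/-- Two diagrams are equivalent if they differ only in the choice of the pullback `D`. -/
def Equivalent (d e : SqDiagram u v F' F) : Prop :=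
  d.onA = e.onA ∧ ∃ i : d.D ≅ e.D, i.hom ≫ e.toB' = d.toB' ∧ i.hom ≫ e.toB = d.toB

theorem equivalence : Equivalence (Equivalent (u := u) (v := v) (F' := F') (F := F)) where
  refl d := ⟨rfl, Iso.refl _, Category.id_comp _, Category.id_comp _⟩
  symm := fun ⟨h, i, h₁, h₂⟩ => ⟨h.symm, i.symm, by simp [← h₁], by simp [← h₂]⟩
  trans := fun ⟨h, i, h₁, h₂⟩ ⟨h', i', h₁', h₂'⟩ => ⟨h.trans h', i ≪≫ i', by simp [h₁, h₁'],
    by simp [h₂, h₂']⟩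

instance setoid : Setoid (SqDiagram u v F' F) := ⟨Equivalent, equivalence⟩

variable (d : SqDiagram u v F' F)

/-- The element of `B'` over `b ∈ B` and `a' ∈ A'`. -/
def sel {Z : E} (a' : Z ⟶ F'.A) (b : Z ⟶ F.B) (h : a' ≫ d.onA = b ≫ F.f) : Z ⟶ F'.B :=
  d.isPullback.lift b a' h.symm ≫ d.toB'

theorem sel_f {Z : E} (a' : Z ⟶ F'.A) (b : Z ⟶ F.B) (h : a' ≫ d.onA = b ≫ F.f) :
    d.sel a' b h ≫ F'.f = a' := by
  rw [sel, Category.assoc, d.comm, d.isPullback.lift_snd]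

theorem sel_s {Z : E} (a' : Z ⟶ F'.A) (b : Z ⟶ F.B) (h : a' ≫ d.onA = b ≫ F.f) :
    d.sel a' b h ≫ F'.s ≫ u = b ≫ F.s := by
  rw [sel, Category.assoc, d.comm_left, d.isPullback.lift_fst_assoc]

theorem comp_sel {Z' Z : E} (g : Z' ⟶ Z) (a' : Z ⟶ F'.A) (b : Z ⟶ F.B)
    (h : a' ≫ d.onA = b ≫ F.f) :
    g ≫ d.sel a' b h = d.sel (g ≫ a') (g ≫ b) (by simp only [Category.assoc, h]) := by
  rw [sel, sel, ← Category.assoc]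
  congr 1
  apply d.isPullback.hom_ext
  · rw [Category.assoc, d.isPullback.lift_fst, d.isPullback.lift_fst]
  · rw [Category.assoc, d.isPullback.lift_snd, d.isPullback.lift_snd]

theorem sel_congr {Z : E} {a' a'' : Z ⟶ F'.A} {b b' : Z ⟶ F.B} (h : a' ≫ d.onA = b ≫ F.f)
    (ha : a' = a'') (hb : b = b') : d.sel a' b h = d.sel a'' b' (by rw [← ha, ← hb, h]) := by
  subst ha; subst hb; rfl

/-- The map `Σ_t' Π_f' s'^* X ⟶ Σ_t Π_f s^* Σ_u X` sending `(a', φ)` to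
`(onA a', b ↦ φ (sel a' b))`. -/
def domMap (X : Over I') : F'.dom X ⟶ F.dom ((Over.map u).obj X) :=
  lam (X := (Over.map u).obj X) (F'.shape X ≫ d.onA)
    (evalAt (X := X) (pullback.fst (F'.shape X ≫ d.onA) F.f)
      (d.sel (pullback.fst (F'.shape X ≫ d.onA) F.f ≫ F'.shape X) (pullback.snd _ _)
        ((Category.assoc _ _ _).trans pullback.condition)) (d.sel_f _ _ _).symm)
    (by
      refine (Category.assoc _ _ _).symm.trans ?_
      rw [evalAt_hom, Category.assoc]
      exact d.sel_s _ _ _)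

theorem domMap_shape (X : Over I') : d.domMap X ≫ F.shape _ = F'.shape X ≫ d.onA :=
  lam_shape _ _ _

theorem evalAt_domMap {Z : E} {X : Over I'} (y : Z ⟶ F'.dom X) (b : Z ⟶ F.B)
    (h : (y ≫ d.domMap X) ≫ F.shape _ = b ≫ F.f)
    (h' : (y ≫ F'.shape X) ≫ d.onA = b ≫ F.f) :
    evalAt (X := (Over.map u).obj X) (y ≫ d.domMap X) b h =
      evalAt y (d.sel (y ≫ F'.shape X) b h') (d.sel_f _ _ _).symm := by
  have h'' : y ≫ F'.shape X ≫ d.onA = b ≫ F.f := by rw [← h', Category.assoc]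
  refine (evalAt_lam (X := (Over.map u).obj X) _ _ _ y b h h'').trans ?_
  rw [comp_evalAt]
  refine evalAt_congr _ (pullback.lift_fst _ _ _) ?_
  rw [comp_sel]
  exact d.sel_congr _ (pullback.lift_fst_assoc _ _ _ _) (pullback.lift_snd _ _ _)

/-- The square between extensions represented by a diagram. -/
def square : StrongSquare u v F'.ext F.ext :=
  extSquare d.domMap
    (fun X => by rw [reassoc_of% (d.domMap_shape X), d.comm_right])
    (fun {X Y} g => by
      have hs : (F'.mapDom g ≫ d.domMap Y) ≫ F.shape _ =
          (d.domMap X ≫ F.mapDom ((Over.map u).map g)) ≫ F.shape _ := by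
        rw [Category.assoc, Category.assoc, mapDom_shape, domMap_shape, domMap_shape,
          reassoc_of% (mapDom_shape F' g)]
      refine dom_ext hs fun z b hb => ?_
      have h₁ : ((z ≫ F'.mapDom g) ≫ F'.shape Y) ≫ d.onA = b ≫ F.f := by
        rw [← hb]; simp only [Category.assoc, domMap_shape]
      have h₂ : (z ≫ F'.shape X) ≫ d.onA = b ≫ F.f := by
        rw [← h₁, Category.assoc z (F'.mapDom g), mapDom_shape]
      have h₃ : ((z ≫ F'.mapDom g) ≫ d.domMap Y) ≫ F.shape _ = b ≫ F.f := by
        rw [Category.assoc z]; exact hb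
      have h₄ : (z ≫ d.domMap X) ≫ F.shape _ = b ≫ F.f := by
        rw [Category.assoc, domMap_shape, ← Category.assoc, h₂]
      have h₅ : ((z ≫ d.domMap X) ≫ F.mapDom ((Over.map u).map g)) ≫ F.shape _ = b ≫ F.f := by
        rw [Category.assoc, mapDom_shape, h₄]
      have h₆ : (z ≫ F'.mapDom g) ≫ F'.shape Y = d.sel (z ≫ F'.shape X) b h₂ ≫ F'.f := by
        rw [sel_f, Category.assoc, mapDom_shape]
      calc evalAt (z ≫ F'.mapDom g ≫ d.domMap Y) b hb
          = evalAt ((z ≫ F'.mapDom g) ≫ d.domMap Y) b h₃ :=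
            evalAt_congr _ (Category.assoc _ _ _).symm rfl
        _ = _ := d.evalAt_domMap _ b h₃ h₁
        _ = evalAt (z ≫ F'.mapDom g) (d.sel (z ≫ F'.shape X) b h₂) h₆ :=
            evalAt_congr _ rfl (d.sel_congr _ (by rw [Category.assoc, mapDom_shape]) rfl)
        _ = evalAt z (d.sel (z ≫ F'.shape X) b h₂) (d.sel_f _ _ _).symm ≫ g.left :=
            evalAt_mapDom _ _ _ _ _ _
        _ = evalAt (z ≫ d.domMap X) b h₄ ≫ g.left := by rw [d.evalAt_domMap z b h₄ h₂]
        _ = evalAt ((z ≫ d.domMap X) ≫ F.mapDom ((Over.map u).map g)) b h₅ :=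
            (evalAt_mapDom _ ((Over.map u).map g) _ _ h₅ h₄).symm
        _ = _ := evalAt_congr _ (Category.assoc _ _ _) rfl)
    (fun K X => by
      have hs : (F'.strDom K X ≫ d.domMap (tens K X)) ≫ F.shape _ =
          (prod.map (𝟙 K) (d.domMap X) ≫ F.strDom K ((Over.map u).obj X) ≫
            F.mapDom (sumTens u K X)) ≫ F.shape _ := by
        simp only [Category.assoc]
        rw [mapDom_shape, domMap_shape, strDom_shape, reassoc_of% (strDom_shape F' K X),
          prod.map_snd_assoc, domMap_shape]
      refine dom_ext hs fun z b hb => ?_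
      have h₁ : ((z ≫ F'.strDom K X) ≫ F'.shape (tens K X)) ≫ d.onA = b ≫ F.f := by
        rw [← hb]; simp only [Category.assoc, domMap_shape]
      have h₂ : ((z ≫ prod.snd) ≫ F'.shape X) ≫ d.onA = b ≫ F.f := by
        rw [← h₁, Category.assoc z (F'.strDom K X), strDom_shape, Category.assoc z]
      have h₃ : ((z ≫ F'.strDom K X) ≫ d.domMap (tens K X)) ≫ F.shape _ = b ≫ F.f := by
        rw [Category.assoc z]; exact hb
      have h₄ : ((z ≫ prod.snd) ≫ d.domMap X) ≫ F.shape _ = b ≫ F.f := by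
        rw [Category.assoc, domMap_shape, ← Category.assoc, h₂]
      have h₇ : ((z ≫ prod.map (𝟙 K) (d.domMap X)) ≫ F.strDom K ((Over.map u).obj X)) ≫
          F.shape _ = b ≫ F.f := by
        rw [Category.assoc, strDom_shape, Category.assoc, prod.map_snd_assoc, ← h₄]
        simp only [Category.assoc]
      have h₅ : (((z ≫ prod.map (𝟙 K) (d.domMap X)) ≫ F.strDom K ((Over.map u).obj X)) ≫
          F.mapDom (sumTens u K X)) ≫ F.shape _ = b ≫ F.f := by
        rw [Category.assoc _ (F.mapDom _), mapDom_shape, h₇]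
      have h₆ : (z ≫ F'.strDom K X) ≫ F'.shape (tens K X) =
          d.sel ((z ≫ prod.snd) ≫ F'.shape X) b h₂ ≫ F'.f := by
        rw [sel_f, Category.assoc, strDom_shape, Category.assoc]
      have h₈ : ((z ≫ prod.map (𝟙 K) (d.domMap X)) ≫ prod.snd) ≫ F.shape _ = b ≫ F.f := by
        rw [Category.assoc z, prod.map_snd, ← h₄]
        simp only [Category.assoc]
      calc evalAt (z ≫ F'.strDom K X ≫ d.domMap (tens K X)) b hb
          = evalAt ((z ≫ F'.strDom K X) ≫ d.domMap (tens K X)) b h₃ :=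
            evalAt_congr _ (Category.assoc _ _ _).symm rfl
        _ = _ := d.evalAt_domMap _ b h₃ h₁
        _ = evalAt (z ≫ F'.strDom K X) (d.sel ((z ≫ prod.snd) ≫ F'.shape X) b h₂) h₆ :=
            evalAt_congr _ rfl (d.sel_congr _ (by
              rw [Category.assoc, strDom_shape, Category.assoc]) rfl)
        _ = prod.lift (z ≫ prod.fst) (evalAt (z ≫ prod.snd)
              (d.sel ((z ≫ prod.snd) ≫ F'.shape X) b h₂) (d.sel_f _ _ _).symm) :=
            evalAt_strDom _ _ _ _ _
        _ = prod.lift (z ≫ prod.fst) (evalAt ((z ≫ prod.snd) ≫ d.domMap X) b h₄) :=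
            congrArg (prod.lift _) (d.evalAt_domMap (z ≫ prod.snd) b h₄ h₂).symm
        _ = prod.lift ((z ≫ prod.map (𝟙 K) (d.domMap X)) ≫ prod.fst)
              (evalAt ((z ≫ prod.map (𝟙 K) (d.domMap X)) ≫ prod.snd) b h₈) := by
            exact congrArg₂ prod.lift (by rw [Category.assoc, prod.map_fst, Category.comp_id])
              (evalAt_congr _ (by rw [Category.assoc, Category.assoc, prod.map_snd]) rfl)
        _ = evalAt ((z ≫ prod.map (𝟙 K) (d.domMap X)) ≫ F.strDom K ((Over.map u).obj X)) b h₇ :=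
            (evalAt_strDom _ _ _ _ _).symm
        _ = evalAt (((z ≫ prod.map (𝟙 K) (d.domMap X)) ≫ F.strDom K ((Over.map u).obj X)) ≫
              F.mapDom (sumTens u K X)) b h₅ :=
            ((evalAt_mapDom _ (sumTens u K X) _ _ h₅ h₇).trans (Category.comp_id _)).symm
        _ = _ := evalAt_congr _ (by simp only [Category.assoc]) rfl)

end SqDiagram


/-- Vertical composition of diagrams: the middle object is the pullback of the two middle
objects. -/
def SqDiagram.comp {I₁ J₁ I₂ J₂ I₃ J₃ : E} {u : I₁ ⟶ I₂} {v : J₁ ⟶ J₂} {u' : I₂ ⟶ I₃}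
    {v' : J₂ ⟶ J₃} {F₁ : PolyDiagram I₁ J₁} {F₂ : PolyDiagram I₂ J₂} {F₃ : PolyDiagram I₃ J₃}
    (d : SqDiagram u v F₁ F₂) (e : SqDiagram u' v' F₂ F₃) :
    SqDiagram (u ≫ u') (v ≫ v') F₁ F₃ where
  D := pullback e.toB' d.toB
  toB' := pullback.snd e.toB' d.toB ≫ d.toB'
  toA' := pullback.snd e.toB' d.toB ≫ d.toA'
  toB := pullback.fst e.toB' d.toB ≫ e.toB
  onA := d.onA ≫ e.onA
  isPullback := by
    have h := (IsPullback.of_hasPullback e.toB' d.toB).paste_vert d.isPullback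
    rw [e.comm] at h
    exact h.paste_horiz e.isPullback
  comm := by rw [Category.assoc, d.comm]
  comm_left := by
    have h := d.comm_left
    have h' := e.comm_left
    rw [Category.assoc, reassoc_of% h, ← pullback.condition_assoc, h', Category.assoc]
  comm_right := by
    have h := d.comm_right
    rw [Category.assoc, e.comm_right, reassoc_of% h]

/-- A diagram
```
  I' <--s'-- B' ---f'--> A' --t'--> J'
  |          |           |          |
  u          |           |          v
  ↓          ↓           ↓          ↓
  I <---s--- B ----f---> A ---t---> J
```
in which the middle square is a pullback. -/
structure CartDiagram {I' J' I J : E} (u : I' ⟶ I) (v : J' ⟶ J) (F' : PolyDiagram I' J')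
    (F : PolyDiagram I J) where
  onB : F'.B ⟶ F.B
  onA : F'.A ⟶ F.A
  isPullback : IsPullback onB F'.f F.f onA
  comm_left : F'.s ≫ u = onB ≫ F.s
  comm_right : onA ≫ F.t = F'.t ≫ v

/-- A cartesian diagram, as a diagram in which `D = B'`. -/
def CartDiagram.toSqDiagram {I' J' I J : E} {u : I' ⟶ I} {v : J' ⟶ J} {F' : PolyDiagram I' J'}
    {F : PolyDiagram I J} (d : CartDiagram u v F' F) : SqDiagram u v F' F where
  D := F'.B
  toB' := 𝟙 F'.B
  toA' := F'.f
  toB := d.onB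
  onA := d.onA
  isPullback := d.isPullback
  comm := Category.id_comp _
  comm_left := by rw [Category.id_comp, d.comm_left]
  comm_right := d.comm_right

/-- The square between extensions represented by a cartesian diagram. -/
def CartDiagram.square {I' J' I J : E} {u : I' ⟶ I} {v : J' ⟶ J} {F' : PolyDiagram I' J'}
    {F : PolyDiagram I J} (d : CartDiagram u v F' F) : StrongSquare u v F'.ext F.ext :=
  d.toSqDiagram.square

/-- Vertical composition of cartesian diagrams: pasting. -/
def CartDiagram.comp {I₁ J₁ I₂ J₂ I₃ J₃ : E} {u : I₁ ⟶ I₂} {v : J₁ ⟶ J₂} {u' : I₂ ⟶ I₃}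
    {v' : J₂ ⟶ J₃} {F₁ : PolyDiagram I₁ J₁} {F₂ : PolyDiagram I₂ J₂} {F₃ : PolyDiagram I₃ J₃}
    (d : CartDiagram u v F₁ F₂) (e : CartDiagram u' v' F₂ F₃) :
    CartDiagram (u ≫ u') (v ≫ v') F₁ F₃ where
  onB := d.onB ≫ e.onB
  onA := d.onA ≫ e.onA
  isPullback := d.isPullback.paste_horiz e.isPullback
  comm_left := by
    have h := d.comm_left
    rw [reassoc_of% h, e.comm_left, Category.assoc]
  comm_right := by
    have h := d.comm_right
    rw [Category.assoc, e.comm_right, reassoc_of% h]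

/-! ### Composition of polynomials -/

/-- The identity polynomial `I = I = I = I`. -/
def PolyDiagram.id (I : E) : PolyDiagram I I := ⟨I, I, 𝟙 I, 𝟙 I, 𝟙 I⟩

section Comp

variable {I J K : E} (F : PolyDiagram I J) (G : PolyDiagram J K)

/-- The base `{(c, φ) | c ∈ C, φ ∈ ∏_{d ∈ D_c} A_{u d}}` of the composite of
`F = (I ← B → A → J)` followed by `G = (J ←u- D → C → K)`, i.e. the dependent product along `D → C`
of the pullback of `A → J` along `u : D → J`. -/
abbrev PolyDiagram.compA : E := G.dom (Over.mk F.t)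

/-- The map `((c, φ), d) ↦ φ d`. -/
def PolyDiagram.compEval :
    pullback (G.shape (Over.mk F.t)) G.f ⟶ F.A :=
  evalAt (F := G) (X := Over.mk F.t) (pullback.fst _ _) (pullback.snd _ _) pullback.condition

/-- The composite (substitution) of `F = (I ← B → A → J)` followed by `G = (J ← D → C → K)`:
`I ← {((c, φ), d, b) | f b = φ d} → {(c, φ)} → K`. -/
def PolyDiagram.comp : PolyDiagram I K where
  B := pullback F.f (F.compEval G)
  A := F.compA G
  s := pullback.fst F.f (F.compEval G) ≫ F.s
  f := pullback.snd F.f (F.compEval G) ≫ pullback.fst (G.shape (Over.mk F.t)) G.f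
  t := G.shape (Over.mk F.t) ≫ G.t

/-- The map `((c, φ), ψ) ↦ (c, φ)`. -/
def PolyDiagram.compBase (X : Over I) : (F.comp G).dom X ⟶ G.dom (Over.mk F.t) :=
  (F.comp G).shape X

section

variable {F G}

/-- The value at `d` of the `compA`-part of an element `y`. -/
def PolyDiagram.compShape {X : Over I} {Z : E} (y : Z ⟶ (F.comp G).dom X) (d : Z ⟶ G.B)
    (h : (y ≫ F.compBase G X) ≫ G.shape (Over.mk F.t) = d ≫ G.f) : Z ⟶ F.A :=
  evalAt (F := G) (X := Over.mk F.t) (y ≫ F.compBase G X) d h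

theorem PolyDiagram.compShape_t {X : Over I} {Z : E} (y : Z ⟶ (F.comp G).dom X) (d : Z ⟶ G.B)
    (h : (y ≫ F.compBase G X) ≫ G.shape (Over.mk F.t) = d ≫ G.f) :
    PolyDiagram.compShape y d h ≫ F.t = d ≫ G.s :=
  evalAt_hom (F := G) (X := Over.mk F.t) _ _ _

theorem PolyDiagram.comp_compShape {X : Over I} {Z' Z : E} (g : Z' ⟶ Z)
    (y : Z ⟶ (F.comp G).dom X) (d : Z ⟶ G.B)
    (h : (y ≫ F.compBase G X) ≫ G.shape (Over.mk F.t) = d ≫ G.f) :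
    g ≫ PolyDiagram.compShape y d h = PolyDiagram.compShape (g ≫ y) (g ≫ d)
      (by simp only [Category.assoc] at h ⊢; rw [h]) := by
  refine (comp_evalAt (F := G) (X := Over.mk F.t) _ _ _ _).trans ?_
  exact evalAt_congr _ (Category.assoc _ _ _).symm rfl

/-- The element `((c, φ), d, b)` of `B`, where `y` lies over `(c, φ)`. -/
def PolyDiagram.compPos {X : Over I} {Z : E} (y : Z ⟶ (F.comp G).dom X) (d : Z ⟶ G.B)
    (h : (y ≫ F.compBase G X) ≫ G.shape (Over.mk F.t) = d ≫ G.f) (b : Z ⟶ F.B)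
    (hb : PolyDiagram.compShape y d h = b ≫ F.f) : Z ⟶ (F.comp G).B :=
  pullback.lift b (pullback.lift (y ≫ F.compBase G X) d h) (by
    rw [← hb, PolyDiagram.compEval, comp_evalAt, PolyDiagram.compShape]
    exact evalAt_congr _ (pullback.lift_fst _ _ _).symm (pullback.lift_snd _ _ _).symm)

theorem PolyDiagram.compPos_f {X : Over I} {Z : E} (y : Z ⟶ (F.comp G).dom X) (d : Z ⟶ G.B)
    (h : (y ≫ F.compBase G X) ≫ G.shape (Over.mk F.t) = d ≫ G.f) (b : Z ⟶ F.B)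
    (hb : PolyDiagram.compShape y d h = b ≫ F.f) :
    y ≫ F.compBase G X = PolyDiagram.compPos y d h b hb ≫ (F.comp G).f :=
  ((pullback.lift_snd_assoc _ _ _ _).trans (pullback.lift_fst _ _ _)).symm

theorem PolyDiagram.compPos_s {X : Over I} {Z : E} (y : Z ⟶ (F.comp G).dom X) (d : Z ⟶ G.B)
    (h : (y ≫ F.compBase G X) ≫ G.shape (Over.mk F.t) = d ≫ G.f) (b : Z ⟶ F.B)
    (hb : PolyDiagram.compShape y d h = b ≫ F.f) :
    PolyDiagram.compPos y d h b hb ≫ (F.comp G).s = b ≫ F.s :=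
  pullback.lift_fst_assoc _ _ _ _

end

/-- The canonical map from the extension of a composite to the composite of the extensions,
`((c, φ), ψ) ↦ (c, d ↦ (φ d, b ↦ ψ (d, b)))`. -/
def compMap (X : Over I) : (F.comp G).dom X ⟶ G.dom (F.ext.functor.obj X) :=
  let y := pullback.fst (F.compBase G X ≫ G.shape (Over.mk F.t)) G.f
  let d := pullback.snd (F.compBase G X ≫ G.shape (Over.mk F.t)) G.f
  have h : (y ≫ F.compBase G X) ≫ G.shape (Over.mk F.t) = d ≫ G.f :=
    (Category.assoc _ _ _).trans pullback.condition
  let a := PolyDiagram.compShape y d h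
  let y' := pullback.fst a F.f ≫ y
  let d' := pullback.fst a F.f ≫ d
  let b := pullback.snd a F.f
  have h' : (y' ≫ F.compBase G X) ≫ G.shape (Over.mk F.t) = d' ≫ G.f := by
    simp only [y', d', Category.assoc] at h ⊢
    rw [h]
  have hb : PolyDiagram.compShape y' d' h' = b ≫ F.f :=
    (PolyDiagram.comp_compShape _ _ _ _).symm.trans pullback.condition
  lam (F := G) (X := F.ext.functor.obj X) (F.compBase G X ≫ G.shape (Over.mk F.t))
    (lam (F := F) (X := X) a
      (evalAt y' (PolyDiagram.compPos y' d' h' b hb) (PolyDiagram.compPos_f _ _ _ _ _))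
      ((evalAt_hom _ _ _).trans (PolyDiagram.compPos_s _ _ _ _ _)))
    (by
      refine Eq.trans ?_ (PolyDiagram.compShape_t y d h)
      refine (Category.assoc _ _ _).symm.trans ?_
      exact congrArg (· ≫ F.t) (lam_shape _ _ _))

/-- The canonical map from the extension of the identity polynomial to the identity functor,
`(i, φ) ↦ φ i`. -/
def idMap (X : Over I) : (PolyDiagram.id I).dom X ⟶ X.left :=
  evalAt (𝟙 _) ((PolyDiagram.id I).shape X)
    ((Category.id_comp _).trans (Category.comp_id _).symm)

end Comp

/-! ### Polynomial functors -/

theorem IsStrong.id {I J : E} (P : StrongFunctor I J) : IsStrong (P := P) (Q := P) (𝟙 P.functor) :=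
  fun K a => by simp [tensMap_id]

/-- A polynomial functor is a (strong) functor which is isomorphic, as a strong functor, to the
extension of a polynomial. -/
def IsPolyFunctor {I J : E} (P : StrongFunctor I J) : Prop :=
  ∃ (F : PolyDiagram I J) (e : F.ext.functor ≅ P.functor), IsStrong (P := F.ext) (Q := P) e.hom

theorem isPoly_ext {I J : E} (F : PolyDiagram I J) : IsPolyFunctor F.ext :=
  ⟨F, Iso.refl _, IsStrong.id _⟩

/-- Cartesian squares: the underlying natural transformation is cartesian, i.e. all its naturality
squares are pullbacks. -/
def IsCartesianSquare {I' J' I J : E} {u : I' ⟶ I} {v : J' ⟶ J} {P' : StrongFunctor I' J'}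
    {P : StrongFunctor I J} (σ : StrongSquare u v P' P) : Prop :=
  NatTrans.Equifibered σ.nat

/-- The base change `v^* P Σ_u` of `P` along `(u, v)`. -/
def baseChange {I' J' I J : E} (u : I' ⟶ I) (v : J' ⟶ J) (P : StrongFunctor I J) :
    StrongFunctor I' J' :=
  ((sumS u).comp P).comp (pullS v)

/-- The square `Σ_v v^* P Σ_u ⟶ P Σ_u` given by the counit of `Σ_v ⊣ v^*`. -/
def baseChangeSquare {I' J' I J : E} (u : I' ⟶ I) (v : J' ⟶ J) (P : StrongFunctor I J) :
    StrongSquare u v (baseChange u v P) P where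
  nat :=
    { app := fun X => (Over.mapPullbackAdj v).counit.app (P.functor.obj ((Over.map u).obj X))
      naturality := fun X Y g =>
        (Over.mapPullbackAdj v).counit.naturality (P.functor.map ((Over.map u).map g)) }
  strong := (isStrong_iff _).2 fun K X => by
    let b := P.functor.obj ((Over.map u).obj X)
    let g : tens K b ⟶ P.functor.obj ((Over.map u).obj (tens K X)) :=
      P.strength.app K ((Over.map u).obj X) ≫ P.functor.map (sumTens u K X)
    have hc (Y : Over J) : ((Over.mapPullbackAdj v).counit.app Y).left = pullback.fst Y.hom v := by
      simp
    have key : (pullStrength v K b ≫ pullMap v g) ≫ pullback.fst _ v =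
        prod.map (𝟙 K) (pullback.fst b.hom v) ≫ g.left := by
      rw [Category.assoc, pullMap_fst, ← Category.assoc, pullStrength_fst]
    have h₁ := hc (P.functor.obj ((Over.map u).obj (tens K X)))
    have h₂ := hc b
    show (pullStrength v K b ≫ pullMap v _) ≫ ((Over.mapPullbackAdj v).counit.app
        (P.functor.obj ((Over.map u).obj (tens K X)))).left =
      prod.map (𝟙 K) ((Over.mapPullbackAdj v).counit.app b).left ≫ _ ≫ _
    rw [h₁, h₂]
    exact key

/-- The cobase change `Σ_v P' u^*` of `P'` along `(u, v)`. -/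
def cobaseChange {I' J' I J : E} (u : I' ⟶ I) (v : J' ⟶ J) (P' : StrongFunctor I' J') :
    StrongFunctor I J :=
  ((pullS u).comp P').comp (sumS v)

/-- The square `Σ_v P' ⟶ Σ_v P' u^* Σ_u` given by the unit of `Σ_u ⊣ u^*`. -/
def cobaseChangeSquare {I' J' I J : E} (u : I' ⟶ I) (v : J' ⟶ J) (P' : StrongFunctor I' J') :
    StrongSquare u v P' (cobaseChange u v P') where
  nat :=
    { app := fun X => (Over.map v).map (P'.functor.map ((Over.mapPullbackAdj u).unit.app X))
      naturality := fun X Y g => Over.OverMorphism.ext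
        (map_left_comm P'.functor _ _ _ ((Over.pullback u).map ((Over.map u).map g))
          (congrArg Over.Hom.left ((Over.mapPullbackAdj u).unit.naturality g))) }
  strong := (isStrong_iff _).2 fun K X => by
    have hc (Y : Over I') : ((Over.mapPullbackAdj u).unit.app Y).left =
        pullback.lift (𝟙 Y.left) Y.hom (by simp) := by
      simp
    let η := (Over.mapPullbackAdj u).unit
    let st : tens K ((Over.pullback u).obj ((Over.map u).obj X)) ⟶
      (Over.pullback u).obj (tens K ((Over.map u).obj X)) := (pullS u).strength.app K _
    let st' := (Over.pullback u).map (sumTens u K X)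
    have key : η.app (tens K X) = tensMap (𝟙 K) (η.app X) ≫ st ≫ st' := by
      ext
      show ((Over.mapPullbackAdj u).unit.app (tens K X)).left =
        prod.map (𝟙 K) ((Over.mapPullbackAdj u).unit.app X).left ≫
          pullStrength u K ((Over.map u).obj X) ≫ pullMap u (sumTens u K X)
      rw [hc, hc]
      apply pullback.hom_ext
      · rw [Category.assoc, Category.assoc, pullMap_fst, reassoc_of% (pullStrength_fst u K),
          sumTens_left]
        erw [pullback.lift_fst, Category.comp_id]
        rw [prod.map_map, pullback.lift_fst]
        simp
      · rw [Category.assoc, Category.assoc, pullMap_snd, pullStrength_snd]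
        erw [prod.map_snd_assoc, pullback.lift_snd, pullback.lift_snd]
        rfl
    show (P'.strength.app K X).left ≫ (P'.functor.map (η.app (tens K X))).left =
      prod.map (𝟙 K) (P'.functor.map (η.app X)).left ≫
        (𝟙 _ ≫ (P'.strength.app K _).left ≫ (P'.functor.map st).left) ≫ (P'.functor.map st').left
    have e := P'.strength.naturality_left (𝟙 K) (η.app X)
    rw [Category.id_comp, Category.assoc]
    erw [reassoc_of% e]
    congr 1
    rw [map_left_comp P'.functor st st' (_ ≫ _) rfl, key]
    exact (map_left_comp P'.functor _ _ _ rfl).symm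

/-! ### The double categories of polynomials -/

/-- The underlying data of the double category of polynomials: horizontal arrows are polynomials,
and squares are diagrams up to choice of the pullback. -/
def polyGraph (E : Type u) [Category.{v} E] [HasFiniteLimits E] [IsLCC E] :
    DoubleGraph.{max u v, max u v} E where
  Hor I J := PolyDiagram I J
  Sq u v F' F := Quotient (SqDiagram.setoid (u := u) (v := v) (F' := F') (F := F))
  hid I := PolyDiagram.id I
  hcomp F G := F.comp G

/-- The underlying data of the double category of polynomials and cartesian diagrams. -/
def cartGraph (E : Type u) [Category.{v} E] [HasFiniteLimits E] [IsLCC E] :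
    DoubleGraph.{v, max u v} E where
  Hor I J := PolyDiagram I J
  Sq u v F' F := CartDiagram u v F' F
  hid I := PolyDiagram.id I
  hcomp F G := F.comp G

/-- The square `σ` with identity vertical boundary has components `φ X`, up to the identifications
`Σ_1 X = X`. -/
def StrongSquare.HasComponents {I J : E} {P Q : StrongFunctor I J}
    (σ : StrongSquare (𝟙 I) (𝟙 J) P Q)
    (φ : ∀ X : Over I, (P.functor.obj X).left ⟶ (Q.functor.obj X).left) : Prop :=
  ∀ X : Over I, (σ.nat.app X).left =
    φ X ≫ (Q.functor.map ((Over.mapId I).inv.app X)).left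


/-- The class of a diagram, as a square of the double category of polynomials. -/
def SqDiagram.cls {I' J' I J : E} {u : I' ⟶ I} {v : J' ⟶ J} {F' : PolyDiagram I' J'}
    {F : PolyDiagram I J} (d : SqDiagram u v F' F) : (polyGraph E).Sq u v F' F :=
  Quotient.mk _ d

end

end PolyDouble

open PolyDouble

/-!
# Polynomial functors and polynomials form equivalent framed bicategories

The proof works with generalised elements: an element of `Σ_t Π_f s^* X` is a pair `(a, φ)` of a
shape `a` and a family `φ` of elements of `X` indexed by the positions `b` with `f b = a`, and maps
out of or between extensions are computed on such pairs.

*Squares and diagrams.* Over `s : B ⟶ I` the extension of a polynomial has a generic element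
`genElt : a ↦ (a, b ↦ b)`. Every element `(a, φ)` is the image, under the morphism `φ` of `E/I`, of
the family `famElt`, whose fibre embeds in a tensor of `s : B ⟶ I` in such a way that the family
becomes an image of the generic element under the strength. Extensions preserve monomorphisms, so a
strong natural transformation out of an extension is determined by its value at the generic element
(`StrongSquare.ext_genElt`). Conversely this value is a shape `α a'` together with a family of
elements of `B'`; naturality along the inclusion of the fibre in the tensor with `A'`, together
with strength, shows that these lie over `a'` (`StrongSquare.evalAt_genElt_map_f`), which is
exactly a diagram (`StrongSquare.diagram_square`). For a square that is cartesian, lifting the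
generic element along one naturality square inverts the map `D ⟶ B'`
(`SqDiagram.exists_inverse_toB'`).

*Polynomial functors.* The comparison `compMap` between the extension of a composite and the
composite of the extensions is a strong natural isomorphism (`compIso`), so polynomial functors are
closed under composition. As `Σ_u` and `u^*` are extensions of spans, base change `v^* P Σ_u` and
cobase change `Σ_v P' u^*` are polynomial as well. Their universal properties are transposition
along `Σ_v ⊣ v^*` and `Σ_u ⊣ u^*` (`vcompSquare_baseChangeSquare_eq_iff`,
`vcompSquare_cobaseChangeSquare_eq_iff`). In the cartesian fragment everything remains cartesian
because the unit and counit of `Σ_u ⊣ u^*` are cartesian and polynomial functors preserve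
pullbacks.

*Polynomials.* The double categories of polynomials are transported from those of polynomial
functors: whenever squares correspond bijectively and the horizontal composites and identities are
compared by invertible globular squares, the structure and laws can be pulled back
(`Transport.doubleCat`), the comparison is a double functor (`Transport.doubleFunctor`), and if
each horizontal arrow is isomorphic to one in the image it is a framed biequivalence
(`Transport.isFramedBiequivalence`) and the framing is inherited (`Transport.isFramed`). Vertical
composition in the transported structure is that of diagrams, since composing diagrams represents
the composite square (`SqDiagram.comp_square`, `CartDiagram.comp_square`).
-/

universe w₂' w₂

namespace PolyDouble

noncomputable section

section

/-! ### Squares as morphisms of the category of horizontal arrows -/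

namespace DoubleCat

variable {O : Type u} [Category.{v} O] {G : DoubleGraph.{w', w} O} (D : DoubleCat G)

/-- The horizontal arrow `M`, as an object of `𝔻₁`; a reducible form of `DoubleCat.ofHor`, so that
the boundary of a morphism of `𝔻₁` is visible to unification. -/
abbrev horObj {I J : O} (M : G.Hor I J) : D.Total := ⟨I, J, M⟩

/-- The square `σ`, as a morphism of `𝔻₁`; a reducible form of `DoubleCat.ofSq`. -/
abbrev sqHom {I' J' I J : O} {u : I' ⟶ I} {v : J' ⟶ J} {M : G.Hor I' J'} {N : G.Hor I J}
    (σ : G.Sq u v M N) : D.horObj M ⟶ D.horObj N := ⟨u, v, σ⟩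

variable {I' J' I J : O} {u₁ u₂ : I' ⟶ I} {v₁ v₂ : J' ⟶ J} {M : G.Hor I' J'} {N : G.Hor I J}

/-- Squares are heterogeneously equal as soon as they are equal as morphisms of `𝔻₁`. -/
theorem heq_of_sqHom_eq {σ : G.Sq u₁ v₁ M N} {τ : G.Sq u₂ v₂ M N} (h : D.sqHom σ = D.sqHom τ) :
    σ ≍ τ := by
  injection h

theorem sqHom_eq_of_heq {σ : G.Sq u₁ v₁ M N} {τ : G.Sq u₂ v₂ M N} (hu : u₁ = u₂) (hv : v₁ = v₂)
    (h : σ ≍ τ) : D.sqHom σ = D.sqHom τ :=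
  Total.Hom.ext hu hv h

theorem sqHom_injective {σ τ : G.Sq u₁ v₁ M N} (h : D.sqHom σ = D.sqHom τ) : σ = τ :=
  eq_of_heq (D.heq_of_sqHom_eq h)

/-- The horizontal identity square on `u`, as a morphism of `𝔻₁`. -/
def hidHom {I' I : O} (u : I' ⟶ I) : D.horObj (G.hid I') ⟶ D.horObj (G.hid I) := D.sqHom (D.hidSq u)

/-- The right boundary of `f` is the left boundary of `g`. -/
def Matches {I J K I' J' K' : O} {M : G.Hor I J} {N : G.Hor J K} {M' : G.Hor I' J'}
    {N' : G.Hor J' K'} (f : D.horObj M ⟶ D.horObj M') (g : D.horObj N ⟶ D.horObj N') : Prop :=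
  g.left = f.right

/-- Horizontal composition of morphisms of `𝔻₁` whose boundaries match. -/
def hc {I J K I' J' K' : O} {M : G.Hor I J} {N : G.Hor J K} {M' : G.Hor I' J'} {N' : G.Hor J' K'}
    (f : D.horObj M ⟶ D.horObj M') (g : D.horObj N ⟶ D.horObj N') (h : D.Matches f g) :
    D.horObj (G.hcomp M N) ⟶ D.horObj (G.hcomp M' N') :=
  Total.Hom.mk (M := D.horObj (G.hcomp M N)) (N := D.horObj (G.hcomp M' N')) f.left g.right
    (D.hcompSq f.sq ((Eq.mp (congrArg (fun x => G.Sq x g.right N N') h) g.sq)))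

section

variable {D} {I₁ J₁ K₁ L₁ I₂ J₂ K₂ L₂ I₃ J₃ K₃ : O} {M₁ : G.Hor I₁ J₁} {N₁ : G.Hor J₁ K₁}
  {P₁ : G.Hor K₁ L₁} {M₂ : G.Hor I₂ J₂} {N₂ : G.Hor J₂ K₂} {P₂ : G.Hor K₂ L₂}
  {M₃ : G.Hor I₃ J₃} {N₃ : G.Hor J₃ K₃}

theorem Matches.of_eq {f : D.horObj M₁ ⟶ D.horObj M₂} {g : D.horObj N₁ ⟶ D.horObj N₂}
    (h : g.left = f.right) : D.Matches f g := h

theorem Matches.id (M : G.Hor I₁ J₁) (N : G.Hor J₁ K₁) :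
    D.Matches (𝟙 (D.horObj M)) (𝟙 (D.horObj N)) := rfl

theorem Matches.comp {f : D.horObj M₁ ⟶ D.horObj M₂} {f' : D.horObj M₂ ⟶ D.horObj M₃}
    {g : D.horObj N₁ ⟶ D.horObj N₂} {g' : D.horObj N₂ ⟶ D.horObj N₃} (h : D.Matches f g)
    (h' : D.Matches f' g') : D.Matches (f ≫ f') (g ≫ g') :=
  congrArg₂ (fun (x : J₁ ⟶ J₂) (y : J₂ ⟶ J₃) => x ≫ y) h h'

theorem Matches.congr {f f' : D.horObj M₁ ⟶ D.horObj M₂} {g g' : D.horObj N₁ ⟶ D.horObj N₂}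
    (h : D.Matches f g) (hf : f = f') (hg : g = g') : D.Matches f' g' := by
  subst hf hg; exact h

theorem Matches.hc_left {f : D.horObj M₁ ⟶ D.horObj M₂} {g : D.horObj N₁ ⟶ D.horObj N₂}
    (h : D.Matches f g) {k : D.horObj P₁ ⟶ D.horObj P₂} (h' : D.Matches g k) :
    D.Matches (D.hc f g h) k := h'

theorem Matches.hc_right {f : D.horObj M₁ ⟶ D.horObj M₂} {g : D.horObj N₁ ⟶ D.horObj N₂}
    (h : D.Matches f g) {k : D.horObj P₁ ⟶ D.horObj P₂} (h' : D.Matches g k) :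
    D.Matches f (D.hc g k h') := h

theorem Matches.sqHom {u : I₁ ⟶ I₂} {v : J₁ ⟶ J₂} {w : K₁ ⟶ K₂} (σ : G.Sq u v M₁ M₂)
    (τ : G.Sq v w N₁ N₂) : D.Matches (D.sqHom σ) (D.sqHom τ) := rfl

variable (D)

theorem hc_id (M : G.Hor I₁ J₁) (N : G.Hor J₁ K₁) :
    D.hc (𝟙 (D.horObj M)) (𝟙 (D.horObj N)) (.id M N) = 𝟙 (D.horObj (G.hcomp M N)) :=
  congrArg D.sqHom (D.hcompSq_vid M N)

theorem hc_comp (f : D.horObj M₁ ⟶ D.horObj M₂) (f' : D.horObj M₂ ⟶ D.horObj M₃)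
    (g : D.horObj N₁ ⟶ D.horObj N₂) (g' : D.horObj N₂ ⟶ D.horObj N₃) (h : D.Matches f g)
    (h' : D.Matches f' g') :
    D.hc f g h ≫ D.hc f' g' h' = D.hc (f ≫ f') (g ≫ g') (h.comp h') := by
  obtain ⟨gl, gr, gs⟩ := g
  obtain ⟨gl', gr', gs'⟩ := g'
  obtain rfl : gl = f.right := h
  obtain rfl : gl' = f'.right := h'
  exact (congrArg D.sqHom (D.interchange f.sq gs f'.sq gs')).symm

theorem hc_comp_assoc (f : D.horObj M₁ ⟶ D.horObj M₂) (f' : D.horObj M₂ ⟶ D.horObj M₃)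
    (g : D.horObj N₁ ⟶ D.horObj N₂) (g' : D.horObj N₂ ⟶ D.horObj N₃) (h : D.Matches f g)
    (h' : D.Matches f' g') {Z : D.Total} (k : D.horObj (G.hcomp M₃ N₃) ⟶ Z) :
    D.hc f g h ≫ D.hc f' g' h' ≫ k = D.hc (f ≫ f') (g ≫ g') (h.comp h') ≫ k := by
  rw [← Category.assoc, hc_comp]

theorem hc_congr {f f' : D.horObj M₁ ⟶ D.horObj M₂} {g g' : D.horObj N₁ ⟶ D.horObj N₂}
    (h : D.Matches f g) (hf : f = f') (hg : g = g') :
    D.hc f g h = D.hc f' g' (h.congr hf hg) := by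
  subst hf hg; rfl

theorem hc_comp_left {M₂' : G.Hor I₂ J₁} (f : D.horObj M₁ ⟶ D.horObj M₂')
    (f' : D.horObj M₂' ⟶ D.horObj M₃) (g : D.horObj N₁ ⟶ D.horObj N₃)
    (h : D.Matches (f ≫ f') g) (h₁ : D.Matches f (𝟙 (D.horObj N₁))) (h₂ : D.Matches f' g) :
    D.hc (f ≫ f') g h = D.hc f (𝟙 (D.horObj N₁)) h₁ ≫ D.hc f' g h₂ := by
  rw [hc_comp]
  exact D.hc_congr _ rfl (Category.id_comp g).symm

theorem hc_comp_right {N₂' : G.Hor J₁ K₂} (f : D.horObj M₁ ⟶ D.horObj M₃)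
    (g : D.horObj N₁ ⟶ D.horObj N₂') (g' : D.horObj N₂' ⟶ D.horObj N₃)
    (h : D.Matches f (g ≫ g')) (h₁ : D.Matches (𝟙 (D.horObj M₁)) g) (h₂ : D.Matches f g') :
    D.hc f (g ≫ g') h = D.hc (𝟙 (D.horObj M₁)) g h₁ ≫ D.hc f g' h₂ := by
  rw [hc_comp]
  exact D.hc_congr _ (Category.id_comp f).symm rfl

end

/-- The associator, as an isomorphism of `𝔻₁`. -/
def assocIso {I J K L : O} (M : G.Hor I J) (N : G.Hor J K) (P : G.Hor K L) :
    D.horObj (G.hcomp (G.hcomp M N) P) ≅ D.horObj (G.hcomp M (G.hcomp N P)) where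
  hom := D.sqHom (D.assoc M N P)
  inv := D.sqHom (D.assocInv M N P)
  hom_inv_id := D.sqHom_eq_of_heq (Category.comp_id _) (Category.comp_id _) (D.assoc_assocInv M N P)
  inv_hom_id := D.sqHom_eq_of_heq (Category.comp_id _) (Category.comp_id _) (D.assocInv_assoc M N P)

/-- The left unitor, as an isomorphism of `𝔻₁`. -/
def leftUnitIso {I J : O} (M : G.Hor I J) : D.horObj (G.hcomp (G.hid I) M) ≅ D.horObj M where
  hom := D.sqHom (D.leftUnit M)
  inv := D.sqHom (D.leftUnitInv M)
  hom_inv_id := D.sqHom_eq_of_heq (Category.comp_id _) (Category.comp_id _)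
    (D.leftUnit_leftUnitInv M)
  inv_hom_id := D.sqHom_eq_of_heq (Category.comp_id _) (Category.comp_id _)
    (D.leftUnitInv_leftUnit M)

/-- The right unitor, as an isomorphism of `𝔻₁`. -/
def rightUnitIso {I J : O} (M : G.Hor I J) : D.horObj (G.hcomp M (G.hid J)) ≅ D.horObj M where
  hom := D.sqHom (D.rightUnit M)
  inv := D.sqHom (D.rightUnitInv M)
  hom_inv_id := D.sqHom_eq_of_heq (Category.comp_id _) (Category.comp_id _)
    (D.rightUnit_rightUnitInv M)
  inv_hom_id := D.sqHom_eq_of_heq (Category.comp_id _) (Category.comp_id _)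
    (D.rightUnitInv_rightUnit M)

theorem hc_assocIso {I J K L I' J' K' L' : O} {M : G.Hor I J} {N : G.Hor J K} {P : G.Hor K L}
    {M' : G.Hor I' J'} {N' : G.Hor J' K'} {P' : G.Hor K' L'} (f : D.horObj M ⟶ D.horObj M')
    (g : D.horObj N ⟶ D.horObj N') (k : D.horObj P ⟶ D.horObj P') (h : D.Matches f g)
    (h' : D.Matches g k) :
    D.hc (D.hc f g h) k (h.hc_left h') ≫ (D.assocIso M' N' P').hom =
      (D.assocIso M N P).hom ≫ D.hc f (D.hc g k h') (h.hc_right h') := by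
  obtain ⟨gl, gr, gs⟩ := g
  obtain ⟨kl, kr, ks⟩ := k
  obtain rfl : gl = f.right := h
  obtain rfl : kl = gr := h'
  exact D.sqHom_eq_of_heq ((Category.comp_id _).trans (Category.id_comp _).symm)
    ((Category.comp_id _).trans (Category.id_comp _).symm) (D.assoc_naturality f.sq gs ks)

theorem hc_leftUnitIso {I J I' J' : O} {M : G.Hor I J} {M' : G.Hor I' J'}
    (f : D.horObj M ⟶ D.horObj M') (u : I ⟶ I') (h : D.Matches (D.hidHom u) f) :
    D.hc (D.hidHom u) f h ≫ (D.leftUnitIso M').hom = (D.leftUnitIso M).hom ≫ f := by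
  obtain ⟨fl, fr, fs⟩ := f
  obtain rfl : fl = u := h
  exact D.sqHom_eq_of_heq ((Category.comp_id _).trans (Category.id_comp _).symm)
    ((Category.comp_id _).trans (Category.id_comp _).symm) (D.leftUnit_naturality fs)

theorem hc_rightUnitIso {I J I' J' : O} {M : G.Hor I J} {M' : G.Hor I' J'}
    (f : D.horObj M ⟶ D.horObj M') (v : J ⟶ J') (h : D.Matches f (D.hidHom v)) :
    D.hc f (D.hidHom v) h ≫ (D.rightUnitIso M').hom = (D.rightUnitIso M).hom ≫ f := by
  obtain ⟨fl, fr, fs⟩ := f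
  obtain rfl : v = fr := h
  exact D.sqHom_eq_of_heq ((Category.comp_id _).trans (Category.id_comp _).symm)
    ((Category.comp_id _).trans (Category.id_comp _).symm) (D.rightUnit_naturality fs)

theorem hidHom_id (I : O) : D.hidHom (𝟙 I) = 𝟙 (D.horObj (G.hid I)) :=
  congrArg D.sqHom (D.hidSq_id I)

theorem hidHom_comp {I₁ I₂ I₃ : O} (u : I₁ ⟶ I₂) (u' : I₂ ⟶ I₃) :
    D.hidHom (u ≫ u') = D.hidHom u ≫ D.hidHom u' :=
  congrArg D.sqHom (D.hidSq_comp u u')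

theorem pentagon_hom {I J K L P : O} (A : G.Hor I J) (B : G.Hor J K) (C : G.Hor K L)
    (F : G.Hor L P) :
    D.hc (D.assocIso A B C).hom (𝟙 (D.horObj F)) (.of_eq rfl) ≫ (D.assocIso A (G.hcomp B C) F).hom ≫
        D.hc (𝟙 (D.horObj A)) (D.assocIso B C F).hom (.of_eq rfl) =
      (D.assocIso (G.hcomp A B) C F).hom ≫ (D.assocIso A B (G.hcomp C F)).hom :=
  D.sqHom_eq_of_heq (by change 𝟙 I ≫ 𝟙 I ≫ 𝟙 I = 𝟙 I ≫ 𝟙 I; simp)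
    (by change 𝟙 P ≫ 𝟙 P ≫ 𝟙 P = 𝟙 P ≫ 𝟙 P; simp) (D.pentagon A B C F)

theorem triangle_hom {I J K : O} (M : G.Hor I J) (N : G.Hor J K) :
    (D.assocIso M (G.hid J) N).hom ≫ D.hc (𝟙 (D.horObj M)) (D.leftUnitIso N).hom (.of_eq rfl) =
      D.hc (D.rightUnitIso M).hom (𝟙 (D.horObj N)) (.of_eq rfl) :=
  D.sqHom_eq_of_heq (Category.comp_id _) (Category.comp_id _) (D.triangle M N)

/-! ### Transporters and cotransporters -/

theorem isHomLift_iff {X Y : D.Total} (f : D.endpoints.obj X ⟶ D.endpoints.obj Y) (φ : X ⟶ Y) :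
    D.endpoints.IsHomLift f φ ↔ f = D.endpoints.map φ :=
  ⟨fun _ => IsHomLift.eq_of_isHomLift D.endpoints f φ, fun h => h ▸ inferInstance⟩

variable {D} in
theorem isHomLift_left {X Y : D.Total} {f : D.endpoints.obj X ⟶ D.endpoints.obj Y} {φ : X ⟶ Y}
    (h : D.endpoints.IsHomLift f φ) : f.1 = φ.left :=
  congrArg Prod.fst ((D.isHomLift_iff f φ).1 h)

variable {D} in
theorem isHomLift_right {X Y : D.Total} {f : D.endpoints.obj X ⟶ D.endpoints.obj Y} {φ : X ⟶ Y}
    (h : D.endpoints.IsHomLift f φ) : f.2 = φ.right :=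
  congrArg Prod.snd ((D.isHomLift_iff f φ).1 h)

/-- The universal property of a transporter, in terms of squares. -/
theorem isTransporter_of_existsUnique {u : I' ⟶ I} {v : J' ⟶ J} (σ : G.Sq u v M N)
    (h : ∀ {I₀ J₀ : O} (a : I₀ ⟶ I') (b : J₀ ⟶ J') (L : G.Hor I₀ J₀)
      (τ : G.Sq (a ≫ u) (b ≫ v) L N), ∃! χ : G.Sq a b L M, D.vcomp χ σ = τ) :
    D.IsTransporter σ where
  toIsHomLift := (D.isHomLift_iff (X := D.horObj M) (Y := D.horObj N) _ (D.sqHom σ)).2 rfl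
  universal_property' := by
    rintro ⟨I₀, J₀, L⟩ ⟨a, b⟩ ⟨l, r, τ⟩ hτ
    obtain rfl : a ≫ u = l := isHomLift_left hτ
    obtain rfl : b ≫ v = r := isHomLift_right hτ
    obtain ⟨χ, hχ, huniq⟩ := h a b L τ
    refine ⟨⟨a, b, χ⟩, ⟨(D.isHomLift_iff _ _).2 rfl, congrArg D.sqHom hχ⟩, ?_⟩
    rintro ⟨a', b', χ'⟩ ⟨h₁, h₂⟩
    obtain rfl : a = a' := isHomLift_left h₁
    obtain rfl : b = b' := isHomLift_right h₁
    obtain rfl := huniq χ' (D.sqHom_injective h₂)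
    rfl

/-- The universal property of a cotransporter, in terms of squares. -/
theorem isCotransporter_of_existsUnique {u : I' ⟶ I} {v : J' ⟶ J} (σ : G.Sq u v M N)
    (h : ∀ {I₀ J₀ : O} (a : I ⟶ I₀) (b : J ⟶ J₀) (L : G.Hor I₀ J₀)
      (τ : G.Sq (u ≫ a) (v ≫ b) M L), ∃! χ : G.Sq a b N L, D.vcomp σ χ = τ) :
    D.IsCotransporter σ where
  toIsHomLift := (D.isHomLift_iff (X := D.horObj M) (Y := D.horObj N) _ (D.sqHom σ)).2 rfl
  universal_property' := by
    rintro ⟨I₀, J₀, L⟩ ⟨a, b⟩ ⟨l, r, τ⟩ hτ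
    obtain rfl : u ≫ a = l := isHomLift_left hτ
    obtain rfl : v ≫ b = r := isHomLift_right hτ
    obtain ⟨χ, hχ, huniq⟩ := h a b L τ
    refine ⟨⟨a, b, χ⟩, ⟨(D.isHomLift_iff _ _).2 rfl, congrArg D.sqHom hχ⟩, ?_⟩
    rintro ⟨a', b', χ'⟩ ⟨h₁, h₂⟩
    obtain rfl : a = a' := isHomLift_left h₁
    obtain rfl : b = b' := isHomLift_right h₁
    obtain rfl := huniq χ' (D.sqHom_injective h₂)
    rfl

theorem isFramed_of_lifts
    (h : ∀ {I' J' I J : O} (u : I' ⟶ I) (v : J' ⟶ J) (N : G.Hor I J),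
      ∃ (M : G.Hor I' J') (σ : G.Sq u v M N), D.IsTransporter σ)
    (h' : ∀ {I' J' I J : O} (u : I' ⟶ I) (v : J' ⟶ J) (M : G.Hor I' J'),
      ∃ (N : G.Hor I J) (σ : G.Sq u v M N), D.IsCotransporter σ) : D.IsFramed where
  exists_transporter := by
    rintro ⟨I, J, N⟩ ⟨I', J'⟩ ⟨u, v⟩
    obtain ⟨M, σ, hσ⟩ := h u v N
    exact ⟨_, _, hσ⟩
  exists_cotransporter := by
    rintro ⟨I', J', M⟩ ⟨I, J⟩ ⟨u, v⟩
    obtain ⟨N, σ, hσ⟩ := h' u v M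
    exact ⟨_, _, hσ⟩

end DoubleCat

end

section

/-! ### Transport of double categories -/

namespace DoubleCat

variable {O : Type u} [Category.{v} O] {G : DoubleGraph.{w', w} O} (D : DoubleCat G)

/-- Horizontal composition of isomorphisms of `𝔻₁`. -/
def hcIso {I J K I' J' K' : O} {M : G.Hor I J} {N : G.Hor J K} {M' : G.Hor I' J'} {N' : G.Hor J' K'}
    (f : D.horObj M ≅ D.horObj M') (g : D.horObj N ≅ D.horObj N') (h : D.Matches f.hom g.hom)
    (h' : D.Matches f.inv g.inv) :
    D.horObj (G.hcomp M N) ≅ D.horObj (G.hcomp M' N') where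
  hom := D.hc f.hom g.hom h
  inv := D.hc f.inv g.inv h'
  hom_inv_id := by
    rw [hc_comp, D.hc_congr _ f.hom_inv_id g.hom_inv_id, hc_id]
  inv_hom_id := by
    rw [hc_comp, D.hc_congr _ f.inv_hom_id g.inv_hom_id, hc_id]

theorem hcIso_hom {I J K I' J' K' : O} {M : G.Hor I J} {N : G.Hor J K} {M' : G.Hor I' J'}
    {N' : G.Hor J' K'} (f : D.horObj M ≅ D.horObj M') (g : D.horObj N ≅ D.horObj N')
    (h : D.Matches f.hom g.hom) (h' : D.Matches f.inv g.inv) :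
    (D.hcIso f g h h').hom = D.hc f.hom g.hom h := rfl

end DoubleCat

/-- The data needed to transport a double category `D` along a map `hor` of horizontal arrows:
a correspondence between squares, and invertible globular squares comparing the horizontal
composites and identities. -/
structure Transport {O : Type u} [Category.{v} O] (G : DoubleGraph.{w', w} O)
    {H : DoubleGraph.{w₂', w₂} O} (D : DoubleCat H) (hor : ∀ {I J : O}, G.Hor I J → H.Hor I J) where
  e : ∀ {I' J' I J : O} {u : I' ⟶ I} {v : J' ⟶ J} {M : G.Hor I' J'} {N : G.Hor I J},
    G.Sq u v M N ≃ H.Sq u v (hor M) (hor N)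
  comp : ∀ {I J K : O} (M : G.Hor I J) (N : G.Hor J K),
    H.Sq (𝟙 I) (𝟙 K) (hor (G.hcomp M N)) (H.hcomp (hor M) (hor N))
  compInv : ∀ {I J K : O} (M : G.Hor I J) (N : G.Hor J K),
    H.Sq (𝟙 I) (𝟙 K) (H.hcomp (hor M) (hor N)) (hor (G.hcomp M N))
  comp_compInv : ∀ {I J K : O} (M : G.Hor I J) (N : G.Hor J K),
    D.vcomp (comp M N) (compInv M N) ≍ D.vid (hor (G.hcomp M N))
  compInv_comp : ∀ {I J K : O} (M : G.Hor I J) (N : G.Hor J K),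
    D.vcomp (compInv M N) (comp M N) ≍ D.vid (H.hcomp (hor M) (hor N))
  unit : ∀ I : O, H.Sq (𝟙 I) (𝟙 I) (hor (G.hid I)) (H.hid I)
  unitInv : ∀ I : O, H.Sq (𝟙 I) (𝟙 I) (H.hid I) (hor (G.hid I))
  unit_unitInv : ∀ I : O, D.vcomp (unit I) (unitInv I) ≍ D.vid (hor (G.hid I))
  unitInv_unit : ∀ I : O, D.vcomp (unitInv I) (unit I) ≍ D.vid (H.hid I)

namespace Transport

open DoubleCat

variable {O : Type u} [Category.{v} O] {G : DoubleGraph.{w', w} O}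
  {H : DoubleGraph.{w₂', w₂} O} {D : DoubleCat H} {hor : ∀ {I J : O}, G.Hor I J → H.Hor I J}
  (T : Transport G D hor)

/-- The morphism of `𝔻₁` corresponding to a square. -/
abbrev hom {I' J' I J : O} {u : I' ⟶ I} {v : J' ⟶ J} {M : G.Hor I' J'} {N : G.Hor I J}
    (σ : G.Sq u v M N) : D.horObj (hor M) ⟶ D.horObj (hor N) := D.sqHom (T.e σ)

theorem heq_of_hom_eq {I' J' I J : O} {u₁ u₂ : I' ⟶ I} {v₁ v₂ : J' ⟶ J} {M : G.Hor I' J'}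
    {N : G.Hor I J} {σ : G.Sq u₁ v₁ M N} {τ : G.Sq u₂ v₂ M N} (h : T.hom σ = T.hom τ) :
    σ ≍ τ := by
  obtain rfl : u₁ = u₂ := congrArg Total.Hom.left h
  obtain rfl : v₁ = v₂ := congrArg Total.Hom.right h
  exact heq_of_eq (T.e.injective (D.sqHom_injective h))

theorem eq_of_hom_eq {I' J' I J : O} {u : I' ⟶ I} {v : J' ⟶ J} {M : G.Hor I' J'}
    {N : G.Hor I J} {σ τ : G.Sq u v M N} (h : T.hom σ = T.hom τ) : σ = τ :=
  eq_of_heq (T.heq_of_hom_eq h)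

/-- The square with boundary `(u, v)` corresponding to a morphism of `𝔻₁`; the boundary is
prescribed, as that of the morphism may only be propositionally equal to it. -/
def ofHom {I' J' I J : O} {u : I' ⟶ I} {v : J' ⟶ J} {M : G.Hor I' J'} {N : G.Hor I J}
    (f : D.horObj (hor M) ⟶ D.horObj (hor N)) (hl : f.left = u) (hr : f.right = v) :
    G.Sq u v M N :=
  T.e.symm (hl ▸ hr ▸ f.sq : H.Sq u v (hor M) (hor N))

theorem hom_ofHom {I' J' I J : O} {u : I' ⟶ I} {v : J' ⟶ J} {M : G.Hor I' J'} {N : G.Hor I J}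
    (f : D.horObj (hor M) ⟶ D.horObj (hor N)) (hl : f.left = u) (hr : f.right = v) :
    T.hom (T.ofHom f hl hr) = f := by
  subst hl hr
  exact congrArg D.sqHom (T.e.apply_symm_apply f.sq)

/-- The comparison of horizontal composites, as an isomorphism of `𝔻₁`. -/
def compIso {I J K : O} (M : G.Hor I J) (N : G.Hor J K) :
    D.horObj (hor (G.hcomp M N)) ≅ D.horObj (H.hcomp (hor M) (hor N)) where
  hom := D.sqHom (T.comp M N)
  inv := D.sqHom (T.compInv M N)
  hom_inv_id := D.sqHom_eq_of_heq (Category.comp_id _) (Category.comp_id _) (T.comp_compInv M N)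
  inv_hom_id := D.sqHom_eq_of_heq (Category.comp_id _) (Category.comp_id _) (T.compInv_comp M N)

/-- The comparison of horizontal identities, as an isomorphism of `𝔻₁`. -/
def unitIso (I : O) : D.horObj (hor (G.hid I)) ≅ D.horObj (H.hid I) where
  hom := D.sqHom (T.unit I)
  inv := D.sqHom (T.unitInv I)
  hom_inv_id := D.sqHom_eq_of_heq (Category.comp_id _) (Category.comp_id _) (T.unit_unitInv I)
  inv_hom_id := D.sqHom_eq_of_heq (Category.comp_id _) (Category.comp_id _) (T.unitInv_unit I)

/-- The transported associator. -/
def assocIso {I J K L : O} (M : G.Hor I J) (N : G.Hor J K) (P : G.Hor K L) :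
    D.horObj (hor (G.hcomp (G.hcomp M N) P)) ≅ D.horObj (hor (G.hcomp M (G.hcomp N P))) :=
  T.compIso (G.hcomp M N) P ≪≫ D.hcIso (T.compIso M N) (Iso.refl (D.horObj (hor P))) (.of_eq rfl)
      (.of_eq rfl) ≪≫
    D.assocIso (hor M) (hor N) (hor P) ≪≫
    D.hcIso (Iso.refl (D.horObj (hor M))) (T.compIso N P).symm (.of_eq rfl) (.of_eq rfl) ≪≫
    (T.compIso M (G.hcomp N P)).symm

/-- The transported left unitor. -/
def leftUnitIso {I J : O} (M : G.Hor I J) :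
    D.horObj (hor (G.hcomp (G.hid I) M)) ≅ D.horObj (hor M) :=
  T.compIso (G.hid I) M ≪≫ D.hcIso (T.unitIso I) (Iso.refl (D.horObj (hor M))) (.of_eq rfl)
      (.of_eq rfl) ≪≫
    D.leftUnitIso (hor M)

/-- The transported right unitor. -/
def rightUnitIso {I J : O} (M : G.Hor I J) :
    D.horObj (hor (G.hcomp M (G.hid J))) ≅ D.horObj (hor M) :=
  T.compIso M (G.hid J) ≪≫
    D.hcIso (Iso.refl (D.horObj (hor M))) (T.unitIso J) (.of_eq rfl) (.of_eq rfl) ≪≫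
    D.rightUnitIso (hor M)

/-- The transported horizontal composite of two squares, as a morphism of `𝔻₁`. -/
def hcompHom {I' J' K' I J K : O} {u : I' ⟶ I} {v : J' ⟶ J} {w : K' ⟶ K}
    {M' : G.Hor I' J'} {N' : G.Hor J' K'} {M : G.Hor I J} {N : G.Hor J K}
    (σ : G.Sq u v M' M) (τ : G.Sq v w N' N) :
    D.horObj (hor (G.hcomp M' N')) ⟶ D.horObj (hor (G.hcomp M N)) :=
  (T.compIso M' N').hom ≫ D.hc (T.hom σ) (T.hom τ) (.sqHom _ _) ≫ (T.compIso M N).inv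

theorem id_comp_comp_id {I' I : O} (u : I' ⟶ I) : 𝟙 I' ≫ u ≫ 𝟙 I = u := by simp

theorem id_comp_five (I : O) : 𝟙 I ≫ 𝟙 I ≫ 𝟙 I ≫ 𝟙 I ≫ 𝟙 I = 𝟙 I := by simp

theorem id_comp_assoc_five (I : O) : (((𝟙 I ≫ 𝟙 I) ≫ 𝟙 I) ≫ 𝟙 I) ≫ 𝟙 I = 𝟙 I := by simp

/-- The structure of a double category transported along `hor`. Its laws are equations between
morphisms of `𝔻₁`, where the comparisons of composites and identities cancel. -/
def doubleCat : DoubleCat G where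
  vid M := T.ofHom (𝟙 (D.horObj (hor M))) (id rfl) (id rfl)
  vcomp σ τ := T.ofHom (T.hom σ ≫ T.hom τ) (id rfl) (id rfl)
  vid_vcomp σ := T.heq_of_hom_eq (by simp only [hom_ofHom]; exact Category.id_comp _)
  vcomp_vid σ := T.heq_of_hom_eq (by simp only [hom_ofHom]; exact Category.comp_id _)
  vcomp_assoc σ τ ρ := T.heq_of_hom_eq (by simp only [hom_ofHom]; exact Category.assoc _ _ _)
  hidSq {I' I} u := T.ofHom ((T.unitIso I').hom ≫ D.hidHom u ≫ (T.unitIso I).inv)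
    (id (id_comp_comp_id u)) (id (id_comp_comp_id u))
  hidSq_id I := T.eq_of_hom_eq (by simp [hom_ofHom, hidHom_id])
  hidSq_comp u u' := T.eq_of_hom_eq (by simp [hom_ofHom, hidHom_comp])
  hcompSq {_ _ _ _ _ _ u _ w _ _ _ _} σ τ := T.ofHom (T.hcompHom σ τ) (id (id_comp_comp_id u))
    (id (id_comp_comp_id w))
  hcompSq_vid M N := T.eq_of_hom_eq (by
    simp only [hom_ofHom, hcompHom]
    rw [D.hc_id, Category.id_comp, Iso.hom_inv_id])
  interchange σ σ' τ τ' := T.eq_of_hom_eq (by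
    simp only [hom_ofHom, hcompHom, Category.assoc, Iso.inv_hom_id_assoc, hc_comp_assoc])
  assoc {I _ _ L} M N P :=
    T.ofHom (T.assocIso M N P).hom (id (id_comp_five I)) (id (id_comp_five L))
  assocInv {I _ _ L} M N P :=
    T.ofHom (T.assocIso M N P).inv (id (id_comp_assoc_five I)) (id (id_comp_assoc_five L))
  assoc_assocInv M N P := T.heq_of_hom_eq (by simp only [hom_ofHom, Iso.hom_inv_id])
  assocInv_assoc M N P := T.heq_of_hom_eq (by simp only [hom_ofHom, Iso.inv_hom_id])
  assoc_naturality σ τ ρ := T.heq_of_hom_eq (by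
    simp only [hom_ofHom, hcompHom, assocIso]
    simp only [Iso.trans_hom, hcIso_hom, Iso.refl_hom, Iso.symm_hom, Category.assoc,
      Iso.inv_hom_id_assoc, hc_comp_assoc, Category.comp_id, Category.id_comp, Iso.inv_hom_id]
    rw [D.hc_comp_left, Category.assoc,
      reassoc_of% (D.hc_assocIso (T.hom σ) (T.hom τ) (T.hom ρ) (.of_eq rfl) (.of_eq rfl))]
    · simp only [hc_comp_assoc, Category.comp_id]
    all_goals exact rfl)
  leftUnit {I J} M :=
    T.ofHom (T.leftUnitIso M).hom (id (id_comp_comp_id (𝟙 I))) (id (id_comp_comp_id (𝟙 J)))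
  leftUnitInv {I J} M := T.ofHom (T.leftUnitIso M).inv
    (id ((Category.assoc _ _ _).trans (id_comp_comp_id (𝟙 I))))
    (id ((Category.assoc _ _ _).trans (id_comp_comp_id (𝟙 J))))
  leftUnit_leftUnitInv M := T.heq_of_hom_eq (by simp only [hom_ofHom, Iso.hom_inv_id])
  leftUnitInv_leftUnit M := T.heq_of_hom_eq (by simp only [hom_ofHom, Iso.inv_hom_id])
  leftUnit_naturality σ := T.heq_of_hom_eq (by
    simp only [hom_ofHom, hcompHom, leftUnitIso]
    simp only [Iso.trans_hom, hcIso_hom, Iso.refl_hom, Category.assoc,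
      Iso.inv_hom_id_assoc, hc_comp_assoc, Category.comp_id, Iso.inv_hom_id]
    rw [D.hc_comp_left, Category.assoc, D.hc_leftUnitIso]
    exact rfl)
  rightUnit {I J} M :=
    T.ofHom (T.rightUnitIso M).hom (id (id_comp_comp_id (𝟙 I))) (id (id_comp_comp_id (𝟙 J)))
  rightUnitInv {I J} M := T.ofHom (T.rightUnitIso M).inv
    (id ((Category.assoc _ _ _).trans (id_comp_comp_id (𝟙 I))))
    (id ((Category.assoc _ _ _).trans (id_comp_comp_id (𝟙 J))))
  rightUnit_rightUnitInv M := T.heq_of_hom_eq (by simp only [hom_ofHom, Iso.hom_inv_id])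
  rightUnitInv_rightUnit M := T.heq_of_hom_eq (by simp only [hom_ofHom, Iso.inv_hom_id])
  rightUnit_naturality σ := T.heq_of_hom_eq (by
    simp only [hom_ofHom, hcompHom, rightUnitIso]
    simp only [Iso.trans_hom, hcIso_hom, Iso.refl_hom, Category.assoc,
      Iso.inv_hom_id_assoc, hc_comp_assoc, Category.comp_id, Iso.inv_hom_id]
    rw [D.hc_comp_right, Category.assoc, D.hc_rightUnitIso]
    exact rfl)
  pentagon A B C F := T.heq_of_hom_eq (by
    simp only [hom_ofHom, hcompHom, assocIso]
    simp only [Iso.trans_hom, hcIso_hom, Iso.refl_hom, Iso.symm_hom, Category.assoc,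
      Iso.inv_hom_id_assoc, hc_comp_assoc, Category.comp_id, Category.id_comp, Iso.inv_hom_id]
    congr 1
    rw [D.hc_comp_left, D.hc_comp_left, D.hc_comp_left]
    · simp only [Category.assoc]
      congr 1
      rw [reassoc_of% (D.hc_assocIso (𝟙 (D.horObj (hor A))) (T.compIso B C).inv
        (𝟙 (D.horObj (hor F))) (.of_eq rfl) (.of_eq rfl)),
        D.hc_comp_assoc (𝟙 (D.horObj (hor A))) (𝟙 (D.horObj (hor A)))]
      simp only [D.hc_comp_assoc (T.compIso B C).inv, Iso.inv_hom_id, Category.id_comp, hc_id]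
      rw [D.hc_comp_right, D.hc_comp_right]
      · simp only [Category.assoc]
        rw [reassoc_of% (D.pentagon_hom (hor A) (hor B) (hor C) (hor F)),
          reassoc_of% (D.hc_assocIso (T.compIso A B).hom (𝟙 (D.horObj (hor C)))
            (𝟙 (D.horObj (hor F))) (.of_eq rfl) (.of_eq rfl)),
          ← reassoc_of% (D.hc_assocIso (𝟙 (D.horObj (hor A))) (𝟙 (D.horObj (hor B)))
            (T.compIso C F).inv (.of_eq rfl) (.of_eq rfl)), hc_comp_assoc]
        simp only [hc_id, Category.comp_id, Category.id_comp]
      all_goals first | exact rfl | exact Category.comp_id _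
    all_goals first | exact rfl | exact (Category.comp_id (𝟙 _)).symm |
      exact (id_comp_comp_id (𝟙 _)).symm)
  triangle M N := T.heq_of_hom_eq (by
    simp only [hom_ofHom, hcompHom, leftUnitIso, rightUnitIso, assocIso]
    simp only [Iso.trans_hom, hcIso_hom, Iso.refl_hom, Iso.symm_hom, Category.assoc,
      Iso.inv_hom_id_assoc, hc_comp_assoc, Category.comp_id]
    rw [D.hc_comp_right, D.hc_comp_left,
      D.hc_comp_left, Category.assoc, Category.assoc, Category.assoc,
      ← D.triangle_hom, Category.assoc,
      reassoc_of% (D.hc_assocIso (𝟙 (D.horObj (hor M))) (T.unitIso _).hom (𝟙 (D.horObj (hor N)))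
        (.of_eq rfl) (.of_eq rfl))]
    all_goals first | exact rfl | exact Category.comp_id _ | exact (Category.comp_id _).symm)

end Transport

end

section

/-! ### Framings and comparison functors of transported double categories -/

namespace DoubleCat

variable {O : Type u} [Category.{v} O] {G : DoubleGraph.{w', w} O} {D : DoubleCat G}

theorem IsTransporter.existsUnique {I' J' I J : O} {u : I' ⟶ I} {v : J' ⟶ J}
    {M : G.Hor I' J'} {N : G.Hor I J} {σ : G.Sq u v M N} (hσ : D.IsTransporter σ) {I₀ J₀ : O}
    (a : I₀ ⟶ I') (b : J₀ ⟶ J') (L : G.Hor I₀ J₀) (τ : G.Sq (a ≫ u) (b ≫ v) L N) :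
    ∃! χ : D.horObj L ⟶ D.horObj M,
      (χ.left = a ∧ χ.right = b) ∧ χ ≫ D.sqHom σ = D.sqHom τ := by
  obtain ⟨χ, ⟨h₁, h₂⟩, h₃⟩ := @Functor.IsStronglyCartesian.universal_property' _ _ _ _
    D.endpoints _ _ _ _ _ _ hσ (D.horObj L) (Prod.mkHom a b : (I₀, J₀) ⟶ (I', J')) (D.sqHom τ)
    ((D.isHomLift_iff (X := D.horObj L) (Y := D.horObj N) _ (D.sqHom τ)).2 rfl)
  refine ⟨χ, ⟨⟨(isHomLift_left h₁).symm, (isHomLift_right h₁).symm⟩, h₂⟩, ?_⟩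
  rintro χ' ⟨⟨rfl, rfl⟩, h₄⟩
  exact h₃ χ' ⟨(D.isHomLift_iff (X := D.horObj L) (Y := D.horObj M) _ χ').2 rfl, h₄⟩

theorem IsCotransporter.existsUnique {I' J' I J : O} {u : I' ⟶ I} {v : J' ⟶ J}
    {M : G.Hor I' J'} {N : G.Hor I J} {σ : G.Sq u v M N} (hσ : D.IsCotransporter σ) {I₀ J₀ : O}
    (a : I ⟶ I₀) (b : J ⟶ J₀) (L : G.Hor I₀ J₀) (τ : G.Sq (u ≫ a) (v ≫ b) M L) :
    ∃! χ : D.horObj N ⟶ D.horObj L,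
      (χ.left = a ∧ χ.right = b) ∧ D.sqHom σ ≫ χ = D.sqHom τ := by
  obtain ⟨χ, ⟨h₁, h₂⟩, h₃⟩ := @Functor.IsStronglyCocartesian.universal_property' _ _ _ _
    D.endpoints _ _ _ _ _ _ hσ (D.horObj L) (Prod.mkHom a b : (I, J) ⟶ (I₀, J₀)) (D.sqHom τ)
    ((D.isHomLift_iff (X := D.horObj M) (Y := D.horObj L) _ (D.sqHom τ)).2 rfl)
  refine ⟨χ, ⟨⟨(isHomLift_left h₁).symm, (isHomLift_right h₁).symm⟩, h₂⟩, ?_⟩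
  rintro χ' ⟨⟨rfl, rfl⟩, h₄⟩
  exact h₃ χ' ⟨(D.isHomLift_iff (X := D.horObj N) (Y := D.horObj L) _ χ').2 rfl, h₄⟩

end DoubleCat

namespace Transport

open DoubleCat

variable {O : Type u} [Category.{v} O] {G : DoubleGraph.{w', w} O}
  {H : DoubleGraph.{w₂', w₂} O} {D : DoubleCat H} {hor : ∀ {I J : O}, G.Hor I J → H.Hor I J}
  (T : Transport G D hor)

theorem hom_vcomp {I₁ J₁ I₂ J₂ I₃ J₃ : O} {u : I₁ ⟶ I₂} {v : J₁ ⟶ J₂} {u' : I₂ ⟶ I₃}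
    {v' : J₂ ⟶ J₃} {L : G.Hor I₁ J₁} {M : G.Hor I₂ J₂} {N : G.Hor I₃ J₃} (σ : G.Sq u v L M)
    (τ : G.Sq u' v' M N) : T.hom (T.doubleCat.vcomp σ τ) = T.hom σ ≫ T.hom τ := by
  exact T.hom_ofHom (u := u ≫ u') (v := v ≫ v') (T.hom σ ≫ T.hom τ) (id rfl) (id rfl)

theorem e_vcomp {I₁ J₁ I₂ J₂ I₃ J₃ : O} {u : I₁ ⟶ I₂} {v : J₁ ⟶ J₂} {u' : I₂ ⟶ I₃}
    {v' : J₂ ⟶ J₃} {L : G.Hor I₁ J₁} {M : G.Hor I₂ J₂} {N : G.Hor I₃ J₃} (σ : G.Sq u v L M)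
    (τ : G.Sq u' v' M N) : T.e (T.doubleCat.vcomp σ τ) = D.vcomp (T.e σ) (T.e τ) :=
  D.sqHom_injective (T.hom_vcomp σ τ)

theorem hom_vid {I J : O} (M : G.Hor I J) :
    T.hom (T.doubleCat.vid M) = 𝟙 (D.horObj (hor M)) := by
  exact T.hom_ofHom (u := 𝟙 I) (v := 𝟙 J) (𝟙 (D.horObj (hor M))) (id rfl) (id rfl)

/-- The comparison double functor out of a transported double category. -/
def doubleFunctor : DoubleFunctor T.doubleCat D (fun M => hor M) where
  sq σ := T.e σ
  sq_vid M := D.sqHom_injective (T.hom_vid M)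
  sq_vcomp σ τ := T.e_vcomp σ τ
  mapComp M N := T.comp M N
  mapCompInv M N := T.compInv M N
  mapComp_mapCompInv M N := T.comp_compInv M N
  mapCompInv_mapComp M N := T.compInv_comp M N
  mapComp_naturality {_ _ _ _ _ _ _ _ _ M' N' M N} σ τ := D.heq_of_sqHom_eq (by
    change T.hom (T.ofHom (T.hcompHom σ τ) _ _) ≫ (T.compIso M N).hom =
      (T.compIso M' N').hom ≫ D.hc (T.hom σ) (T.hom τ) (.sqHom _ _)
    simp only [hom_ofHom, hcompHom, Category.assoc, Iso.inv_hom_id, Category.comp_id])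
  mapId I := T.unit I
  mapIdInv I := T.unitInv I
  mapId_mapIdInv I := T.unit_unitInv I
  mapIdInv_mapId I := T.unitInv_unit I
  mapId_naturality {I' I} u := D.heq_of_sqHom_eq (by
    change T.hom (T.ofHom ((T.unitIso I').hom ≫ D.hidHom u ≫ (T.unitIso I).inv) _ _) ≫
      (T.unitIso I).hom = (T.unitIso I').hom ≫ D.hidHom u
    simp only [hom_ofHom, Category.assoc, Iso.inv_hom_id, Category.comp_id])
  map_assoc M N P := D.heq_of_sqHom_eq (by
    change T.hom (T.ofHom (T.assocIso M N P).hom _ _) ≫ (T.compIso M (G.hcomp N P)).hom ≫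
        D.hc (𝟙 (D.horObj (hor M))) (T.compIso N P).hom (.of_eq rfl) =
      (T.compIso (G.hcomp M N) P).hom ≫
        D.hc (T.compIso M N).hom (𝟙 (D.horObj (hor P))) (.of_eq rfl) ≫
          (D.assocIso (hor M) (hor N) (hor P)).hom
    simp only [hom_ofHom, assocIso, Iso.trans_hom, hcIso_hom, Iso.refl_hom, Iso.symm_hom,
      Category.assoc, Iso.inv_hom_id_assoc, hc_comp, Category.comp_id, Iso.inv_hom_id, hc_id])
  map_leftUnit {I _} M := D.heq_of_sqHom_eq (by
    change T.hom (T.ofHom (T.leftUnitIso M).hom _ _) = (T.compIso (G.hid I) M).hom ≫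
      D.hc (T.unitIso I).hom (𝟙 (D.horObj (hor M))) (.of_eq rfl) ≫ (D.leftUnitIso (hor M)).hom
    simp only [hom_ofHom, leftUnitIso, Iso.trans_hom, hcIso_hom, Iso.refl_hom])
  map_rightUnit {_ J} M := D.heq_of_sqHom_eq (by
    change T.hom (T.ofHom (T.rightUnitIso M).hom _ _) = (T.compIso M (G.hid J)).hom ≫
      D.hc (𝟙 (D.horObj (hor M))) (T.unitIso J).hom (.of_eq rfl) ≫ (D.rightUnitIso (hor M)).hom
    simp only [hom_ofHom, rightUnitIso, Iso.trans_hom, hcIso_hom, Iso.refl_hom])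

/-- Every horizontal arrow of `D` is isomorphic, by globular squares, to one in the image of
`hor`. -/
def HorSurjective {H : DoubleGraph.{w₂', w₂} O} (D : DoubleCat H)
    (hor : ∀ {I J : O}, G.Hor I J → H.Hor I J) : Prop :=
  ∀ {I J : O} (P : H.Hor I J), ∃ (M : G.Hor I J) (j : D.horObj (hor M) ≅ D.horObj P),
    (j.hom.left = 𝟙 I ∧ j.hom.right = 𝟙 J) ∧ j.inv.left = 𝟙 I ∧ j.inv.right = 𝟙 J

theorem isFramedBiequivalence (hs : HorSurjective D (fun M => hor M)) :
    T.doubleFunctor.IsFramedBiequivalence :=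
  { faithful := ⟨fun {X Y f g} h => by
      obtain ⟨fl, fr, fs⟩ := f
      obtain ⟨gl, gr, gs⟩ := g
      have h' : T.hom fs = T.hom gs := h
      obtain rfl : fl = gl := congrArg Total.Hom.left h'
      obtain rfl : fr = gr := congrArg Total.Hom.right h'
      obtain rfl := T.eq_of_hom_eq h'
      rfl⟩
    full := ⟨fun {X Y} f => ⟨⟨f.left, f.right, T.e.symm f.sq⟩,
      congrArg (fun s => (⟨f.left, f.right, s⟩ : D.horObj (hor X.hor) ⟶ D.horObj (hor Y.hor)))
        (T.e.apply_symm_apply f.sq)⟩⟩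
    essSurj := ⟨fun P => by
      obtain ⟨M, j, -⟩ := hs P.hor
      exact ⟨T.doubleCat.horObj M, ⟨j⟩⟩⟩ }

/-- A transported double category is framed if the original one is: lifts are transported along an
isomorphism from their domain, or codomain, to a horizontal arrow in the image of `hor`. -/
theorem isFramed (hs : HorSurjective D (fun M => hor M))
    (h : ∀ {I' J' I J : O} (u : I' ⟶ I) (v : J' ⟶ J) (N : H.Hor I J),
      ∃ (M : H.Hor I' J') (σ : H.Sq u v M N), D.IsTransporter σ)
    (h' : ∀ {I' J' I J : O} (u : I' ⟶ I) (v : J' ⟶ J) (M : H.Hor I' J'),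
      ∃ (N : H.Hor I J) (σ : H.Sq u v M N), D.IsCotransporter σ) : T.doubleCat.IsFramed := by
  refine isFramed_of_lifts _ (fun {I' J' I J} u v N => ?_) (fun {I' J' I J} u v M => ?_)
  · obtain ⟨P, σ, hσ⟩ := h u v (hor N)
    obtain ⟨M, j, ⟨h₁, h₂⟩, h₃, h₄⟩ := hs P
    have hl : (j.hom ≫ D.sqHom σ).left = u :=
      (congrArg (fun x : I' ⟶ I' => x ≫ u) h₁).trans (Category.id_comp u)
    have hr : (j.hom ≫ D.sqHom σ).right = v :=
      (congrArg (fun x : J' ⟶ J' => x ≫ v) h₂).trans (Category.id_comp v)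
    refine ⟨M, T.ofHom (j.hom ≫ D.sqHom σ) hl hr, isTransporter_of_existsUnique _ _ ?_⟩
    intro I₀ J₀ a b L τ
    obtain ⟨χ, ⟨⟨ha, hb⟩, hχ⟩, huniq⟩ := hσ.existsUnique a b (hor L) (T.e τ)
    have hl' : (χ ≫ j.inv).left = a := by
      refine (congrArg₂ (fun (x : I₀ ⟶ I') (y : I' ⟶ I') => x ≫ y) ha h₃).trans
        (Category.comp_id a)
    have hr' : (χ ≫ j.inv).right = b := by
      refine (congrArg₂ (fun (x : J₀ ⟶ J') (y : J' ⟶ J') => x ≫ y) hb h₄).trans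
        (Category.comp_id b)
    refine ⟨T.ofHom (χ ≫ j.inv) hl' hr', T.eq_of_hom_eq ?_, fun χ' hχ' => T.eq_of_hom_eq ?_⟩
    · rw [hom_vcomp, hom_ofHom, hom_ofHom, Category.assoc, Iso.inv_hom_id_assoc, hχ]
    · rw [hom_ofHom, Iso.eq_comp_inv]
      refine huniq _ ⟨⟨?_, ?_⟩, ?_⟩
      · exact (congrArg (fun x : I' ⟶ I' => a ≫ x) h₁).trans (Category.comp_id a)
      · exact (congrArg (fun x : J' ⟶ J' => b ≫ x) h₂).trans (Category.comp_id b)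
      · have := congrArg T.hom hχ'
        rw [hom_vcomp, hom_ofHom] at this
        rw [Category.assoc]
        exact this
  · obtain ⟨P, σ, hσ⟩ := h' u v (hor M)
    obtain ⟨N, j, ⟨h₁, h₂⟩, h₃, h₄⟩ := hs P
    have hl : (D.sqHom σ ≫ j.inv).left = u :=
      (congrArg (fun x : I ⟶ I => u ≫ x) h₃).trans (Category.comp_id u)
    have hr : (D.sqHom σ ≫ j.inv).right = v :=
      (congrArg (fun x : J ⟶ J => v ≫ x) h₄).trans (Category.comp_id v)
    refine ⟨N, T.ofHom (D.sqHom σ ≫ j.inv) hl hr, isCotransporter_of_existsUnique _ _ ?_⟩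
    intro I₀ J₀ a b L τ
    obtain ⟨χ, ⟨⟨ha, hb⟩, hχ⟩, huniq⟩ := hσ.existsUnique a b (hor L) (T.e τ)
    have hl' : (j.hom ≫ χ).left = a := by
      refine (congrArg₂ (fun (y : I ⟶ I) (x : I ⟶ I₀) => y ≫ x) h₁ ha).trans
        (Category.id_comp a)
    have hr' : (j.hom ≫ χ).right = b := by
      refine (congrArg₂ (fun (y : J ⟶ J) (x : J ⟶ J₀) => y ≫ x) h₂ hb).trans
        (Category.id_comp b)
    refine ⟨T.ofHom (j.hom ≫ χ) hl' hr', T.eq_of_hom_eq ?_, fun χ' hχ' => T.eq_of_hom_eq ?_⟩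
    · rw [hom_vcomp, hom_ofHom, hom_ofHom, Category.assoc, Iso.inv_hom_id_assoc, hχ]
    · rw [hom_ofHom, ← Iso.inv_comp_eq]
      refine huniq _ ⟨⟨?_, ?_⟩, ?_⟩
      · exact (congrArg (fun x : I ⟶ I => x ≫ a) h₃).trans (Category.id_comp a)
      · exact (congrArg (fun x : J ⟶ J => x ≫ b) h₄).trans (Category.id_comp b)
      · have := congrArg T.hom hχ'
        rw [hom_vcomp, hom_ofHom, Category.assoc] at this
        exact this

end Transport

end

section

/-! ### Strong natural transformations -/

section Strong

variable {E : Type u} [Category.{v} E] [HasFiniteLimits E]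

theorem IsStrong.comp {I J : E} {P Q R : StrongFunctor I J} {φ : P.functor ⟶ Q.functor}
    {ψ : Q.functor ⟶ R.functor} (hφ : IsStrong (P := P) (Q := Q) φ)
    (hψ : IsStrong (P := Q) (Q := R) ψ) : IsStrong (P := P) (Q := R) (φ ≫ ψ) := fun K a => by
  have e : tensMap (𝟙 K) (φ.app a ≫ ψ.app a) =
      tensMap (𝟙 K) (φ.app a) ≫ tensMap (𝟙 K) (ψ.app a) := by
    rw [← tensMap_comp, Category.comp_id]
  rw [NatTrans.comp_app, NatTrans.comp_app, e, Category.assoc, ← hψ K a,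
    reassoc_of% (hφ K a)]

theorem IsStrong.inv {I J : E} {P Q : StrongFunctor I J} {e : P.functor ≅ Q.functor}
    (h : IsStrong (P := P) (Q := Q) e.hom) : IsStrong (P := Q) (Q := P) e.inv := fun K a => by
  have h' : tensMap (𝟙 K) (e.inv.app a) ≫ tensMap (𝟙 K) (e.hom.app a) = 𝟙 _ := by
    rw [← tensMap_comp, Category.comp_id, Iso.inv_hom_id_app, tensMap_id]
  rw [← cancel_mono (e.hom.app (tens K a)), Category.assoc, Category.assoc, Iso.inv_hom_id_app,
    h K a, reassoc_of% h', Category.comp_id]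

theorem IsStrong.hcomp {I J K : E} {P P' : StrongFunctor I J} {Q Q' : StrongFunctor J K}
    {φ : P.functor ⟶ P'.functor} {ψ : Q.functor ⟶ Q'.functor} (hφ : IsStrong (P := P) (Q := P') φ)
    (hψ : IsStrong (P := Q) (Q := Q') ψ) :
    IsStrong (P := P.comp Q) (Q := P'.comp Q') (NatTrans.hcomp φ ψ) := fun X a => by
  have e : tensMap (𝟙 X) (ψ.app (P.functor.obj a) ≫ Q'.functor.map (φ.app a)) =
      tensMap (𝟙 X) (ψ.app (P.functor.obj a)) ≫ tensMap (𝟙 X) (Q'.functor.map (φ.app a)) := by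
    rw [← tensMap_comp, Category.comp_id]
  have h₁ := ψ.naturality (P.strength.app X a)
  have h₂ := Q'.strength.naturality (𝟙 X) (φ.app a)
  have h₃ := hψ X (P.functor.obj a)
  change (Q.strength.app X (P.functor.obj a) ≫ Q.functor.map (P.strength.app X a)) ≫
      ψ.app (P.functor.obj (tens X a)) ≫ Q'.functor.map (φ.app (tens X a)) =
    tensMap (𝟙 X) (ψ.app (P.functor.obj a) ≫ Q'.functor.map (φ.app a)) ≫
      Q'.strength.app X (P'.functor.obj a) ≫ Q'.functor.map (P'.strength.app X a)
  rw [e, Category.assoc, Category.assoc, reassoc_of% h₁, reassoc_of% h₃, reassoc_of% h₂,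
    ← Functor.map_comp, ← Functor.map_comp, hφ X a]

theorem fst_comp_hom_of_comp_eq {I A : E} {s : A ⟶ I} {X : Over I} {Z : E} {x : Z ⟶ X.left}
    {a : Z ⟶ A} (h : x ≫ X.hom = a ≫ s) :
    (pullback.fst a (𝟙 A) ≫ x) ≫ X.hom = pullback.snd a (𝟙 A) ≫ s := by
  have e : pullback.snd a (𝟙 A) = pullback.fst a (𝟙 A) ≫ a :=
    (Category.comp_id _).symm.trans pullback.condition.symm
  rw [Category.assoc, h, e, Category.assoc]

end Strong

variable {E : Type u} [Category.{v} E] [HasFiniteLimits E] [IsLCC E]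

/-- The natural isomorphism from an extension to a strong functor with components `φ X`. -/
def extIso {I J : E} (F : PolyDiagram I J) (P : StrongFunctor I J)
    (φ : ∀ X, F.dom X ⟶ (P.functor.obj X).left) (hi : ∀ X, IsIso (φ X))
    (hφ : ∀ X, φ X ≫ (P.functor.obj X).hom = F.shape X ≫ F.t)
    (nat : ∀ {X Y : Over I} (g : X ⟶ Y), F.mapDom g ≫ φ Y = φ X ≫ (P.functor.map g).left) :
    F.ext.functor ≅ P.functor :=
  NatIso.ofComponents (fun X => Over.isoMk (@asIso _ _ _ _ (φ X) (hi X)) (hφ X))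
    (fun g => Over.OverMorphism.ext (nat g))

/-- Compatibility of the components with the strengths only has to be checked on elements. -/
theorem extIso_isStrong {I J : E} (F : PolyDiagram I J) (P : StrongFunctor I J)
    (φ : ∀ X, F.dom X ⟶ (P.functor.obj X).left) (hi : ∀ X, IsIso (φ X))
    (hφ : ∀ X, φ X ≫ (P.functor.obj X).hom = F.shape X ≫ F.t)
    (nat : ∀ {X Y : Over I} (g : X ⟶ Y), F.mapDom g ≫ φ Y = φ X ≫ (P.functor.map g).left)
    (str : ∀ (K : E) (X : Over I), F.strDom K X ≫ φ (tens K X) =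
      prod.map (𝟙 K) (φ X) ≫ (P.strength.app K X).left) :
    IsStrong (P := F.ext) (Q := P) (extIso F P φ hi hφ nat).hom :=
  isStrong_of_left _ fun K X => by
    rw [ext_strength_left]
    exact str K X

/-! ### Spans -/

/-- The polynomial `I ←s- A = A -t→ J`. -/
abbrev PolyDiagram.span {I J A : E} (s : A ⟶ I) (t : A ⟶ J) : PolyDiagram I J := ⟨A, A, s, 𝟙 A, t⟩

section Span

variable {I J A : E} (s : A ⟶ I) (t : A ⟶ J)

/-- The map `(a, φ) ↦ φ a`. -/
def spanMap (X : Over I) : (PolyDiagram.span s t).dom X ⟶ X.left :=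
  evalAt (F := PolyDiagram.span s t) (𝟙 _) ((PolyDiagram.span s t).shape X)
    ((Category.id_comp _).trans (Category.comp_id _).symm)

theorem spanMap_comm (X : Over I) :
    spanMap s t X ≫ X.hom = (PolyDiagram.span s t).shape X ≫ s :=
  evalAt_hom (F := PolyDiagram.span s t) _ _ _

variable {s t} in
theorem comp_spanMap {X : Over I} {Z : E} (y : Z ⟶ (PolyDiagram.span s t).dom X) (b : Z ⟶ A)
    (h : y ≫ (PolyDiagram.span s t).shape X = b ≫ 𝟙 A) :
    y ≫ spanMap s t X = evalAt (F := PolyDiagram.span s t) y b h := by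
  refine (comp_evalAt (F := PolyDiagram.span s t) _ _ _ _).trans (evalAt_congr _ ?_ ?_)
  · exact Category.comp_id _
  · exact h.trans (Category.comp_id _)

theorem spanMap_naturality {X Y : Over I} (g : X ⟶ Y) :
    (PolyDiagram.span s t).mapDom g ≫ spanMap s t Y = spanMap s t X ≫ g.left := by
  have h := evalAt_mapDom (PolyDiagram.span s t) g (𝟙 _) ((PolyDiagram.span s t).shape X)
    ((Category.assoc _ _ _).trans ((Category.id_comp _).trans
      ((mapDom_shape _ g).trans (Category.comp_id _).symm)))
    ((Category.id_comp _).trans (Category.comp_id _).symm)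
  refine Eq.trans ?_ h
  rw [← comp_spanMap (t := t), Category.id_comp]

theorem spanMap_strength (K : E) (X : Over I) :
    (PolyDiagram.span s t).strDom K X ≫ spanMap s t (tens K X) =
      prod.map (𝟙 K) (spanMap s t X) := by
  have hs := strDom_shape (PolyDiagram.span s t) K X
  have h := evalAt_strDom (PolyDiagram.span s t) (𝟙 (K ⨯ (PolyDiagram.span s t).dom X))
    (prod.snd ≫ (PolyDiagram.span s t).shape X)
    ((Category.assoc _ _ _).trans ((Category.id_comp _).trans (hs.trans
      (Category.comp_id _).symm)))
    ((Category.assoc _ _ _).trans ((Category.id_comp _).trans (Category.comp_id _).symm))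
  rw [← comp_spanMap (t := t), ← comp_spanMap (t := t), Category.id_comp, Category.id_comp,
    Category.id_comp] at h
  rw [h]
  apply prod.hom_ext
  · rw [prod.lift_fst, prod.map_fst, Category.comp_id]
  · rw [prod.lift_snd, prod.map_snd]

/-- The middle map of a span is an identity, so `Π` is trivial and the extension is `Σ_t s^*`. -/
theorem isPullback_spanMap (X : Over I) :
    IsPullback (spanMap s t X) ((PolyDiagram.span s t).shape X) X.hom s := by
  refine IsPullback.of_isLimit' ⟨spanMap_comm s t X⟩ (PullbackCone.IsLimit.mk _
    (fun c => lam (F := PolyDiagram.span s t) (X := X) c.snd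
      (pullback.fst c.snd (𝟙 A) ≫ c.fst) (fst_comp_hom_of_comp_eq c.condition)) (fun c => ?_)
      (fun c => ?_) (fun c m h₁ h₂ => ?_))
  · have hl := lam_shape (F := PolyDiagram.span s t) (X := X) c.snd
      (pullback.fst c.snd (𝟙 A) ≫ c.fst) (fst_comp_hom_of_comp_eq c.condition)
    rw [comp_spanMap (s := s) (t := t) _ c.snd (hl.trans (Category.comp_id _).symm)]
    have := evalAt_lam (F := PolyDiagram.span s t) (X := X) c.snd
      (pullback.fst c.snd (𝟙 A) ≫ c.fst) (fst_comp_hom_of_comp_eq c.condition) (𝟙 _) c.snd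
      ((congrArg (· ≫ (PolyDiagram.span s t).shape X) (Category.id_comp _)).trans
        (hl.trans (Category.comp_id _).symm))
      ((Category.id_comp _).trans (Category.comp_id _).symm)
    refine (evalAt_congr _ (Category.id_comp _).symm rfl).trans (this.trans ?_)
    rw [pullback.lift_fst_assoc, Category.id_comp]
  · exact lam_shape (F := PolyDiagram.span s t) (X := X) _ _ _
  · have hl := lam_shape (F := PolyDiagram.span s t) (X := X) c.snd
      (pullback.fst c.snd (𝟙 A) ≫ c.fst) (fst_comp_hom_of_comp_eq c.condition)
    refine dom_ext (F := PolyDiagram.span s t) (h₂.trans hl.symm) ?_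
    intro Z' z b hb
    have hb' : z ≫ c.snd = b ≫ 𝟙 A := by
      rw [Category.assoc, h₂] at hb
      exact hb
    rw [← comp_spanMap (t := t), Category.assoc, h₁, evalAt_lam (h'' := hb'),
      pullback.lift_fst_assoc]

end Span

instance isIso_spanMap {I J : E} (t : I ⟶ J) (X : Over I) : IsIso (spanMap (𝟙 I) t X) :=
  have : IsIso (𝟙 I) := inferInstance
  (isPullback_spanMap (𝟙 I) t X).isIso_fst_of_isIso

instance isIso_idMap {I : E} (X : Over I) : IsIso (idMap X) := isIso_spanMap (𝟙 I) X

theorem isPolyFunctor_sumS {I J : E} (u : I ⟶ J) : IsPolyFunctor (sumS u) :=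
  ⟨PolyDiagram.span (𝟙 I) u, extIso _ _ (spanMap (𝟙 I) u) (isIso_spanMap u)
    (fun X => by
      have h := spanMap_comm (𝟙 I) u X
      rw [Category.comp_id] at h
      change spanMap (𝟙 I) u X ≫ X.hom ≫ u = (PolyDiagram.span (𝟙 I) u).shape X ≫ u
      rw [← h, Category.assoc])
    (spanMap_naturality (𝟙 I) u), extIso_isStrong _ _ _ _ _ _ fun K X =>
      (spanMap_strength (𝟙 I) u K X).trans (Category.comp_id _).symm⟩

/-- The isomorphism from the extension of the identity polynomial to the identity functor. -/
def idIso (I : E) : (PolyDiagram.id I).ext.functor ≅ (StrongFunctor.id I).functor :=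
  extIso (PolyDiagram.id I) (StrongFunctor.id I) idMap isIso_idMap
    (fun X => spanMap_comm (𝟙 I) (𝟙 I) X) (spanMap_naturality (𝟙 I) (𝟙 I))

theorem idIso_isStrong (I : E) :
    IsStrong (P := (PolyDiagram.id I).ext) (Q := StrongFunctor.id I) (idIso I).hom :=
  extIso_isStrong _ _ _ isIso_idMap _ (spanMap_naturality (𝟙 I) (𝟙 I)) fun K X =>
    (spanMap_strength (𝟙 I) (𝟙 I) K X).trans (Category.comp_id _).symm

theorem isPolyFunctor_id (I : E) : IsPolyFunctor (StrongFunctor.id I) :=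
  ⟨_, idIso I, idIso_isStrong I⟩

section Pull

variable {I J : E} (v : I ⟶ J)

/-- The map `(i, φ) ↦ (φ i, i)`. -/
def spanPull (X : Over J) : (PolyDiagram.span v (𝟙 I)).dom X ⟶ pullback X.hom v :=
  pullback.lift (spanMap v (𝟙 I) X) ((PolyDiagram.span v (𝟙 I)).shape X) (spanMap_comm _ _ _)

theorem spanPull_fst (X : Over J) : spanPull v X ≫ pullback.fst X.hom v = spanMap v (𝟙 I) X :=
  pullback.lift_fst _ _ _

theorem spanPull_snd (X : Over J) :
    spanPull v X ≫ pullback.snd X.hom v = (PolyDiagram.span v (𝟙 I)).shape X :=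
  pullback.lift_snd _ _ _

theorem isIso_spanPull (X : Over J) : IsIso (spanPull v X) := by
  have : spanPull v X = (isPullback_spanMap v (𝟙 I) X).isoPullback.hom := by
    apply pullback.hom_ext
    · rw [spanPull_fst, IsPullback.isoPullback_hom_fst]
    · rw [spanPull_snd, IsPullback.isoPullback_hom_snd]
  rw [this]
  infer_instance

theorem spanPull_naturality {X Y : Over J} (g : X ⟶ Y) :
    (PolyDiagram.span v (𝟙 I)).mapDom g ≫ spanPull v Y = spanPull v X ≫ pullMap v g := by
  apply pullback.hom_ext
  · rw [Category.assoc, spanPull_fst, Category.assoc, pullMap_fst, ← Category.assoc,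
      spanPull_fst, spanMap_naturality]
  · rw [Category.assoc, spanPull_snd, Category.assoc, pullMap_snd, spanPull_snd, mapDom_shape]

theorem spanPull_strength (K : E) (X : Over J) :
    (PolyDiagram.span v (𝟙 I)).strDom K X ≫ spanPull v (tens K X) =
      prod.map (𝟙 K) (spanPull v X) ≫ pullStrength v K X := by
  apply pullback.hom_ext
  · rw [Category.assoc, spanPull_fst, Category.assoc, pullStrength_fst, spanMap_strength,
      prod.map_map, spanPull_fst, Category.comp_id]
  · rw [Category.assoc, spanPull_snd, Category.assoc, pullStrength_snd, strDom_shape,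
      prod.map_snd_assoc, spanPull_snd]

theorem isPolyFunctor_pullS : IsPolyFunctor (pullS v) :=
  ⟨PolyDiagram.span v (𝟙 I), extIso (PolyDiagram.span v (𝟙 I)) (pullS v) (spanPull v)
    (isIso_spanPull v) (fun X => (spanPull_snd v X).trans (Category.comp_id _).symm)
    (spanPull_naturality v), extIso_isStrong _ _ _ _ _ _ (spanPull_strength v)⟩

end Pull

end

section

/-! ### Extensions of composite polynomials -/

variable {E : Type u} [Category.{v} E] [HasFiniteLimits E] [IsLCC E]

/-- The projection `K ⊗ X ⟶ X`. -/
def tensSnd {I : E} (K : E) (X : Over I) : tens K X ⟶ X := Over.homMk prod.snd rfl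

/-- Strengths are compatible with discarding the tensor factor. -/
theorem strDom_mapDom_tensSnd {I J : E} (F : PolyDiagram I J) (K : E) (X : Over I) :
    F.strDom K X ≫ F.mapDom (tensSnd K X) = prod.snd := by
  refine dom_ext (by rw [Category.assoc, mapDom_shape, strDom_shape]) fun z b hb => ?_
  have h₁ : (z ≫ F.strDom K X) ≫ F.shape (tens K X) = b ≫ F.f := by
    rw [← hb]; simp only [Category.assoc, mapDom_shape]
  have h₂ : (z ≫ prod.snd) ≫ F.shape X = b ≫ F.f := by
    rw [← h₁]; simp only [Category.assoc, strDom_shape]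
  refine (evalAt_congr (y' := (z ≫ F.strDom K X) ≫ F.mapDom (tensSnd K X)) _
    (Category.assoc _ _ _).symm rfl).trans ?_
  rw [evalAt_mapDom F (tensSnd K X) _ _ _ h₁, evalAt_strDom F z b h₁ h₂]
  exact prod.lift_snd _ _

section Comp

variable {I J K : E} (F : PolyDiagram I J) (G : PolyDiagram J K)

/-- The structure map of `Π_f s^* X` over `A`, as a morphism over the codomain of `t : A ⟶ J`. -/
def shapeHom (X : Over I) : F.ext.functor.obj X ⟶ Over.mk F.t := Over.homMk (F.shape X) rfl

/-- The map `(c, φ) ↦ (c, d ↦ a_d)` where `φ d = (a_d, ψ_d)`. -/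
def innerShape (X : Over I) : G.dom (F.ext.functor.obj X) ⟶ F.compA G := G.mapDom (shapeHom F X)

theorem innerShape_shape (X : Over I) : innerShape F G X ≫ G.shape (Over.mk F.t) =
    G.shape (F.ext.functor.obj X) := mapDom_shape _ _

/-- The structure map of the composite polynomial. -/
def compF : (F.comp G).B ⟶ F.compA G := (F.comp G).f

/-- The projection `((c, φ), d, b) ↦ b`. -/
def posB : (F.comp G).B ⟶ F.B := pullback.fst F.f (F.compEval G)

/-- The projection `((c, φ), d, b) ↦ d`. -/
def posD : (F.comp G).B ⟶ G.B :=
  pullback.snd F.f (F.compEval G) ≫ pullback.snd (G.shape (Over.mk F.t)) G.f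

theorem compF_shape : compF F G ≫ G.shape (Over.mk F.t) = posD F G ≫ G.f := by
  refine (Category.assoc _ _ _).trans (Eq.trans ?_ (Category.assoc _ _ _).symm)
  exact congrArg _ pullback.condition

theorem posB_f : posB F G ≫ F.f =
    evalAt (F := G) (X := Over.mk F.t) (compF F G) (posD F G) (compF_shape F G) :=
  pullback.condition.trans (comp_evalAt (F := G) (X := Over.mk F.t) _ _ _ _)

variable {F G} {X : Over I}

/-- Positions `((c, φ), d, b)` of the composite polynomial are determined by their components. -/
theorem comp_pos_ext {Z : E} {q q' : Z ⟶ (F.comp G).B} (hB : q ≫ posB F G = q' ≫ posB F G)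
    (hD : q ≫ posD F G = q' ≫ posD F G) (hF : q ≫ compF F G = q' ≫ compF F G) : q = q' := by
  refine pullback.hom_ext hB (pullback.hom_ext ?_ ?_)
  · exact (Category.assoc _ _ _).trans (hF.trans (Category.assoc _ _ _).symm)
  · exact (Category.assoc _ _ _).trans (hD.trans (Category.assoc _ _ _).symm)

section

variable {Z : E} (y : Z ⟶ (F.comp G).dom X) (d : Z ⟶ G.B)
  (h : (y ≫ F.compBase G X) ≫ G.shape (Over.mk F.t) = d ≫ G.f) (b : Z ⟶ F.B)
  (hb : PolyDiagram.compShape y d h = b ≫ F.f)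

theorem compPos_posB : PolyDiagram.compPos y d h b hb ≫ posB F G = b := pullback.lift_fst _ _ _

theorem compPos_posD : PolyDiagram.compPos y d h b hb ≫ posD F G = d :=
  (pullback.lift_snd_assoc _ _ _ _).trans (pullback.lift_snd _ _ _)

theorem compPos_compF :
    PolyDiagram.compPos y d h b hb ≫ compF F G = y ≫ F.compBase G X :=
  (PolyDiagram.compPos_f y d h b hb).symm

theorem compPos_eq {q : Z ⟶ (F.comp G).B} (hB : q ≫ posB F G = b) (hD : q ≫ posD F G = d)
    (hF : q ≫ compF F G = y ≫ F.compBase G X) : PolyDiagram.compPos y d h b hb = q :=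
  comp_pos_ext ((compPos_posB y d h b hb).trans hB.symm) ((compPos_posD y d h b hb).trans hD.symm)
    ((compPos_compF y d h b hb).trans hF.symm)

end

/-- The value at `d` of an element of `Σ Π (F X)`. -/
def innerAt {Z : E} (w : Z ⟶ G.dom (F.ext.functor.obj X)) (d : Z ⟶ G.B)
    (h : w ≫ G.shape _ = d ≫ G.f) : Z ⟶ F.dom X :=
  evalAt (F := G) (X := F.ext.functor.obj X) w d h

theorem comp_innerAt {Z' Z : E} (g : Z' ⟶ Z) (w : Z ⟶ G.dom (F.ext.functor.obj X)) (d : Z ⟶ G.B)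
    (h : w ≫ G.shape _ = d ≫ G.f) (h' : (g ≫ w) ≫ G.shape _ = (g ≫ d) ≫ G.f) :
    g ≫ innerAt w d h = innerAt (g ≫ w) (g ≫ d) h' :=
  comp_evalAt (F := G) (X := F.ext.functor.obj X) _ _ _ _

theorem innerAt_congr {Z : E} {w w' : Z ⟶ G.dom (F.ext.functor.obj X)} {d d' : Z ⟶ G.B}
    (h : w ≫ G.shape _ = d ≫ G.f) (h' : w' ≫ G.shape _ = d' ≫ G.f) (hw : w = w') (hd : d = d') :
    innerAt w d h = innerAt w' d' h' := by
  subst hw hd; rfl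

theorem innerAt_shape {Z : E} (w : Z ⟶ G.dom (F.ext.functor.obj X)) (d : Z ⟶ G.B)
    (h : w ≫ G.shape _ = d ≫ G.f)
    (h' : (w ≫ innerShape F G X) ≫ G.shape (Over.mk F.t) = d ≫ G.f) :
    innerAt w d h ≫ F.shape X =
      evalAt (F := G) (X := Over.mk F.t) (w ≫ innerShape F G X) d h' :=
  (evalAt_mapDom G (shapeHom F X) w d h' h).symm

/-- Elements of `Σ Π (F X)` agree if their values have the same values. -/
theorem comp_dom_ext {Z : E} {w w' : Z ⟶ G.dom (F.ext.functor.obj X)}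
    (h : w ≫ innerShape F G X = w' ≫ innerShape F G X)
    (e : ∀ {Z' : E} (z : Z' ⟶ Z) (d : Z' ⟶ G.B) (hd : (z ≫ w) ≫ G.shape _ = d ≫ G.f)
      (hd' : (z ≫ w') ≫ G.shape _ = d ≫ G.f) (b : Z' ⟶ F.B)
      (hb : innerAt (z ≫ w) d hd ≫ F.shape X = b ≫ F.f)
      (hb' : innerAt (z ≫ w') d hd' ≫ F.shape X = b ≫ F.f),
      evalAt (innerAt (z ≫ w) d hd) b hb = evalAt (innerAt (z ≫ w') d hd') b hb') : w = w' := by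
  have h₀ : w ≫ G.shape _ = w' ≫ G.shape _ := by
    rw [← innerShape_shape, ← Category.assoc, h, Category.assoc]
  refine dom_ext h₀ fun {Z'} z d hd => ?_
  have hd' : (z ≫ w') ≫ G.shape _ = d ≫ G.f := by rw [← hd, Category.assoc, Category.assoc, h₀]
  have hs : innerAt (z ≫ w) d hd ≫ F.shape X = innerAt (z ≫ w') d hd' ≫ F.shape X := by
    have k : ((z ≫ w) ≫ innerShape F G X) ≫ G.shape (Over.mk F.t) = d ≫ G.f := by
      rw [Category.assoc, innerShape_shape, hd]
    rw [innerAt_shape _ _ _ k, innerAt_shape _ _ hd' (by rw [Category.assoc, innerShape_shape, hd'])]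
    exact evalAt_congr _ (by rw [Category.assoc, h, Category.assoc]) rfl
  change innerAt (z ≫ w) d hd = innerAt (z ≫ w') d hd'
  refine dom_ext hs fun {Z''} z' b hb => ?_
  have k : (((z' ≫ z) ≫ w) ≫ G.shape _) = (z' ≫ d) ≫ G.f := by
    rw [Category.assoc z' d, ← hd]; simp only [Category.assoc]
  have k' : (((z' ≫ z) ≫ w') ≫ G.shape _) = (z' ≫ d) ≫ G.f := by
    rw [Category.assoc z' d, ← hd']; simp only [Category.assoc]
  have i : z' ≫ innerAt (z ≫ w) d hd = innerAt ((z' ≫ z) ≫ w) (z' ≫ d) k :=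
    (comp_innerAt z' _ _ _ (by rw [← k]; simp only [Category.assoc])).trans
      (innerAt_congr _ _ (Category.assoc _ _ _).symm rfl)
  have i' : z' ≫ innerAt (z ≫ w') d hd' = innerAt ((z' ≫ z) ≫ w') (z' ≫ d) k' :=
    (comp_innerAt z' _ _ _ (by rw [← k']; simp only [Category.assoc])).trans
      (innerAt_congr _ _ (Category.assoc _ _ _).symm rfl)
  refine (evalAt_congr _ i rfl).trans ((e (z' ≫ z) (z' ≫ d) k k' b ?_ ?_).trans
    (evalAt_congr _ i'.symm rfl))
  · rw [← i, hb]
  · rw [← i', Category.assoc, ← hs, ← hb, Category.assoc]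

variable (F G X) in
/-- The map sending `((c, φ), ψ)` and `d` to `(φ d, b ↦ ψ (d, b))`. -/
def compInner : pullback (F.compBase G X ≫ G.shape (Over.mk F.t)) G.f ⟶ F.dom X :=
  let y := pullback.fst (F.compBase G X ≫ G.shape (Over.mk F.t)) G.f
  let d := pullback.snd (F.compBase G X ≫ G.shape (Over.mk F.t)) G.f
  have h : (y ≫ F.compBase G X) ≫ G.shape (Over.mk F.t) = d ≫ G.f :=
    (Category.assoc _ _ _).trans pullback.condition
  let a := PolyDiagram.compShape y d h
  let y' := pullback.fst a F.f ≫ y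
  let d' := pullback.fst a F.f ≫ d
  let b := pullback.snd a F.f
  have h' : (y' ≫ F.compBase G X) ≫ G.shape (Over.mk F.t) = d' ≫ G.f := by
    simp only [y', d', Category.assoc] at h ⊢
    rw [h]
  have hb : PolyDiagram.compShape y' d' h' = b ≫ F.f :=
    (PolyDiagram.comp_compShape _ _ _ _).symm.trans pullback.condition
  lam (F := F) (X := X) a
    (evalAt y' (PolyDiagram.compPos y' d' h' b hb) (PolyDiagram.compPos_f _ _ _ _ _))
    ((evalAt_hom _ _ _).trans (PolyDiagram.compPos_s _ _ _ _ _))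

theorem compMap_shape : compMap F G X ≫ G.shape _ = F.compBase G X ≫ G.shape (Over.mk F.t) :=
  lam_shape (F := G) (X := F.ext.functor.obj X) _ _ _

theorem innerAt_compMap {Z : E} (z : Z ⟶ (F.comp G).dom X) (d : Z ⟶ G.B)
    (h : (z ≫ compMap F G X) ≫ G.shape _ = d ≫ G.f)
    (h' : z ≫ F.compBase G X ≫ G.shape (Over.mk F.t) = d ≫ G.f) :
    innerAt (z ≫ compMap F G X) d h = pullback.lift z d h' ≫ compInner F G X :=
  evalAt_lam (F := G) (X := F.ext.functor.obj X) _ _ _ z d h h'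

theorem compShape_congr {Z : E} {y y' : Z ⟶ (F.comp G).dom X} {d d' : Z ⟶ G.B}
    (h : (y ≫ F.compBase G X) ≫ G.shape (Over.mk F.t) = d ≫ G.f)
    (h' : (y' ≫ F.compBase G X) ≫ G.shape (Over.mk F.t) = d' ≫ G.f) (hy : y = y') (hd : d = d') :
    PolyDiagram.compShape y d h = PolyDiagram.compShape y' d' h' := by
  subst hy hd; rfl

theorem compPos_congr {Y : Over I} {Z : E} {y : Z ⟶ (F.comp G).dom X}
    {y' : Z ⟶ (F.comp G).dom Y} {d d' : Z ⟶ G.B}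
    (h : (y ≫ F.compBase G X) ≫ G.shape (Over.mk F.t) = d ≫ G.f)
    (h' : (y' ≫ F.compBase G Y) ≫ G.shape (Over.mk F.t) = d' ≫ G.f)
    {b b' : Z ⟶ F.B} (hb : PolyDiagram.compShape y d h = b ≫ F.f)
    (hb' : PolyDiagram.compShape y' d' h' = b' ≫ F.f)
    (hy : y ≫ F.compBase G X = y' ≫ F.compBase G Y) (hd : d = d') (hbb : b = b') :
    PolyDiagram.compPos y d h b hb = PolyDiagram.compPos y' d' h' b' hb' :=
  compPos_eq _ _ _ _ _ ((compPos_posB _ _ _ _ _).trans hbb.symm)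
    ((compPos_posD _ _ _ _ _).trans hd.symm) ((compPos_compF _ _ _ _ _).trans hy.symm)

theorem innerAt_compMap_shape {Z : E} (z : Z ⟶ (F.comp G).dom X) (d : Z ⟶ G.B)
    (h : (z ≫ compMap F G X) ≫ G.shape _ = d ≫ G.f)
    (h' : (z ≫ F.compBase G X) ≫ G.shape (Over.mk F.t) = d ≫ G.f) :
    innerAt (z ≫ compMap F G X) d h ≫ F.shape X = PolyDiagram.compShape z d h' := by
  have h'' : z ≫ F.compBase G X ≫ G.shape (Over.mk F.t) = d ≫ G.f := by
    rw [← h', Category.assoc]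
  rw [innerAt_compMap z d h h'', Category.assoc]
  refine (congrArg _ (lam_shape (F := F) (X := X) _ _ _)).trans ?_
  refine (PolyDiagram.comp_compShape _ _ _ _).trans (compShape_congr _ _ ?_ ?_)
  · exact pullback.lift_fst _ _ _
  · exact pullback.lift_snd _ _ _

/-- The defining property of the comparison of composites. -/
theorem evalAt_innerAt_compMap {Z : E} (z : Z ⟶ (F.comp G).dom X) (d : Z ⟶ G.B)
    (h : (z ≫ compMap F G X) ≫ G.shape _ = d ≫ G.f)
    (h' : (z ≫ F.compBase G X) ≫ G.shape (Over.mk F.t) = d ≫ G.f) (b : Z ⟶ F.B)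
    (hb : innerAt (z ≫ compMap F G X) d h ≫ F.shape X = b ≫ F.f)
    (hb' : PolyDiagram.compShape z d h' = b ≫ F.f) :
    evalAt (innerAt (z ≫ compMap F G X) d h) b hb =
      evalAt z (PolyDiagram.compPos z d h' b hb') (PolyDiagram.compPos_f _ _ _ _ _) := by
  have h'' : z ≫ F.compBase G X ≫ G.shape (Over.mk F.t) = d ≫ G.f := by
    rw [← h', Category.assoc]
  have e := innerAt_compMap z d h h''
  refine (evalAt_congr _ e rfl).trans ?_
  have k : pullback.lift z d h'' ≫ PolyDiagram.compShape
      (pullback.fst (F.compBase G X ≫ G.shape (Over.mk F.t)) G.f)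
      (pullback.snd (F.compBase G X ≫ G.shape (Over.mk F.t)) G.f)
      ((Category.assoc _ _ _).trans pullback.condition) = b ≫ F.f := by
    refine Eq.trans ?_ hb'
    refine (PolyDiagram.comp_compShape _ _ _ _).trans (compShape_congr _ _ ?_ ?_)
    · exact pullback.lift_fst _ _ _
    · exact pullback.lift_snd _ _ _
  refine (evalAt_lam (F := F) (X := X) _ _ _ (pullback.lift z d h'') b _ k).trans ?_
  have e' : pullback.lift (pullback.lift z d h'') b k ≫ (pullback.fst _ _ ≫
      pullback.fst (F.compBase G X ≫ G.shape (Over.mk F.t)) G.f) = z := by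
    rw [pullback.lift_fst_assoc, pullback.lift_fst]
  refine (comp_evalAt _ _ _ _).trans (evalAt_congr _ e' ?_)
  · symm
    refine compPos_eq _ _ _ _ _ ?_ ?_ ?_
    · rw [Category.assoc, compPos_posB, pullback.lift_snd]
    · rw [Category.assoc, compPos_posD, pullback.lift_fst_assoc, pullback.lift_snd]
    · rw [Category.assoc, compPos_compF]
      exact (Category.assoc _ _ _).symm.trans (congrArg (· ≫ F.compBase G X) e')

variable (F G X) in
theorem compMap_innerShape : compMap F G X ≫ innerShape F G X = F.compBase G X := by
  refine dom_ext (F := G) (X := Over.mk F.t)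
    (by rw [Category.assoc, innerShape_shape, compMap_shape]) fun z d hd => ?_
  have h₁ : ((z ≫ compMap F G X) ≫ innerShape F G X) ≫ G.shape (Over.mk F.t) = d ≫ G.f := by
    rw [← hd]; simp only [Category.assoc]
  have h₂ : (z ≫ compMap F G X) ≫ G.shape _ = d ≫ G.f := by
    rw [← h₁, Category.assoc _ (innerShape F G X), innerShape_shape]
  have h₃ : (z ≫ F.compBase G X) ≫ G.shape (Over.mk F.t) = d ≫ G.f := by
    rw [← h₂, Category.assoc, Category.assoc, compMap_shape]
  refine (evalAt_congr _ (Category.assoc _ _ _).symm rfl).trans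
    ((innerAt_shape (z ≫ compMap F G X) d h₂ h₁).symm.trans ?_)
  exact innerAt_compMap_shape z d h₂ h₃

/-- The value at `((c, φ), d, b)` of the element of the extension of the composite polynomial
corresponding to `w`. -/
def invVal {Z : E} (w : Z ⟶ G.dom (F.ext.functor.obj X)) (q : Z ⟶ (F.comp G).B)
    (h : w ≫ innerShape F G X = q ≫ compF F G) : Z ⟶ X.left :=
  have hd : w ≫ G.shape _ = (q ≫ posD F G) ≫ G.f := by
    rw [← innerShape_shape, ← Category.assoc, h, Category.assoc, compF_shape, Category.assoc]
  have hd' : (w ≫ innerShape F G X) ≫ G.shape (Over.mk F.t) = (q ≫ posD F G) ≫ G.f := by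
    rw [Category.assoc, innerShape_shape, hd]
  have hq : (q ≫ posB F G) ≫ F.f = _ := (Category.assoc _ _ _).trans
    ((congrArg (q ≫ ·) (posB_f F G)).trans (comp_evalAt (F := G) (X := Over.mk F.t) _ _ _ _))
  evalAt (innerAt w (q ≫ posD F G) hd) (q ≫ posB F G)
    ((innerAt_shape _ _ hd hd').trans ((evalAt_congr _ h rfl).trans hq.symm))

theorem invVal_eq {Z : E} (w : Z ⟶ G.dom (F.ext.functor.obj X)) (q : Z ⟶ (F.comp G).B)
    (h : w ≫ innerShape F G X = q ≫ compF F G) (d : Z ⟶ G.B) (hd : w ≫ G.shape _ = d ≫ G.f)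
    (b : Z ⟶ F.B) (hb : innerAt w d hd ≫ F.shape X = b ≫ F.f) (hqd : q ≫ posD F G = d)
    (hqb : q ≫ posB F G = b) : invVal w q h = evalAt (innerAt w d hd) b hb := by
  subst hqd hqb; rfl

theorem comp_invVal {Z' Z : E} (g : Z' ⟶ Z) (w : Z ⟶ G.dom (F.ext.functor.obj X))
    (q : Z ⟶ (F.comp G).B) (h : w ≫ innerShape F G X = q ≫ compF F G)
    {w' : Z' ⟶ G.dom (F.ext.functor.obj X)} {q' : Z' ⟶ (F.comp G).B}
    (h' : w' ≫ innerShape F G X = q' ≫ compF F G) (hw : g ≫ w = w') (hq : g ≫ q = q') :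
    g ≫ invVal w q h = invVal w' q' h' := by
  subst hw hq
  refine (comp_evalAt _ _ _ _).trans (evalAt_congr _ ?_ (Category.assoc _ _ _).symm)
  exact (comp_innerAt g _ _ _ (by
    rw [Category.assoc, ← innerShape_shape, ← Category.assoc w, h]
    simp only [Category.assoc, compF_shape])).trans
    (innerAt_congr _ _ rfl (Category.assoc _ _ _).symm)

theorem invVal_hom {Z : E} (w : Z ⟶ G.dom (F.ext.functor.obj X)) (q : Z ⟶ (F.comp G).B)
    (h : w ≫ innerShape F G X = q ≫ compF F G) : invVal w q h ≫ X.hom = q ≫ (F.comp G).s :=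
  (evalAt_hom _ _ _).trans (Category.assoc _ _ _)

variable (F G X) in
/-- The inverse of the comparison of composites. -/
def compInv : G.dom (F.ext.functor.obj X) ⟶ (F.comp G).dom X :=
  lam (F := F.comp G) (X := X) (innerShape F G X)
    (invVal (pullback.fst (innerShape F G X) (compF F G))
      (pullback.snd (innerShape F G X) (compF F G)) pullback.condition)
    (invVal_hom _ _ _)

variable (F G X) in
theorem compInv_compBase : compInv F G X ≫ F.compBase G X = innerShape F G X :=
  lam_shape (F := F.comp G) (X := X) _ _ _

theorem evalAt_compInv {Z : E} (w : Z ⟶ G.dom (F.ext.functor.obj X)) (q : Z ⟶ (F.comp G).B)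
    (h : (w ≫ compInv F G X) ≫ (F.comp G).shape X = q ≫ (F.comp G).f)
    (h' : w ≫ innerShape F G X = q ≫ compF F G) :
    evalAt (w ≫ compInv F G X) q h = invVal w q h' :=
  (evalAt_lam (F := F.comp G) (X := X) _ _ _ w q h h').trans
    (comp_invVal _ _ _ _ _ (pullback.lift_fst _ _ _) (pullback.lift_snd _ _ _))

variable (F G X) in
theorem compMap_compInv : compMap F G X ≫ compInv F G X = 𝟙 _ := by
  have hs : (compMap F G X ≫ compInv F G X) ≫ F.compBase G X = 𝟙 _ ≫ F.compBase G X := by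
    rw [Category.assoc, compInv_compBase, compMap_innerShape, Category.id_comp]
  refine dom_ext hs fun z q hq => ?_
  have h₀ : z ≫ F.compBase G X = q ≫ compF F G := by
    have : (z ≫ compMap F G X ≫ compInv F G X) ≫ F.compBase G X = q ≫ compF F G := hq
    rw [← this, Category.assoc, hs, Category.id_comp]
  have h₁ : (z ≫ compMap F G X) ≫ innerShape F G X = q ≫ compF F G := by
    rw [Category.assoc, compMap_innerShape, h₀]
  have h₂ : (z ≫ F.compBase G X) ≫ G.shape (Over.mk F.t) = (q ≫ posD F G) ≫ G.f := by
    rw [h₀, Category.assoc, compF_shape, Category.assoc]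
  have h₃ : (z ≫ compMap F G X) ≫ G.shape _ = (q ≫ posD F G) ≫ G.f := by
    rw [← h₂, Category.assoc, Category.assoc, compMap_shape]
  have h₄ : PolyDiagram.compShape z (q ≫ posD F G) h₂ = (q ≫ posB F G) ≫ F.f := by
    rw [Category.assoc, posB_f, comp_evalAt (F := G) (X := Over.mk F.t)]
    exact evalAt_congr _ h₀ rfl
  have h₅ : innerAt (z ≫ compMap F G X) (q ≫ posD F G) h₃ ≫ F.shape X =
      (q ≫ posB F G) ≫ F.f := by
    rw [innerAt_compMap_shape _ _ h₃ h₂, h₄]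
  have h₆ : ((z ≫ compMap F G X) ≫ compInv F G X) ≫ F.compBase G X = q ≫ compF F G := by
    rw [Category.assoc, compInv_compBase, h₁]
  calc evalAt (z ≫ compMap F G X ≫ compInv F G X) q hq
      = evalAt ((z ≫ compMap F G X) ≫ compInv F G X) q h₆ :=
        evalAt_congr _ (Category.assoc _ _ _).symm rfl
    _ = invVal (z ≫ compMap F G X) q h₁ := evalAt_compInv _ _ _ _
    _ = evalAt (innerAt (z ≫ compMap F G X) (q ≫ posD F G) h₃) (q ≫ posB F G) h₅ :=
        invVal_eq _ _ _ _ _ _ _ rfl rfl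
    _ = _ := evalAt_innerAt_compMap z _ h₃ h₂ _ h₅ h₄
    _ = _ := evalAt_congr _ (Category.comp_id z).symm (compPos_eq _ _ _ _ _ rfl rfl h₀.symm)

variable (F G X) in
theorem compInv_compMap : compInv F G X ≫ compMap F G X = 𝟙 _ := by
  refine comp_dom_ext (by rw [Category.assoc, compMap_innerShape, compInv_compBase,
    Category.id_comp]) fun z d hd hd' b hb hb' => ?_
  have h₁ : ((z ≫ compInv F G X) ≫ compMap F G X) ≫ G.shape _ = d ≫ G.f := by
    rw [Category.assoc z]; exact hd
  have h₂ : ((z ≫ compInv F G X) ≫ F.compBase G X) ≫ G.shape (Over.mk F.t) = d ≫ G.f := by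
    rw [← h₁]; simp only [Category.assoc, compMap_shape]
  have e : innerAt (z ≫ compInv F G X ≫ compMap F G X) d hd =
      innerAt ((z ≫ compInv F G X) ≫ compMap F G X) d h₁ :=
    innerAt_congr _ _ (Category.assoc _ _ _).symm rfl
  have h₃ : innerAt ((z ≫ compInv F G X) ≫ compMap F G X) d h₁ ≫ F.shape X = b ≫ F.f := by
    rw [← e, hb]
  have h₄ : PolyDiagram.compShape (z ≫ compInv F G X) d h₂ = b ≫ F.f := by
    rw [← innerAt_compMap_shape _ _ h₁ h₂, h₃]
  have h₅ : z ≫ innerShape F G X =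
      PolyDiagram.compPos (z ≫ compInv F G X) d h₂ b h₄ ≫ compF F G := by
    rw [compPos_compF, Category.assoc, compInv_compBase]
  calc evalAt (innerAt (z ≫ compInv F G X ≫ compMap F G X) d hd) b hb
      = evalAt (innerAt ((z ≫ compInv F G X) ≫ compMap F G X) d h₁) b h₃ := evalAt_congr _ e rfl
    _ = _ := evalAt_innerAt_compMap _ _ h₁ h₂ _ h₃ h₄
    _ = invVal z (PolyDiagram.compPos (z ≫ compInv F G X) d h₂ b h₄) h₅ :=
        evalAt_compInv _ _ _ _
    _ = evalAt (innerAt (z ≫ 𝟙 _) d hd') b hb' := by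
        have hz : z ≫ G.shape (F.ext.functor.obj X) = d ≫ G.f := by
          rw [← hd', Category.comp_id]
        have ez : innerAt z d hz = innerAt (z ≫ 𝟙 _) d hd' :=
          innerAt_congr _ _ (Category.comp_id _).symm rfl
        refine (invVal_eq _ _ _ d hz b (by rw [ez, hb']) (compPos_posD _ _ _ _ _)
          (compPos_posB _ _ _ _ _)).trans (evalAt_congr _ ez rfl)

variable (F G)

theorem isIso_compMap (X : Over I) : IsIso (compMap F G X) :=
  ⟨compInv F G X, compMap_compInv F G X, compInv_compMap F G X⟩

theorem compBase_naturality {X Y : Over I} (g : X ⟶ Y) :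
    (F.comp G).mapDom g ≫ F.compBase G Y = F.compBase G X := mapDom_shape (F.comp G) g

theorem compBase_strength (L : E) (X : Over I) :
    (F.comp G).strDom L X ≫ F.compBase G (tens L X) = prod.snd ≫ F.compBase G X :=
  strDom_shape (F.comp G) L X

theorem innerShape_naturality {X Y : Over I} (g : X ⟶ Y) :
    G.mapDom (F.ext.functor.map g) ≫ innerShape F G Y = innerShape F G X :=
  map_left_comp G.ext.functor _ _ (shapeHom F X) (mapDom_shape F g)

theorem innerAt_naturality {X Y : Over I} (g : X ⟶ Y) {Z : E}
    (w : Z ⟶ G.dom (F.ext.functor.obj X)) (d : Z ⟶ G.B)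
    (h : (w ≫ G.mapDom (F.ext.functor.map g)) ≫ G.shape _ = d ≫ G.f)
    (h' : w ≫ G.shape _ = d ≫ G.f) :
    innerAt (w ≫ G.mapDom (F.ext.functor.map g)) d h = innerAt w d h' ≫ F.mapDom g :=
  evalAt_mapDom G (F.ext.functor.map g) w d h h'

theorem compMap_naturality {X Y : Over I} (g : X ⟶ Y) :
    (F.comp G).mapDom g ≫ compMap F G Y = compMap F G X ≫ G.mapDom (F.ext.functor.map g) := by
  refine comp_dom_ext (by rw [Category.assoc, Category.assoc, innerShape_naturality,
    compMap_innerShape, compMap_innerShape, compBase_naturality]) fun z d hd hd' b hb hb' => ?_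
  have h₁ : ((z ≫ (F.comp G).mapDom g) ≫ compMap F G Y) ≫ G.shape _ = d ≫ G.f := by
    rw [Category.assoc z]; exact hd
  have h₂ : ((z ≫ (F.comp G).mapDom g) ≫ F.compBase G Y) ≫ G.shape (Over.mk F.t) = d ≫ G.f := by
    rw [← h₁, Category.assoc _ (F.compBase G Y), Category.assoc _ (compMap F G Y), compMap_shape]
  have h₃ : (z ≫ F.compBase G X) ≫ G.shape (Over.mk F.t) = d ≫ G.f := by
    rw [← h₂, Category.assoc z ((F.comp G).mapDom g), compBase_naturality]
  have h₄ : (z ≫ compMap F G X) ≫ G.shape _ = d ≫ G.f := by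
    rw [← h₃, Category.assoc, Category.assoc, compMap_shape]
  have h₅ : ((z ≫ compMap F G X) ≫ G.mapDom (F.ext.functor.map g)) ≫ G.shape _ = d ≫ G.f := by
    rw [Category.assoc z]; exact hd'
  have e : innerAt (z ≫ (F.comp G).mapDom g ≫ compMap F G Y) d hd =
      innerAt ((z ≫ (F.comp G).mapDom g) ≫ compMap F G Y) d h₁ :=
    innerAt_congr _ _ (Category.assoc _ _ _).symm rfl
  have e' : innerAt (z ≫ compMap F G X ≫ G.mapDom (F.ext.functor.map g)) d hd' =
      innerAt (z ≫ compMap F G X) d h₄ ≫ F.mapDom g :=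
    (innerAt_congr _ h₅ (Category.assoc _ _ _).symm rfl).trans (innerAt_naturality F G g _ _ _ _)
  have k₁ : innerAt ((z ≫ (F.comp G).mapDom g) ≫ compMap F G Y) d h₁ ≫ F.shape Y = b ≫ F.f := by
    rw [← e, hb]
  have k₂ : PolyDiagram.compShape (z ≫ (F.comp G).mapDom g) d h₂ = b ≫ F.f := by
    rw [← innerAt_compMap_shape _ _ h₁ h₂, k₁]
  have k₃ : (innerAt (z ≫ compMap F G X) d h₄ ≫ F.mapDom g) ≫ F.shape Y = b ≫ F.f := by
    rw [← e', hb']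
  have k₄ : innerAt (z ≫ compMap F G X) d h₄ ≫ F.shape X = b ≫ F.f := by
    rw [← k₃, Category.assoc, mapDom_shape]
  have k₅ : PolyDiagram.compShape z d h₃ = b ≫ F.f := by
    rw [← innerAt_compMap_shape _ _ h₄ h₃, k₄]
  have p : PolyDiagram.compPos (z ≫ (F.comp G).mapDom g) d h₂ b k₂ =
      PolyDiagram.compPos z d h₃ b k₅ :=
    compPos_congr h₂ h₃ k₂ k₅ (by rw [Category.assoc, compBase_naturality]) rfl rfl
  have q := PolyDiagram.compPos_f z d h₃ b k₅
  have q' : (z ≫ (F.comp G).mapDom g) ≫ (F.comp G).shape Y =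
      PolyDiagram.compPos z d h₃ b k₅ ≫ (F.comp G).f := by
    rw [Category.assoc, mapDom_shape]; exact q
  calc evalAt (innerAt (z ≫ (F.comp G).mapDom g ≫ compMap F G Y) d hd) b hb
      = evalAt (innerAt ((z ≫ (F.comp G).mapDom g) ≫ compMap F G Y) d h₁) b k₁ :=
        evalAt_congr _ e rfl
    _ = _ := evalAt_innerAt_compMap _ _ h₁ h₂ _ k₁ k₂
    _ = evalAt (z ≫ (F.comp G).mapDom g) (PolyDiagram.compPos z d h₃ b k₅) q' :=
        evalAt_congr _ rfl p
    _ = evalAt z (PolyDiagram.compPos z d h₃ b k₅) q ≫ g.left := evalAt_mapDom _ _ _ _ _ _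
    _ = evalAt (innerAt (z ≫ compMap F G X) d h₄) b k₄ ≫ g.left := by
        rw [evalAt_innerAt_compMap _ _ h₄ h₃ _ k₄ k₅]
    _ = evalAt (innerAt (z ≫ compMap F G X) d h₄ ≫ F.mapDom g) b k₃ :=
        (evalAt_mapDom _ _ _ _ _ _).symm
    _ = _ := evalAt_congr _ e'.symm rfl

theorem innerAt_strength (L : E) {Z : E} (w : Z ⟶ L ⨯ G.dom (F.ext.functor.obj X)) (d : Z ⟶ G.B)
    (h : ((w ≫ G.strDom L (F.ext.functor.obj X)) ≫ G.mapDom (F.ext.strength.app L X)) ≫ G.shape _ =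
      d ≫ G.f) (h' : (w ≫ prod.snd) ≫ G.shape _ = d ≫ G.f) :
    innerAt ((w ≫ G.strDom L (F.ext.functor.obj X)) ≫ G.mapDom (F.ext.strength.app L X)) d h =
      prod.lift (w ≫ prod.fst) (innerAt (w ≫ prod.snd) d h') ≫ F.strDom L X := by
  have h₁ : (w ≫ G.strDom L (F.ext.functor.obj X)) ≫ G.shape _ = d ≫ G.f := by
    rw [← h']; simp only [Category.assoc, strDom_shape]
  refine (evalAt_mapDom G (F.ext.strength.app L X) _ d h h₁).trans ?_
  rw [ext_strength_left]
  exact congrArg (· ≫ F.strDom L X) (evalAt_strDom G w d h₁ h')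

theorem innerShape_strength (L : E) (X : Over I) :
    G.mapDom (F.ext.strength.app L X) ≫ innerShape F G (tens L X) =
      G.mapDom (tensSnd L (F.ext.functor.obj X)) ≫ innerShape F G X := by
  refine map_left_comm G.ext.functor _ (shapeHom F (tens L X)) _ (shapeHom F X) ?_
  rw [ext_strength_left]
  exact strDom_shape F L X

theorem compMap_strength (L : E) (X : Over I) :
    (F.comp G).strDom L X ≫ compMap F G (tens L X) = prod.map (𝟙 L) (compMap F G X) ≫
      G.strDom L (F.ext.functor.obj X) ≫ G.mapDom (F.ext.strength.app L X) := by
  refine comp_dom_ext ?_ fun z d hd hd' b hb hb' => ?_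
  · rw [Category.assoc, Category.assoc, Category.assoc, compMap_innerShape, compBase_strength,
      innerShape_strength, reassoc_of% (strDom_mapDom_tensSnd G L (F.ext.functor.obj X)),
      prod.map_snd_assoc, compMap_innerShape]
  have h₁ : ((z ≫ (F.comp G).strDom L X) ≫ compMap F G (tens L X)) ≫ G.shape _ = d ≫ G.f := by
    rw [Category.assoc z]; exact hd
  have h₂ : ((z ≫ (F.comp G).strDom L X) ≫ F.compBase G (tens L X)) ≫ G.shape (Over.mk F.t) =
      d ≫ G.f := by
    rw [← h₁, Category.assoc _ (F.compBase G (tens L X)), Category.assoc _ (compMap F G _),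
      compMap_shape]
  have h₃ : ((z ≫ prod.snd) ≫ F.compBase G X) ≫ G.shape (Over.mk F.t) = d ≫ G.f := by
    rw [← h₂, Category.assoc z ((F.comp G).strDom L X), compBase_strength, Category.assoc z]
  have h₄ : ((z ≫ prod.snd) ≫ compMap F G X) ≫ G.shape _ = d ≫ G.f := by
    rw [← h₃, Category.assoc _ (compMap F G X), compMap_shape, Category.assoc _ (F.compBase G X)]
  have h₅ : (((z ≫ prod.map (𝟙 L) (compMap F G X)) ≫ G.strDom L (F.ext.functor.obj X)) ≫
      G.mapDom (F.ext.strength.app L X)) ≫ G.shape _ = d ≫ G.f := by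
    rw [← hd']; simp only [Category.assoc]
  have hp : (z ≫ prod.map (𝟙 L) (compMap F G X)) ≫ prod.snd =
      (z ≫ prod.snd) ≫ compMap F G X := by
    rw [Category.assoc, prod.map_snd, Category.assoc]
  have h₆ : ((z ≫ prod.map (𝟙 L) (compMap F G X)) ≫ prod.snd) ≫ G.shape _ = d ≫ G.f := by
    rw [hp, h₄]
  have e : innerAt (z ≫ (F.comp G).strDom L X ≫ compMap F G (tens L X)) d hd =
      innerAt ((z ≫ (F.comp G).strDom L X) ≫ compMap F G (tens L X)) d h₁ :=
    innerAt_congr _ _ (Category.assoc _ _ _).symm rfl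
  have e' : innerAt (z ≫ prod.map (𝟙 L) (compMap F G X) ≫ G.strDom L (F.ext.functor.obj X) ≫
        G.mapDom (F.ext.strength.app L X)) d hd' =
      prod.lift (z ≫ prod.fst) (innerAt ((z ≫ prod.snd) ≫ compMap F G X) d h₄) ≫ F.strDom L X := by
    refine (innerAt_congr _ h₅ (by simp only [Category.assoc]) rfl).trans
      ((innerAt_strength F G L _ d h₅ h₆).trans ?_)
    refine congrArg (· ≫ F.strDom L X) (congrArg₂ prod.lift ?_ (innerAt_congr _ _ hp rfl))
    rw [Category.assoc, prod.map_fst, Category.comp_id]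
  have k₁ : innerAt ((z ≫ (F.comp G).strDom L X) ≫ compMap F G (tens L X)) d h₁ ≫
      F.shape (tens L X) = b ≫ F.f := by
    rw [← e, hb]
  have k₂ : PolyDiagram.compShape (z ≫ (F.comp G).strDom L X) d h₂ = b ≫ F.f := by
    rw [← innerAt_compMap_shape _ _ h₁ h₂, k₁]
  have k₃ : (prod.lift (z ≫ prod.fst) (innerAt ((z ≫ prod.snd) ≫ compMap F G X) d h₄) ≫
      F.strDom L X) ≫ F.shape (tens L X) = b ≫ F.f := by
    rw [← e', hb']
  have k₃' : (prod.lift (z ≫ prod.fst) (innerAt ((z ≫ prod.snd) ≫ compMap F G X) d h₄) ≫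
      prod.snd) ≫ F.shape X = b ≫ F.f := by
    rw [← k₃]; simp only [Category.assoc, strDom_shape]
  have k₄ : innerAt ((z ≫ prod.snd) ≫ compMap F G X) d h₄ ≫ F.shape X = b ≫ F.f := by
    rw [← k₃', prod.lift_snd]
  have k₅ : PolyDiagram.compShape (z ≫ prod.snd) d h₃ = b ≫ F.f := by
    rw [← innerAt_compMap_shape _ _ h₄ h₃, k₄]
  have p : PolyDiagram.compPos (z ≫ (F.comp G).strDom L X) d h₂ b k₂ =
      PolyDiagram.compPos (z ≫ prod.snd) d h₃ b k₅ :=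
    compPos_congr h₂ h₃ k₂ k₅ (by
      rw [Category.assoc, compBase_strength, Category.assoc]) rfl rfl
  have q := PolyDiagram.compPos_f (z ≫ prod.snd) d h₃ b k₅
  have q' : (z ≫ (F.comp G).strDom L X) ≫ (F.comp G).shape (tens L X) =
      PolyDiagram.compPos (z ≫ prod.snd) d h₃ b k₅ ≫ (F.comp G).f := by
    rw [Category.assoc, strDom_shape, ← Category.assoc]; exact q
  calc evalAt (innerAt (z ≫ (F.comp G).strDom L X ≫ compMap F G (tens L X)) d hd) b hb
      = evalAt (innerAt ((z ≫ (F.comp G).strDom L X) ≫ compMap F G (tens L X)) d h₁) b k₁ :=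
        evalAt_congr _ e rfl
    _ = _ := evalAt_innerAt_compMap _ _ h₁ h₂ _ k₁ k₂
    _ = evalAt (z ≫ (F.comp G).strDom L X)
          (PolyDiagram.compPos (z ≫ prod.snd) d h₃ b k₅) q' := evalAt_congr _ rfl p
    _ = prod.lift (z ≫ prod.fst)
          (evalAt (z ≫ prod.snd) (PolyDiagram.compPos (z ≫ prod.snd) d h₃ b k₅) q) :=
        evalAt_strDom _ _ _ _ _
    _ = prod.lift (z ≫ prod.fst)
          (evalAt (innerAt ((z ≫ prod.snd) ≫ compMap F G X) d h₄) b k₄) := by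
        rw [evalAt_innerAt_compMap _ _ h₄ h₃ _ k₄ k₅]
    _ = _ := by
        symm
        refine (evalAt_strDom F _ b k₃ k₃').trans (congrArg₂ prod.lift (prod.lift_fst _ _) ?_)
        exact evalAt_congr _ (prod.lift_snd _ _) rfl
    _ = _ := evalAt_congr _ e'.symm rfl

/-- The comparison of the extension of a composite with the composite of the extensions. -/
def compIso : (F.comp G).ext.functor ≅ (F.ext.comp G.ext).functor :=
  extIso (F.comp G) (F.ext.comp G.ext) (compMap F G) (isIso_compMap F G)
    (fun X => by
      have h := compMap_shape (F := F) (G := G) (X := X)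
      refine (Category.assoc _ _ _).symm.trans ((congrArg (· ≫ G.t) h).trans ?_)
      exact Category.assoc _ _ _)
    (compMap_naturality F G)

theorem compIso_isStrong :
    IsStrong (P := (F.comp G).ext) (Q := F.ext.comp G.ext) (compIso F G).hom :=
  extIso_isStrong _ _ _ _ _ _ fun L X => (compMap_strength F G L X).trans (by
    change _ = _ ≫ (G.ext.strength.app L (F.ext.functor.obj X) ≫
      G.ext.functor.map (F.ext.strength.app L X)).left
    rw [Over.comp_left, ext_strength_left G]
    rfl)

end Comp

theorem IsPolyFunctor.comp {I J K : E} {P : StrongFunctor I J} {Q : StrongFunctor J K}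
    (hP : IsPolyFunctor P) (hQ : IsPolyFunctor Q) : IsPolyFunctor (P.comp Q) := by
  obtain ⟨F, e, he⟩ := hP
  obtain ⟨G, i, hi⟩ := hQ
  exact ⟨F.comp G, compIso F G ≪≫ NatIso.hcomp e i, (compIso_isStrong F G).comp (he.hcomp hi)⟩

theorem isPolyFunctor_baseChange {I' J' I J : E} (u : I' ⟶ I) (v : J' ⟶ J)
    {P : StrongFunctor I J} (h : IsPolyFunctor P) : IsPolyFunctor (baseChange u v P) :=
  ((isPolyFunctor_sumS u).comp h).comp (isPolyFunctor_pullS v)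

theorem isPolyFunctor_cobaseChange {I' J' I J : E} (u : I' ⟶ I) (v : J' ⟶ J)
    {P' : StrongFunctor I' J'} (h : IsPolyFunctor P') : IsPolyFunctor (cobaseChange u v P') :=
  ((isPolyFunctor_pullS u).comp h).comp (isPolyFunctor_sumS v)

end

section

/-! ### Representation of squares by diagrams -/

theorem SqDiagram.sel_toB {E : Type u} [Category.{v} E] {I' J' I J : E} {u : I' ⟶ I} {v : J' ⟶ J}
    {F' : PolyDiagram I' J'} {F : PolyDiagram I J} (d : SqDiagram u v F' F) :
    d.sel d.toA' d.toB d.isPullback.w.symm = d.toB' := by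
  have : d.isPullback.lift d.toB d.toA' d.isPullback.w = 𝟙 _ :=
    d.isPullback.hom_ext (by simp) (by simp)
  rw [sel, this, Category.id_comp]

variable {E : Type u} [Category.{v} E] [HasFiniteLimits E] [IsLCC E]

section Generic

variable {I J : E} (F : PolyDiagram I J)

/-- The generic element `a ↦ (a, b ↦ b)` of the extension of a polynomial at `s : B ⟶ I`. -/
def genElt : F.A ⟶ F.dom (Over.mk F.s) :=
  lam (F := F) (X := Over.mk F.s) (𝟙 F.A) (pullback.snd (𝟙 F.A) F.f) rfl

theorem genElt_shape : genElt F ≫ F.shape (Over.mk F.s) = 𝟙 F.A := lam_shape _ _ _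

theorem evalAt_genElt {Z : E} (z : Z ⟶ F.A) (b : Z ⟶ F.B)
    (h : (z ≫ genElt F) ≫ F.shape (Over.mk F.s) = b ≫ F.f) :
    evalAt (z ≫ genElt F) b h = b := by
  have h' : z ≫ 𝟙 F.A = b ≫ F.f := by rw [← h, Category.assoc, genElt_shape]
  exact (evalAt_lam (F := F) (X := Over.mk F.s) _ _ _ z b h h').trans (pullback.lift_snd _ _ _)

variable {F}

/-- The object of pairs `(z, b)` with `f b = a z`, over `I`. -/
abbrev fibre {Z : E} (a : Z ⟶ F.A) : Over I := Over.mk (pullback.snd a F.f ≫ F.s)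

/-- The family `z ↦ (a z, b ↦ (z, b))`. -/
def famElt {Z : E} (a : Z ⟶ F.A) : Z ⟶ F.dom (fibre a) :=
  lam (F := F) (X := fibre a) a (𝟙 (pullback a F.f)) (Category.id_comp _)

theorem famElt_shape {Z : E} (a : Z ⟶ F.A) : famElt a ≫ F.shape (fibre a) = a := lam_shape _ _ _

theorem evalAt_famElt {Z Z' : E} (a : Z ⟶ F.A) (z : Z' ⟶ Z) (b : Z' ⟶ F.B)
    (h : (z ≫ famElt a) ≫ F.shape (fibre a) = b ≫ F.f) (h' : z ≫ a = b ≫ F.f) :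
    evalAt (z ≫ famElt a) b h = pullback.lift z b h' :=
  (evalAt_lam (F := F) (X := fibre a) _ _ _ z b h h').trans (Category.comp_id _)

/-- The inclusion of the pairs `(z, b)` with `f b = a z` into all pairs. -/
def fibreIncl {Z : E} (a : Z ⟶ F.A) : fibre a ⟶ tens Z (Over.mk F.s) :=
  Over.homMk (prod.lift (pullback.fst a F.f) (pullback.snd a F.f)) (prod.lift_snd_assoc _ _ _)

/-- Evaluation of an element, as a morphism out of its fibre. -/
def fibreEval {Z : E} {X : Over I} (y : Z ⟶ F.dom X) : fibre (y ≫ F.shape X) ⟶ X :=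
  Over.homMk (evalAt (pullback.fst (y ≫ F.shape X) F.f ≫ y) (pullback.snd (y ≫ F.shape X) F.f)
    ((Category.assoc _ _ _).trans pullback.condition)) (evalAt_hom _ _ _)

/-- Every element is the image of a family under a morphism of `E/I`. -/
theorem famElt_mapDom {Z : E} {X : Over I} (y : Z ⟶ F.dom X) :
    famElt (y ≫ F.shape X) ≫ F.mapDom (fibreEval y) = y := by
  refine dom_ext (by rw [Category.assoc, mapDom_shape, famElt_shape]) fun z b hb => ?_
  have h₁ : ((z ≫ famElt (y ≫ F.shape X)) ≫ F.mapDom (fibreEval y)) ≫ F.shape X = b ≫ F.f := by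
    rw [← hb, Category.assoc z]
  have h₂ : (z ≫ famElt (y ≫ F.shape X)) ≫ F.shape _ = b ≫ F.f := by
    rw [← h₁, Category.assoc _ (F.mapDom _), mapDom_shape]
  have h₃ : z ≫ y ≫ F.shape X = b ≫ F.f := by
    rw [← h₂, Category.assoc, famElt_shape]
  refine (evalAt_congr _ (Category.assoc _ _ _).symm rfl).trans
    ((evalAt_mapDom F (fibreEval y) _ b h₁ h₂).trans ?_)
  rw [evalAt_famElt _ _ _ h₂ h₃]
  refine (comp_evalAt _ _ _ _).trans (evalAt_congr _ ?_ (pullback.lift_snd _ _ _))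
  rw [pullback.lift_fst_assoc]

/-- A family is, up to the inclusion of its fibre, obtained from the generic element by the
strength. -/
theorem famElt_fibreIncl {Z : E} (a : Z ⟶ F.A) :
    famElt a ≫ F.mapDom (fibreIncl a) =
      prod.lift (𝟙 Z) (a ≫ genElt F) ≫ F.strDom Z (Over.mk F.s) := by
  refine dom_ext ?_ fun z b hb => ?_
  · rw [Category.assoc, mapDom_shape, famElt_shape, Category.assoc, strDom_shape,
      prod.lift_snd_assoc, Category.assoc, genElt_shape, Category.comp_id]
  have h₁ : ((z ≫ famElt a) ≫ F.mapDom (fibreIncl a)) ≫ F.shape _ = b ≫ F.f := by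
    rw [← hb, Category.assoc z]
  have h₂ : (z ≫ famElt a) ≫ F.shape _ = b ≫ F.f := by
    rw [← h₁, Category.assoc _ (F.mapDom _), mapDom_shape]
  have h₃ : z ≫ a = b ≫ F.f := by
    rw [← h₂, Category.assoc, famElt_shape]
  have h₄ : ((z ≫ prod.lift (𝟙 Z) (a ≫ genElt F)) ≫ prod.snd) ≫ F.shape (Over.mk F.s) =
      b ≫ F.f := by
    rw [Category.assoc z, prod.lift_snd, Category.assoc, Category.assoc, genElt_shape,
      Category.comp_id, h₃]
  have h₅ : ((z ≫ prod.lift (𝟙 Z) (a ≫ genElt F)) ≫ F.strDom Z (Over.mk F.s)) ≫ F.shape _ =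
      b ≫ F.f := by
    rw [Category.assoc, strDom_shape, ← h₄]; simp only [Category.assoc]
  have h₆ : ((z ≫ a) ≫ genElt F) ≫ F.shape (Over.mk F.s) = b ≫ F.f := by
    rw [Category.assoc, genElt_shape, Category.comp_id, h₃]
  refine (evalAt_congr (y' := (z ≫ famElt a) ≫ F.mapDom (fibreIncl a)) _
    (Category.assoc _ _ _).symm rfl).trans
    ((evalAt_mapDom F (fibreIncl a) _ b h₁ h₂).trans ?_)
  refine Eq.trans ?_ ((evalAt_strDom F _ b h₅ h₄).symm.trans
    (evalAt_congr h₅ (Category.assoc _ _ _) rfl))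
  rw [evalAt_famElt _ _ _ h₂ h₃]
  change pullback.lift z b h₃ ≫ prod.lift _ _ = _
  apply prod.hom_ext
  · rw [Category.assoc, prod.lift_fst, pullback.lift_fst, prod.lift_fst, Category.assoc,
      prod.lift_fst, Category.comp_id]
  · rw [Category.assoc, prod.lift_snd, pullback.lift_snd, prod.lift_snd]
    refine (evalAt_genElt F (z ≫ a) b h₆).symm.trans (evalAt_congr _ ?_ rfl)
    rw [Category.assoc, Category.assoc, prod.lift_snd]

instance {Z : E} (a : Z ⟶ F.A) : Mono (fibreIncl a).left := by
  refine ⟨fun {W} (g : W ⟶ pullback a F.f) (h : W ⟶ pullback a F.f) e => ?_⟩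
  have e' : g ≫ prod.lift (pullback.fst a F.f) (pullback.snd a F.f) =
    h ≫ prod.lift (pullback.fst a F.f) (pullback.snd a F.f) := e
  apply pullback.hom_ext
  · rw [← prod.lift_fst (pullback.fst a F.f) (pullback.snd a F.f), ← Category.assoc, e',
      Category.assoc]
  · rw [← prod.lift_snd (pullback.fst a F.f) (pullback.snd a F.f), ← Category.assoc, e',
      Category.assoc]

theorem mono_mapDom (F : PolyDiagram I J) {X Y : Over I} (g : X ⟶ Y) [Mono g.left] :
    Mono (F.mapDom g) := by
  refine ⟨fun {Z} y y' e => dom_ext ?_ fun z b hb => ?_⟩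
  · rw [← mapDom_shape F g, ← Category.assoc, e, Category.assoc]
  have hs : y ≫ F.shape X = y' ≫ F.shape X := by
    rw [← mapDom_shape F g, ← Category.assoc, e, Category.assoc]
  have h : ((z ≫ y) ≫ F.mapDom g) ≫ F.shape Y = b ≫ F.f := by
    rw [← hb, Category.assoc _ (F.mapDom g), mapDom_shape]
  have hb' : (z ≫ y') ≫ F.shape X = b ≫ F.f := by rw [← hb, Category.assoc, Category.assoc, hs]
  have e' : (z ≫ y) ≫ F.mapDom g = (z ≫ y') ≫ F.mapDom g := by
    rw [Category.assoc, e, Category.assoc]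
  rw [← cancel_mono g.left, ← evalAt_mapDom F g _ b h hb,
    ← evalAt_mapDom F g _ b (by rw [← e', h]) hb']
  exact evalAt_congr _ e' rfl

end Generic

variable {I' J' I J : E} {u : I' ⟶ I} {v : J' ⟶ J} {F' : PolyDiagram I' J'} {F : PolyDiagram I J}

/-- The component of a square between extensions. -/
def StrongSquare.map (σ : StrongSquare u v F'.ext F.ext) (X : Over I') :
    F'.dom X ⟶ F.dom ((Over.map u).obj X) := (σ.nat.app X).left

theorem StrongSquare.map_naturality (σ : StrongSquare u v F'.ext F.ext) {X Y : Over I'}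
    (g : X ⟶ Y) : F'.mapDom g ≫ σ.map Y = σ.map X ≫ F.mapDom ((Over.map u).map g) :=
  nat_left σ.nat g

theorem StrongSquare.map_strength (σ : StrongSquare u v F'.ext F.ext) (K : E) (X : Over I') :
    F'.strDom K X ≫ σ.map (tens K X) =
      prod.map (𝟙 K) (σ.map X) ≫ F.strDom K ((Over.map u).obj X) ≫ F.mapDom (sumTens u K X) := by
  have h := (isStrong_iff _).1 σ.strong K X
  rw [ext_strength_left, ext_strength_left] at h
  exact h

theorem StrongSquare.map_shape (σ : StrongSquare u v F'.ext F.ext) (X : Over I') :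
    σ.map X ≫ F.shape _ ≫ F.t = F'.shape X ≫ F'.t ≫ v :=
  (Over.w (σ.nat.app X)).trans (Category.assoc _ _ _)

/-- A square between extensions is determined by its value at the generic element. -/
theorem StrongSquare.famElt_map (σ : StrongSquare u v F'.ext F.ext) {Z : E} (a : Z ⟶ F'.A) :
    (famElt a ≫ σ.map _) ≫ F.mapDom ((Over.map u).map (fibreIncl a)) =
      prod.lift (𝟙 Z) (a ≫ genElt F' ≫ σ.map _) ≫
        F.strDom Z ((Over.map u).obj (Over.mk F'.s)) ≫ F.mapDom (sumTens u Z (Over.mk F'.s)) := by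
  rw [Category.assoc, ← σ.map_naturality, ← Category.assoc, famElt_fibreIncl, Category.assoc,
    σ.map_strength, ← Category.assoc, prod.lift_map, Category.id_comp, Category.assoc]

theorem StrongSquare.ext_genElt {σ τ : StrongSquare u v F'.ext F.ext}
    (h : genElt F' ≫ σ.map _ = genElt F' ≫ τ.map _) : σ = τ := by
  refine StrongSquare.ext _ _ fun X => ?_
  change σ.map X = τ.map X
  have key : famElt (𝟙 _ ≫ F'.shape X) ≫ σ.map _ = famElt (𝟙 _ ≫ F'.shape X) ≫ τ.map _ := by
    have : Mono ((Over.map u).map (fibreIncl (𝟙 _ ≫ F'.shape X))).left :=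
      inferInstanceAs (Mono (fibreIncl (𝟙 _ ≫ F'.shape X)).left)
    have := mono_mapDom F ((Over.map u).map (fibreIncl (𝟙 _ ≫ F'.shape X)))
    rw [← cancel_mono (F.mapDom ((Over.map u).map (fibreIncl (𝟙 _ ≫ F'.shape X)))),
      σ.famElt_map, τ.famElt_map, h]
  rw [← Category.id_comp (σ.map X), ← Category.id_comp (τ.map X),
    ← famElt_mapDom (𝟙 (F'.dom X)), Category.assoc, Category.assoc, σ.map_naturality,
    τ.map_naturality, reassoc_of% key]

namespace SqDiagram

theorem square_map (d : SqDiagram u v F' F) (X : Over I') : d.square.map X = d.domMap X := rfl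

theorem genElt_domMap_shape (d : SqDiagram u v F' F) :
    (genElt F' ≫ d.domMap (Over.mk F'.s)) ≫ F.shape _ = d.onA := by
  rw [Category.assoc, domMap_shape, ← Category.assoc, genElt_shape, Category.id_comp]

/-- The value of the square of a diagram at the generic element. -/
theorem evalAt_genElt_domMap (d : SqDiagram u v F' F) {Z : E} (z : Z ⟶ F'.A) (b : Z ⟶ F.B)
    (h : (z ≫ genElt F' ≫ d.domMap (Over.mk F'.s)) ≫ F.shape _ = b ≫ F.f)
    (h' : z ≫ d.onA = b ≫ F.f) :
    evalAt (X := (Over.map u).obj (Over.mk F'.s)) (z ≫ genElt F' ≫ d.domMap (Over.mk F'.s)) b h =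
      d.sel z b h' := by
  have e : (z ≫ genElt F') ≫ F'.shape (Over.mk F'.s) = z := by
    rw [Category.assoc, genElt_shape, Category.comp_id]
  have h₁ : ((z ≫ genElt F') ≫ d.domMap (Over.mk F'.s)) ≫ F.shape _ = b ≫ F.f := by
    rw [← h, Category.assoc z]
  have h₂ : ((z ≫ genElt F') ≫ F'.shape (Over.mk F'.s)) ≫ d.onA = b ≫ F.f := by rw [e, h']
  have h₃ : (z ≫ genElt F') ≫ F'.shape (Over.mk F'.s) = d.sel z b h' ≫ F'.f := by
    rw [e, sel_f]
  refine (evalAt_congr _ (Category.assoc _ _ _).symm rfl).trans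
    ((d.evalAt_domMap (z ≫ genElt F') b h₁ h₂).trans ?_)
  exact (evalAt_congr _ rfl (d.sel_congr _ e rfl)).trans (evalAt_genElt F' z (d.sel z b h') h₃)

/-- A diagram represents the square `σ` as soon as it has the right shape and selects the right
elements. -/
theorem square_eq (d : SqDiagram u v F' F) (σ : StrongSquare u v F'.ext F.ext)
    (hA : (genElt F' ≫ σ.map _) ≫ F.shape _ = d.onA)
    (hB : ∀ {Z : E} (z : Z ⟶ F'.A) (b : Z ⟶ F.B) (h : z ≫ d.onA = b ≫ F.f)
      (h' : (z ≫ genElt F' ≫ σ.map _) ≫ F.shape _ = b ≫ F.f),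
      d.sel z b h = evalAt (X := (Over.map u).obj (Over.mk F'.s)) (z ≫ genElt F' ≫ σ.map _) b h') :
    d.square = σ := by
  refine StrongSquare.ext_genElt (dom_ext ?_ fun z b hb => ?_)
  · rw [square_map, genElt_domMap_shape, hA]
  · have h : z ≫ d.onA = b ≫ F.f := by
      rw [← hb, square_map, Category.assoc z, genElt_domMap_shape]
    have h' : (z ≫ genElt F' ≫ σ.map _) ≫ F.shape _ = b ≫ F.f := by
      rw [← h, ← hA, Category.assoc z]
    exact (d.evalAt_genElt_domMap z b hb h).trans (hB z b h h')

/-- A square determines its diagram up to the choice of the pullback: the generic element recovers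
the map `A' ⟶ A` and, at the generic point of the pullback, the map `D ⟶ B'`. -/
theorem square_eq_square_iff (d e : SqDiagram u v F' F) :
    d.square = e.square ↔ d.Equivalent e := by
  constructor
  · intro h
    have hA : d.onA = e.onA := by
      rw [← d.genElt_domMap_shape, ← e.genElt_domMap_shape, ← square_map, ← square_map, h]
    have hd := d.isPullback
    rw [hA] at hd
    refine ⟨hA, hd.isoIsPullback _ _ e.isPullback, ?_, IsPullback.isoIsPullback_hom_fst _ _ _ _⟩
    have hc : d.toA' ≫ e.onA = d.toB ≫ F.f := hd.w.symm
    have hsel : d.sel d.toA' d.toB d.isPullback.w.symm = e.sel d.toA' d.toB hc := by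
      have hb : (d.toA' ≫ genElt F' ≫ d.domMap (Over.mk F'.s)) ≫ F.shape _ = d.toB ≫ F.f := by
        rw [Category.assoc, genElt_domMap_shape, d.isPullback.w]
      have hb' : (d.toA' ≫ genElt F' ≫ e.domMap (Over.mk F'.s)) ≫ F.shape _ = d.toB ≫ F.f := by
        rw [Category.assoc, genElt_domMap_shape, hc]
      rw [← d.evalAt_genElt_domMap _ _ hb, ← e.evalAt_genElt_domMap _ _ hb']
      refine evalAt_congr _ ?_ rfl
      rw [← square_map, ← square_map, h]
    rw [← d.sel_toB, hsel, ← e.sel_toB, comp_sel]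
    exact e.sel_congr _ (IsPullback.isoIsPullback_hom_snd _ _ _ _)
      (IsPullback.isoIsPullback_hom_fst _ _ _ _)
  · rintro ⟨hA, i, h₁, h₂⟩
    refine d.square_eq _ (by rw [square_map, genElt_domMap_shape, hA]) fun z b h h' => ?_
    have he : z ≫ e.onA = b ≫ F.f := by rw [← hA, h]
    refine Eq.trans ?_ (e.evalAt_genElt_domMap z b h' he).symm
    have hi : i.hom ≫ e.toA' = d.toA' := by rw [← d.comm, ← h₁, Category.assoc, e.comm]
    have : d.isPullback.lift b z h.symm ≫ i.hom = e.isPullback.lift b z he.symm := by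
      apply e.isPullback.hom_ext
      · rw [Category.assoc, h₂, IsPullback.lift_fst, IsPullback.lift_fst]
      · rw [Category.assoc, hi, IsPullback.lift_snd, IsPullback.lift_snd]
    rw [sel, sel, ← h₁, ← this, Category.assoc]

theorem comp_square {I₁ J₁ I₂ J₂ I₃ J₃ : E} {u : I₁ ⟶ I₂} {v : J₁ ⟶ J₂} {u' : I₂ ⟶ I₃}
    {v' : J₂ ⟶ J₃} {F₁ : PolyDiagram I₁ J₁} {F₂ : PolyDiagram I₂ J₂} {F₃ : PolyDiagram I₃ J₃}
    (d : SqDiagram u v F₁ F₂) (e : SqDiagram u' v' F₂ F₃) :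
    (d.comp e).square = vcompSquare d.square e.square := by
  let X := Over.mk F₁.s
  have hm : (vcompSquare d.square e.square).map X = d.domMap X ≫ e.domMap ((Over.map u).obj X) ≫
      F₃.mapDom ((Over.mapComp u u').inv.app X) := vcompSquare_app _ _ _
  refine (d.comp e).square_eq _ ?_ fun z b h h' => ?_
  · change (genElt F₁ ≫ (vcompSquare d.square e.square).map X) ≫ _ = _
    rw [hm, Category.assoc, Category.assoc, Category.assoc, mapDom_shape, domMap_shape,
      ← Category.assoc, ← Category.assoc, genElt_domMap_shape]
    rfl
  · have h₁ : (z ≫ d.onA) ≫ e.onA = b ≫ F₃.f := (Category.assoc _ _ _).trans h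
    have hz : (z ≫ genElt F₁ ≫ d.domMap X) ≫ F₂.shape _ = z ≫ d.onA := by
      rw [Category.assoc, genElt_domMap_shape]
    have h₂ : ((z ≫ genElt F₁ ≫ d.domMap X) ≫ e.domMap ((Over.map u).obj X)) ≫ F₃.shape _ =
        b ≫ F₃.f := by
      rw [Category.assoc, domMap_shape, ← Category.assoc, hz, h₁]
    have h₃ : ((z ≫ genElt F₁ ≫ d.domMap X) ≫ F₂.shape _) ≫ e.onA = b ≫ F₃.f := by
      rw [hz, h₁]
    have h₄ : (((z ≫ genElt F₁ ≫ d.domMap X) ≫ e.domMap ((Over.map u).obj X)) ≫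
        F₃.mapDom ((Over.mapComp u u').inv.app X)) ≫ F₃.shape _ = b ≫ F₃.f := by
      rw [Category.assoc, mapDom_shape, h₂]
    have h₅ : z ≫ d.onA = e.sel (z ≫ d.onA) b h₁ ≫ F₂.f := (e.sel_f _ _ _).symm
    have h₆ : (z ≫ genElt F₁ ≫ d.domMap X) ≫ F₂.shape _ = e.sel (z ≫ d.onA) b h₁ ≫ F₂.f :=
      hz.trans h₅
    have hev : evalAt (X := (Over.map (u ≫ u')).obj X)
          (z ≫ genElt F₁ ≫ (vcompSquare d.square e.square).map X) b h' =
        d.sel z (e.sel (z ≫ d.onA) b h₁) h₅ := by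
      refine (evalAt_congr _ (by rw [hm]; simp only [Category.assoc]) rfl).trans
        ((evalAt_mapDom F₃ ((Over.mapComp u u').inv.app X) _ b h₄ h₂).trans
          ((Category.comp_id _).trans ?_))
      refine (e.evalAt_domMap _ b h₂ h₃).trans
        ((evalAt_congr _ rfl (e.sel_congr _ hz rfl)).trans
          (d.evalAt_genElt_domMap z (e.sel (z ≫ d.onA) b h₁) h₆ h₅))
    refine Eq.trans ?_ hev.symm
    have e₁ : (d.comp e).isPullback.lift b z h.symm ≫ pullback.fst e.toB' d.toB =
        e.isPullback.lift b (z ≫ d.onA) h₁.symm := by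
      apply e.isPullback.hom_ext
      · exact (Category.assoc _ _ _).trans (((d.comp e).isPullback.lift_fst _ _ _).trans
          (e.isPullback.lift_fst _ _ _).symm)
      · have k : pullback.fst e.toB' d.toB ≫ e.toA' = (d.comp e).toA' ≫ d.onA := by
          rw [← e.comm, pullback.condition_assoc, d.isPullback.w]
          exact (Category.assoc _ _ _).symm
        exact (Category.assoc _ _ _).trans ((congrArg _ k).trans ((Category.assoc _ _ _).symm.trans
          ((congrArg (· ≫ d.onA) ((d.comp e).isPullback.lift_snd _ _ _)).trans
            (e.isPullback.lift_snd _ _ _).symm)))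
    have e₂ : (d.comp e).isPullback.lift b z h.symm ≫ pullback.snd e.toB' d.toB =
        d.isPullback.lift (e.sel (z ≫ d.onA) b h₁) z h₅.symm := by
      apply d.isPullback.hom_ext
      · refine Eq.trans ?_ (d.isPullback.lift_fst _ _ _).symm
        exact (Category.assoc _ _ _).trans ((congrArg _ pullback.condition.symm).trans
          ((Category.assoc _ _ _).symm.trans (congrArg (· ≫ e.toB') e₁)))
      · exact (Category.assoc _ _ _).trans (((d.comp e).isPullback.lift_snd _ _ _).trans
          (d.isPullback.lift_snd _ _ _).symm)
    rw [sel, sel, ← e₂]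
    exact (Category.assoc _ _ _).symm

end SqDiagram

/-- The values of a square at the generic element lie in the right fibres: this is where the
strength enters, through the tensor with `A'`. -/
theorem StrongSquare.evalAt_genElt_map_f (σ : StrongSquare u v F'.ext F.ext) {Z : E}
    (z : Z ⟶ F'.A) (b : Z ⟶ F.B) (h : (z ≫ genElt F' ≫ σ.map _) ≫ F.shape _ = b ≫ F.f) :
    (evalAt (X := (Over.map u).obj (Over.mk F'.s)) (z ≫ genElt F' ≫ σ.map _) b h : Z ⟶ F'.B) ≫
      F'.f = z := by
  let X : Over I' := Over.mk F'.s
  let a : F'.A ⟶ F'.A := 𝟙 F'.A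
  let w := famElt a ≫ σ.map (fibre a)
  let p := prod.lift (𝟙 F'.A) (a ≫ genElt F' ≫ σ.map X)
  have e : w ≫ F.mapDom ((Over.map u).map (fibreIncl a)) =
      p ≫ F.strDom F'.A ((Over.map u).obj X) ≫ F.mapDom (sumTens u F'.A X) := σ.famElt_map a
  have hp : (z ≫ p) ≫ prod.snd = z ≫ genElt F' ≫ σ.map X := by
    rw [Category.assoc, prod.lift_snd, Category.id_comp]
  have hp' : (z ≫ p) ≫ prod.fst = z := by
    rw [Category.assoc, prod.lift_fst, Category.comp_id]
  have h₁ : ((z ≫ p) ≫ prod.snd) ≫ F.shape ((Over.map u).obj X) = b ≫ F.f := by rw [hp, h]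
  have h₂ : ((z ≫ p) ≫ F.strDom F'.A ((Over.map u).obj X)) ≫ F.shape _ = b ≫ F.f := by
    rw [← h₁]; simp only [Category.assoc, strDom_shape]
  have h₃ : (((z ≫ p) ≫ F.strDom F'.A ((Over.map u).obj X)) ≫ F.mapDom (sumTens u F'.A X)) ≫
      F.shape _ = b ≫ F.f := by
    rw [Category.assoc, mapDom_shape, h₂]
  have e' : (z ≫ w) ≫ F.mapDom ((Over.map u).map (fibreIncl a)) =
      ((z ≫ p) ≫ F.strDom F'.A ((Over.map u).obj X)) ≫ F.mapDom (sumTens u F'.A X) := by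
    rw [Category.assoc, e]; simp only [Category.assoc]
  have h₄ : ((z ≫ w) ≫ F.mapDom ((Over.map u).map (fibreIncl a))) ≫ F.shape _ = b ≫ F.f := by
    rw [e', h₃]
  have h₅ : (z ≫ w) ≫ F.shape ((Over.map u).obj (fibre a)) = b ≫ F.f := by
    rw [← h₄, Category.assoc _ (F.mapDom _), mapDom_shape]
  -- the value of `σ` at the tautological family: a pair `(a', b')` with `f' b' = a'`
  let x : Z ⟶ pullback a F'.f := evalAt (X := (Over.map u).obj (fibre a)) (z ≫ w) b h₅
  -- strength forces `a' = z`, since it carries the tensor factor along unchanged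
  have k : x ≫ prod.lift (pullback.fst a F'.f) (pullback.snd a F'.f) =
      prod.lift z (evalAt (X := (Over.map u).obj X) (z ≫ genElt F' ≫ σ.map X) b h) :=
    calc x ≫ prod.lift (pullback.fst a F'.f) (pullback.snd a F'.f)
        = evalAt ((z ≫ w) ≫ F.mapDom ((Over.map u).map (fibreIncl a))) b h₄ :=
          (evalAt_mapDom F ((Over.map u).map (fibreIncl a)) (z ≫ w) b h₄ h₅).symm
      _ = evalAt (((z ≫ p) ≫ F.strDom F'.A ((Over.map u).obj X)) ≫
            F.mapDom (sumTens u F'.A X)) b h₃ := evalAt_congr _ e' rfl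
      _ = evalAt ((z ≫ p) ≫ F.strDom F'.A ((Over.map u).obj X)) b h₂ :=
          (evalAt_mapDom F (sumTens u F'.A X) _ b h₃ h₂).trans (Category.comp_id _)
      _ = _ := (evalAt_strDom F (z ≫ p) b h₂ h₁).trans
          (congrArg₂ prod.lift hp' (evalAt_congr _ hp rfl))
  have k₁ : x ≫ pullback.fst a F'.f = z := by
    have := congrArg (· ≫ prod.fst) k
    simp only [Category.assoc] at this
    rw [prod.lift_fst] at this
    exact this.trans (prod.lift_fst _ _)
  have k₂ : x ≫ pullback.snd a F'.f =
      evalAt (X := (Over.map u).obj X) (z ≫ genElt F' ≫ σ.map X) b h := by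
    have := congrArg (· ≫ prod.snd) k
    simp only [Category.assoc] at this
    rw [prod.lift_snd] at this
    exact this.trans (prod.lift_snd _ _)
  rw [← k₂]
  refine (Category.assoc _ _ _).trans ((congrArg _ pullback.condition.symm).trans ?_)
  exact (congrArg (x ≫ ·) (Category.comp_id _)).trans k₁

/-- The diagram representing a square, read off from its value at the generic element. -/
def StrongSquare.diagram (σ : StrongSquare u v F'.ext F.ext) : SqDiagram u v F' F :=
  let y : F'.A ⟶ F.dom ((Over.map u).obj (Over.mk F'.s)) := genElt F' ≫ σ.map (Over.mk F'.s)
  let a : F'.A ⟶ F.A := y ≫ F.shape _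
  have h : (pullback.snd F.f a ≫ y) ≫ F.shape _ = pullback.fst F.f a ≫ F.f :=
    (Category.assoc _ _ _).trans pullback.condition.symm
  { D := pullback F.f a
    toB' := evalAt (X := (Over.map u).obj (Over.mk F'.s)) (pullback.snd F.f a ≫ y)
      (pullback.fst F.f a) h
    toA' := pullback.snd F.f a
    toB := pullback.fst F.f a
    onA := a
    isPullback := IsPullback.of_hasPullback _ _
    comm := σ.evalAt_genElt_map_f _ _ h
    comm_left := evalAt_hom (X := (Over.map u).obj (Over.mk F'.s)) _ _ _
    comm_right := by
      have := σ.map_shape (Over.mk F'.s)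
      simp only [a, y, Category.assoc]
      rw [this, ← Category.assoc, genElt_shape, Category.id_comp] }

theorem StrongSquare.diagram_square (σ : StrongSquare u v F'.ext F.ext) : σ.diagram.square = σ := by
  refine σ.diagram.square_eq σ rfl fun z b h h' => ?_
  refine (comp_evalAt (X := (Over.map u).obj (Over.mk F'.s)) _ _ _ _).trans (evalAt_congr _ ?_ ?_)
  · exact (Category.assoc _ _ _).symm.trans
      (congrArg (· ≫ genElt F' ≫ σ.map (Over.mk F'.s)) (σ.diagram.isPullback.lift_snd _ _ _))
  · exact σ.diagram.isPullback.lift_fst _ _ _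

end

section

/-! ### Cartesian squares -/

theorem isPullback_left_iff {C : Type u} [Category.{v} C] [HasPullbacks C] {J : C}
    {W X Y Z : Over J} {f : W ⟶ X} {g : W ⟶ Y} {h : X ⟶ Z} {k : Y ⟶ Z} :
    IsPullback f g h k ↔ IsPullback f.left g.left h.left k.left := by
  constructor
  · intro H
    exact H.map (Over.forget J)
  · intro H
    refine IsPullback.of_map (Over.forget J) ?_ H
    ext
    exact H.w

section

variable {E : Type u} [Category.{v} E] [HasFiniteLimits E]

theorem isCartesianSquare_iff {I' J' I J : E} {u : I' ⟶ I} {v : J' ⟶ J}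
    {P' : StrongFunctor I' J'} {P : StrongFunctor I J} (σ : StrongSquare u v P' P) :
    IsCartesianSquare σ ↔ ∀ {X Y : Over I'} (f : X ⟶ Y),
      IsPullback (P'.functor.map f).left (σ.nat.app X).left (σ.nat.app Y).left
        (P.functor.map ((Over.map u).map f)).left :=
  ⟨fun h _ _ f => isPullback_left_iff.1 (h f), fun h _ _ f => isPullback_left_iff.2 (h f)⟩

theorem IsEqToHom.isIso {C : Type u} [Category.{v} C] {X Y : C} {f : X ⟶ Y} (h : IsEqToHom f) :
    IsIso f := by
  obtain ⟨rfl, rfl⟩ := h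
  exact inferInstanceAs (IsIso (𝟙 _))

theorem StrongSquare.IsStructural.isCartesian {I' J' I J : E} {u : I' ⟶ I} {v : J' ⟶ J}
    {P' : StrongFunctor I' J'} {P : StrongFunctor I J} {σ : StrongSquare u v P' P}
    (h : σ.IsStructural) : IsCartesianSquare σ := by
  have := fun X => (h X).isIso
  have : IsIso σ.nat := NatIso.isIso_of_isIso_app _
  exact NatTrans.Equifibered.of_isIso _

theorem assocInvSquare_isStructural {I J K L : E} (M : StrongFunctor I J) (N : StrongFunctor J K)
    (P : StrongFunctor K L) : (assocInvSquare M N P).IsStructural :=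
  globSquare_isStructural _ _ fun _ => IsEqToHom.id _

theorem leftUnitInvSquare_isStructural {I J : E} (M : StrongFunctor I J) :
    (leftUnitInvSquare M).IsStructural :=
  globSquare_isStructural _ _ fun _ => IsEqToHom.id _

theorem rightUnitInvSquare_isStructural {I J : E} (M : StrongFunctor I J) :
    (rightUnitInvSquare M).IsStructural :=
  globSquare_isStructural _ _ fun _ => IsEqToHom.id _

theorem isPullback_map_mapComp_inv {I₁ I₂ I₃ J : E} (N : StrongFunctor I₃ J) (u : I₁ ⟶ I₂)
    (u' : I₂ ⟶ I₃) {X Y : Over I₁} (f : X ⟶ Y) :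
    IsPullback (N.functor.map ((Over.map u').map ((Over.map u).map f))).left
      (N.functor.map ((Over.mapComp u u').inv.app X)).left
      (N.functor.map ((Over.mapComp u u').inv.app Y)).left
      (N.functor.map ((Over.map (u ≫ u')).map f)).left := by
  refine isPullback_left_iff.1 (IsPullback.of_vert_isIso ⟨?_⟩)
  rw [← Functor.map_comp, ← Functor.map_comp]
  congr 1
  ext
  simp

theorem isCartesian_vcompSquare {I₁ J₁ I₂ J₂ I₃ J₃ : E} {u : I₁ ⟶ I₂} {v : J₁ ⟶ J₂}
    {u' : I₂ ⟶ I₃} {v' : J₂ ⟶ J₃} {L : StrongFunctor I₁ J₁} {M : StrongFunctor I₂ J₂}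
    {N : StrongFunctor I₃ J₃} {σ : StrongSquare u v L M} {τ : StrongSquare u' v' M N}
    (hσ : IsCartesianSquare σ) (hτ : IsCartesianSquare τ) :
    IsCartesianSquare (vcompSquare σ τ) := by
  refine (isCartesianSquare_iff _).2 fun {X Y} f => ?_
  have := ((isCartesianSquare_iff _).1 hσ f).paste_vert
    (((isCartesianSquare_iff _).1 hτ ((Over.map u).map f)).paste_vert
      (isPullback_map_mapComp_inv N u u' f))
  rw [vcompSquare_app, vcompSquare_app]
  exact this

end

variable {E : Type u} [Category.{v} E] [HasFiniteLimits E] [IsLCC E]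

/-- Extensions preserve pullbacks, because `s^*` and `Π_f` are right adjoints and `Σ_t` does not
change domains. -/
theorem ext_map_isPullback {I J : E} (F : PolyDiagram I J) {W X Y Z : Over I} {f : W ⟶ X}
    {g : W ⟶ Y} {h : X ⟶ Z} {k : Y ⟶ Z} (H : IsPullback f g h k) :
    IsPullback (F.mapDom f) (F.mapDom g) (F.mapDom h) (F.mapDom k) := by
  have : PreservesLimitsOfSize.{0, 0} (Over.pullback F.s) :=
    (Over.mapPullbackAdj F.s).rightAdjoint_preservesLimits
  have : PreservesLimitsOfSize.{0, 0} (dprod F.f) :=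
    (dprodAdj F.f).rightAdjoint_preservesLimits
  exact isPullback_left_iff.1 ((H.map (Over.pullback F.s)).map (dprod F.f))

theorem IsPolyFunctor.map_isPullback {I J : E} {P : StrongFunctor I J} (hP : IsPolyFunctor P)
    {W X Y Z : Over I} {f : W ⟶ X} {g : W ⟶ Y} {h : X ⟶ Z} {k : Y ⟶ Z}
    (H : IsPullback f g h k) : IsPullback (P.functor.map f) (P.functor.map g) (P.functor.map h)
      (P.functor.map k) := by
  obtain ⟨F, e, -⟩ := hP
  have H' : IsPullback (F.ext.functor.map f) (F.ext.functor.map g) (F.ext.functor.map h)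
    (F.ext.functor.map k) := isPullback_left_iff.2 (ext_map_isPullback F H)
  exact H'.of_iso (e.app _) (e.app _) (e.app _) (e.app _) (e.hom.naturality _)
    (e.hom.naturality _) (e.hom.naturality _) (e.hom.naturality _)

theorem isCartesian_hcompSquare {I' J' K' I J K : E} {u : I' ⟶ I} {v : J' ⟶ J} {w : K' ⟶ K}
    {M' : StrongFunctor I' J'} {N' : StrongFunctor J' K'} {M : StrongFunctor I J}
    {N : StrongFunctor J K} {σ : StrongSquare u v M' M} {τ : StrongSquare v w N' N}
    (hN : IsPolyFunctor N) (hσ : IsCartesianSquare σ) (hτ : IsCartesianSquare τ) :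
    IsCartesianSquare (hcompSquare σ τ) := by
  refine (isCartesianSquare_iff _).2 fun {X Y} f => ?_
  have := ((isCartesianSquare_iff _).1 hτ (M'.functor.map f)).paste_vert
    (isPullback_left_iff.1 (hN.map_isPullback (hσ f)))
  rw [hcompSquare_app, hcompSquare_app]
  exact this

variable (E) in
/-- Polynomial functors and strong natural transformations form a double category. -/
theorem polyFun_isSub :
    (strongDouble E).IsSub (fun P => IsPolyFunctor P) (fun _ => True) where
  hid I := isPolyFunctor_id I
  hcomp _ _ hM hN := hM.comp hN
  vid _ _ := trivial
  vcomp _ _ _ _ _ _ _ := trivial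
  hidSq _ := trivial
  hcompSq _ _ _ _ _ _ _ _ := trivial
  assoc _ _ _ _ _ _ := trivial
  assocInv _ _ _ _ _ _ := trivial
  leftUnit _ _ := trivial
  leftUnitInv _ _ := trivial
  rightUnit _ _ := trivial
  rightUnitInv _ _ := trivial

variable (E) in
/-- Polynomial functors and cartesian strong natural transformations form a double category. -/
theorem polyFun_isSub_cartesian :
    (strongDouble E).IsSub (fun P => IsPolyFunctor P) (fun σ => IsCartesianSquare σ) where
  hid I := isPolyFunctor_id I
  hcomp _ _ hM hN := hM.comp hN
  vid M _ := (vidSquare_isStructural M).isCartesian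
  vcomp _ _ _ _ _ hσ hτ := isCartesian_vcompSquare hσ hτ
  hidSq _ := StrongSquare.IsStructural.isCartesian fun _ => IsEqToHom.id _
  hcompSq _ _ _ _ _ hN hσ hτ := isCartesian_hcompSquare hN hσ hτ
  assoc M N P _ _ _ := (assocSquare_isStructural M N P).isCartesian
  assocInv M N P _ _ _ := (assocInvSquare_isStructural M N P).isCartesian
  leftUnit M _ := (leftUnitSquare_isStructural M).isCartesian
  leftUnitInv M _ := (leftUnitInvSquare_isStructural M).isCartesian
  rightUnit M _ := (rightUnitSquare_isStructural M).isCartesian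
  rightUnitInv M _ := (rightUnitInvSquare_isStructural M).isCartesian

/-! ### Cartesian diagrams -/

variable {I' J' I J : E} {u : I' ⟶ I} {v : J' ⟶ J} {F' : PolyDiagram I' J'} {F : PolyDiagram I J}

namespace CartDiagram

variable (d : CartDiagram u v F' F)

/-- The square of a cartesian diagram does not change values, up to the map `B' ⟶ B`. -/
theorem evalAt_domMap {Z : E} {X : Over I'} (y : Z ⟶ F'.dom X) (b : Z ⟶ F'.B)
    (h : (y ≫ d.toSqDiagram.domMap X) ≫ F.shape _ = (b ≫ d.onB) ≫ F.f)
    (h' : y ≫ F'.shape X = b ≫ F'.f) :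
    evalAt (X := (Over.map u).obj X) (y ≫ d.toSqDiagram.domMap X) (b ≫ d.onB) h =
      evalAt y b h' := by
  have k : (y ≫ F'.shape X) ≫ d.onA = (b ≫ d.onB) ≫ F.f := by
    rw [h', Category.assoc, Category.assoc, d.isPullback.w]
  refine (d.toSqDiagram.evalAt_domMap y (b ≫ d.onB) h k).trans (evalAt_congr _ rfl ?_)
  refine (Category.comp_id _).trans ?_
  apply d.isPullback.hom_ext
  · exact d.isPullback.lift_fst _ _ _
  · exact (d.isPullback.lift_snd _ _ _).trans h'

/-- When `D ⟶ B'` is invertible, an element of `P'` is recovered from its shape and the values of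
its image under the square, since every position of the source is selected. -/
theorem square_isCartesian : IsCartesianSquare d.square := by
  refine (isCartesianSquare_iff _).2 fun {X Y} g => ?_
  let D := d.toSqDiagram
  have hw : F'.mapDom g ≫ D.domMap Y = D.domMap X ≫ F.mapDom ((Over.map u).map g) :=
    nat_left d.square.nat g
  -- elements of the pullback have, at `b'`, the value of the second component at `onB b'`
  refine IsPullback.of_isLimit' ⟨hw⟩ (PullbackCone.isLimitAux' _ fun c => ?_)
  let p : c.pt ⟶ F'.dom Y := c.fst
  let q : c.pt ⟶ F.dom ((Over.map u).obj X) := c.snd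
  have hpq : p ≫ D.domMap Y = q ≫ F.mapDom ((Over.map u).map g) := c.condition
  have hs : q ≫ F.shape _ = (p ≫ F'.shape Y) ≫ d.onA := by
    rw [Category.assoc]
    refine Eq.trans ?_ (congrArg (p ≫ ·) (D.domMap_shape Y))
    rw [← Category.assoc, hpq, Category.assoc, mapDom_shape]
  have hv {Z : E} (z : Z ⟶ c.pt) (b : Z ⟶ F'.B) (h : z ≫ p ≫ F'.shape Y = b ≫ F'.f) :
      (z ≫ q) ≫ F.shape _ = (b ≫ d.onB) ≫ F.f := by
    rw [Category.assoc, hs, ← Category.assoc, h, Category.assoc, Category.assoc, d.isPullback.w]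
  have hg {Z : E} (z : Z ⟶ c.pt) (b : Z ⟶ F'.B) (h : z ≫ p ≫ F'.shape Y = b ≫ F'.f)
      (h' : (z ≫ p) ≫ F'.shape Y = b ≫ F'.f) :
      (evalAt (X := (Over.map u).obj X) (z ≫ q) (b ≫ d.onB) (hv z b h) : Z ⟶ X.left) ≫ g.left =
        evalAt (z ≫ p) b h' := by
    have h₁ : ((z ≫ q) ≫ F.mapDom ((Over.map u).map g)) ≫ F.shape _ = (b ≫ d.onB) ≫ F.f := by
      rw [Category.assoc, mapDom_shape, hv z b h]
    have e : (z ≫ q) ≫ F.mapDom ((Over.map u).map g) = (z ≫ p) ≫ D.domMap Y := by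
      rw [Category.assoc, ← hpq, Category.assoc]
    exact (evalAt_mapDom F ((Over.map u).map g) (z ≫ q) (b ≫ d.onB) h₁ (hv z b h)).symm.trans
      ((evalAt_congr _ e rfl).trans (d.evalAt_domMap (z ≫ p) b (by rw [← e, h₁]) h'))
  have c₀ : pullback.fst (p ≫ F'.shape Y) F'.f ≫ p ≫ F'.shape Y =
    pullback.snd (p ≫ F'.shape Y) F'.f ≫ F'.f := pullback.condition
  let φ : pullback (p ≫ F'.shape Y) F'.f ⟶ X.left :=
    evalAt (X := (Over.map u).obj X) (pullback.fst (p ≫ F'.shape Y) F'.f ≫ q)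
      (pullback.snd (p ≫ F'.shape Y) F'.f ≫ d.onB) (hv _ _ c₀)
  have hφ : φ ≫ X.hom = pullback.snd (p ≫ F'.shape Y) F'.f ≫ F'.s := by
    rw [← Over.w g, ← Category.assoc, hg _ _ c₀ ((Category.assoc _ _ _).trans c₀), evalAt_hom]
  let l : c.pt ⟶ F'.dom X := lam (p ≫ F'.shape Y) φ hφ
  have hls : l ≫ F'.shape X = p ≫ F'.shape Y := lam_shape _ _ _
  have hl {Z : E} (z : Z ⟶ c.pt) (b : Z ⟶ F'.B) (h : z ≫ p ≫ F'.shape Y = b ≫ F'.f)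
      (h' : (z ≫ l) ≫ F'.shape X = b ≫ F'.f) :
      evalAt (z ≫ l) b h' =
        evalAt (X := (Over.map u).obj X) (z ≫ q) (b ≫ d.onB) (hv z b h) := by
    refine (evalAt_lam _ _ _ z b h' h).trans ?_
    refine (comp_evalAt (X := (Over.map u).obj X) _ _ _ _).trans (evalAt_congr _ ?_ ?_)
    · rw [pullback.lift_fst_assoc]
    · rw [pullback.lift_snd_assoc]
  have huniq (m : c.pt ⟶ F'.dom X) (hm₁ : m ≫ F'.mapDom g = p) (hm₂ : m ≫ D.domMap X = q) :
      m = l := by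
    have hms : m ≫ F'.shape X = l ≫ F'.shape X := by
      rw [hls, ← hm₁, Category.assoc, mapDom_shape]
    refine dom_ext hms fun {Z} z b hb => ?_
    have k₁ : z ≫ p ≫ F'.shape Y = b ≫ F'.f := by
      rw [← hb, ← hls, ← hms, Category.assoc]
    have k₂ : ((z ≫ m) ≫ D.domMap X) ≫ F.shape _ = (b ≫ d.onB) ≫ F.f := by
      rw [Category.assoc z, hm₂, hv z b k₁]
    refine (d.evalAt_domMap (z ≫ m) b k₂ hb).symm.trans (Eq.trans ?_ (hl z b k₁ _).symm)
    exact evalAt_congr _ ((Category.assoc _ _ _).trans (congrArg (z ≫ ·) hm₂)) rfl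
  refine ⟨l, dom_ext ?_ fun {Z} z b hb => ?_, dom_ext ?_ fun {Z} z b hb => ?_,
    fun {m} h₁ h₂ => huniq m h₁ h₂⟩
  · change (l ≫ F'.mapDom g) ≫ F'.shape Y = p ≫ F'.shape Y
    rw [Category.assoc, mapDom_shape, hls]
  · change (z ≫ l ≫ F'.mapDom g) ≫ F'.shape Y = b ≫ F'.f at hb
    change evalAt (z ≫ l ≫ F'.mapDom g) b hb = evalAt (z ≫ p) b _
    have k₁ : (z ≫ l) ≫ F'.shape X = b ≫ F'.f := by
      rw [← hb]; simp only [Category.assoc, mapDom_shape]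
    have k₂ : z ≫ p ≫ F'.shape Y = b ≫ F'.f := by rw [← hls, ← k₁, Category.assoc]
    have k₃ : ((z ≫ l) ≫ F'.mapDom g) ≫ F'.shape Y = b ≫ F'.f := by rw [← hb, Category.assoc z]
    refine (evalAt_congr _ (Category.assoc _ _ _).symm rfl).trans
      ((evalAt_mapDom F' g (z ≫ l) b k₃ k₁).trans ?_)
    rw [hl z b k₂ k₁]
    exact hg z b k₂ _
  · change (l ≫ D.domMap X) ≫ F.shape _ = q ≫ F.shape _
    rw [Category.assoc, D.domMap_shape, ← Category.assoc, hls, hs]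
    rfl
  · change (z ≫ l ≫ D.domMap X) ≫ F.shape _ = b ≫ F.f at hb
    change evalAt (X := (Over.map u).obj X) (z ≫ l ≫ D.domMap X) b hb =
      evalAt (X := (Over.map u).obj X) (z ≫ q) b _
    have k₁ : (z ≫ l) ≫ F'.shape X ≫ d.onA = b ≫ F.f := by
      rw [← hb, Category.assoc z (l ≫ _), Category.assoc l, D.domMap_shape, Category.assoc]
      rfl
    have k₂ : b ≫ F.f = (z ≫ p ≫ F'.shape Y) ≫ d.onA := by
      rw [← k₁, ← hls]; simp only [Category.assoc]
    let b' : Z ⟶ F'.B := d.isPullback.lift b (z ≫ p ≫ F'.shape Y) k₂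
    have e₁ : b' ≫ d.onB = b := d.isPullback.lift_fst _ _ _
    have e₂ : b' ≫ F'.f = z ≫ p ≫ F'.shape Y := d.isPullback.lift_snd _ _ _
    have k₃ : (z ≫ l) ≫ F'.shape X = b' ≫ F'.f := by rw [e₂, Category.assoc, hls]
    have k₄ : ((z ≫ l) ≫ D.domMap X) ≫ F.shape _ = (b' ≫ d.onB) ≫ F.f := by
      rw [e₁, ← hb, Category.assoc z]
    refine (evalAt_congr _ (Category.assoc _ _ _).symm e₁.symm).trans
      ((d.evalAt_domMap (z ≫ l) b' k₄ k₃).trans ((hl z b' e₂.symm k₃).trans ?_))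
    exact evalAt_congr _ rfl e₁

theorem ext_of_square_eq {d e : CartDiagram u v F' F} (h : d.square = e.square) : d = e := by
  obtain ⟨hA, i, h₁, h₂⟩ := (SqDiagram.square_eq_square_iff _ _).1 h
  have hB : d.onB = e.onB := by
    have hi : i.hom = 𝟙 _ := (Category.comp_id _).symm.trans h₁
    have := h₂.symm
    rw [hi] at this
    exact this.trans (Category.id_comp _)
  cases d; cases e
  cases hA; cases hB
  rfl

theorem comp_square {I₁ J₁ I₂ J₂ I₃ J₃ : E} {u : I₁ ⟶ I₂} {v : J₁ ⟶ J₂} {u' : I₂ ⟶ I₃}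
    {v' : J₂ ⟶ J₃} {F₁ : PolyDiagram I₁ J₁} {F₂ : PolyDiagram I₂ J₂} {F₃ : PolyDiagram I₃ J₃}
    (d : CartDiagram u v F₁ F₂) (e : CartDiagram u' v' F₂ F₃) :
    (d.comp e).square = vcompSquare d.square e.square := by
  refine Eq.trans ?_ (SqDiagram.comp_square d.toSqDiagram e.toSqDiagram)
  refine (SqDiagram.square_eq_square_iff _ _).2 ⟨rfl, ?_⟩
  have h₀ : d.onB ≫ 𝟙 F₂.B = 𝟙 F₁.B ≫ d.onB := by rw [Category.comp_id, Category.id_comp]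
  let i : F₁.B ≅ pullback (𝟙 F₂.B) d.onB :=
    { hom := pullback.lift d.onB (𝟙 F₁.B) h₀
      inv := pullback.snd (𝟙 F₂.B) d.onB
      hom_inv_id := pullback.lift_snd _ _ _
      inv_hom_id := by
        apply pullback.hom_ext
        · rw [Category.assoc, pullback.lift_fst, ← pullback.condition, Category.comp_id,
            Category.id_comp]
        · rw [Category.assoc, pullback.lift_snd, Category.comp_id, Category.id_comp] }
  refine ⟨i, ?_, ?_⟩
  · exact (pullback.lift_snd_assoc _ _ _ _).trans (Category.comp_id _)
  · exact pullback.lift_fst_assoc _ _ _ _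

end CartDiagram

/-- If the square of a diagram is cartesian, then the map `D ⟶ B'` is invertible: its inverse comes
from lifting the generic element along the naturality square at `D ⟶ B'` over `I'`. -/
theorem SqDiagram.exists_inverse_toB' (d : SqDiagram u v F' F) (h : IsCartesianSquare d.square) :
    ∃ s : F'.B ⟶ d.D, s ≫ d.toB' = 𝟙 F'.B ∧ d.toB' ≫ s = 𝟙 d.D := by
  let X : Over I' := Over.mk F'.s
  let Y : Over I' := Over.mk (d.toB' ≫ F'.s)
  let g : Y ⟶ X := Over.homMk d.toB' rfl
  have hp : IsPullback (F'.mapDom g) (d.domMap Y) (d.domMap X) (F.mapDom ((Over.map u).map g)) :=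
    (isCartesianSquare_iff _).1 h g
  let φ : pullback d.onA F.f ⟶ d.D := d.isPullback.lift (pullback.snd d.onA F.f)
    (pullback.fst d.onA F.f) pullback.condition.symm
  have hφ : φ ≫ ((Over.map u).obj Y).hom = pullback.snd d.onA F.f ≫ F.s := by
    change φ ≫ (d.toB' ≫ F'.s) ≫ u = _
    rw [Category.assoc, d.comm_left, d.isPullback.lift_fst_assoc]
  let q : F'.A ⟶ F.dom ((Over.map u).obj Y) := lam (X := (Over.map u).obj Y) d.onA φ hφ
  have hqs : q ≫ F.shape _ = d.onA := lam_shape _ _ _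
  have hq {Z : E} (z : Z ⟶ F'.A) (b : Z ⟶ F.B) (h : (z ≫ q) ≫ F.shape _ = b ≫ F.f)
      (h' : z ≫ d.onA = b ≫ F.f) : evalAt (X := (Over.map u).obj Y) (z ≫ q) b h =
        d.isPullback.lift b z h'.symm := by
    refine (evalAt_lam (X := (Over.map u).obj Y) _ _ _ z b h h').trans ?_
    apply d.isPullback.hom_ext
    · rw [Category.assoc, d.isPullback.lift_fst, d.isPullback.lift_fst, pullback.lift_snd]
    · rw [Category.assoc, d.isPullback.lift_snd, d.isPullback.lift_snd, pullback.lift_fst]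
  have hpq : genElt F' ≫ d.domMap X = q ≫ F.mapDom ((Over.map u).map g) := by
    refine dom_ext (by rw [genElt_domMap_shape, Category.assoc, mapDom_shape, hqs])
      fun {Z} z b hb => ?_
    have k₁ : z ≫ d.onA = b ≫ F.f := by
      rw [← hb, Category.assoc z, genElt_domMap_shape]
    have k₂ : (z ≫ q) ≫ F.shape _ = b ≫ F.f := by rw [Category.assoc, hqs, k₁]
    have k₃ : ((z ≫ q) ≫ F.mapDom ((Over.map u).map g)) ≫ F.shape _ = b ≫ F.f := by
      rw [Category.assoc, mapDom_shape, k₂]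
    refine (d.evalAt_genElt_domMap z b hb k₁).trans (Eq.trans ?_
      (evalAt_congr k₃ (Category.assoc _ _ _) rfl))
    refine Eq.trans ?_ (evalAt_mapDom F ((Over.map u).map g) (z ≫ q) b k₃ k₂).symm
    exact congrArg (· ≫ d.toB') (hq z b k₂ k₁).symm
  let m : F'.A ⟶ F'.dom Y := hp.lift (genElt F') q hpq
  have hm₁ : m ≫ F'.mapDom g = genElt F' := hp.lift_fst _ _ _
  have hm₂ : m ≫ d.domMap Y = q := hp.lift_snd _ _ _
  have hms : m ≫ F'.shape Y = 𝟙 F'.A := by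
    rw [← genElt_shape F', ← hm₁, Category.assoc, mapDom_shape]
  have hs {Z : E} (z : Z ⟶ F'.A) (b : Z ⟶ F'.B) (h : z = b ≫ F'.f) :
      (z ≫ m) ≫ F'.shape Y = b ≫ F'.f := by rw [Category.assoc, hms, Category.comp_id, h]
  let s : F'.B ⟶ d.D := evalAt (X := Y) (F'.f ≫ m) (𝟙 F'.B) (hs _ _ (Category.id_comp _).symm)
  refine ⟨s, ?_, ?_⟩
  · have k₁ : ((F'.f ≫ m) ≫ F'.mapDom g) ≫ F'.shape X = 𝟙 F'.B ≫ F'.f := by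
      rw [Category.assoc, mapDom_shape, hs _ _ (Category.id_comp _).symm]
    have k₂ : (F'.f ≫ genElt F') ≫ F'.shape X = 𝟙 F'.B ≫ F'.f := by
      rw [← hm₁, ← Category.assoc F'.f, k₁]
    refine (evalAt_mapDom F' g (F'.f ≫ m) (𝟙 F'.B) k₁ _).symm.trans ?_
    refine (evalAt_congr _ ?_ rfl).trans (evalAt_genElt F' F'.f (𝟙 F'.B) k₂)
    rw [Category.assoc, hm₁]
  · have k₀ : d.toA' ≫ d.onA = d.toB ≫ F.f := d.isPullback.w.symm
    have k₁ : ((d.toA' ≫ m) ≫ F'.shape Y) ≫ d.onA = d.toB ≫ F.f := by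
      rw [Category.assoc d.toA', hms, Category.comp_id, k₀]
    have k₂ : ((d.toA' ≫ m) ≫ d.domMap Y) ≫ F.shape _ = d.toB ≫ F.f := by
      rw [Category.assoc, domMap_shape, ← Category.assoc, k₁]
    have k₃ : (d.toA' ≫ q) ≫ F.shape _ = d.toB ≫ F.f := by rw [Category.assoc, hqs, k₀]
    have k₄ : (d.toA' ≫ m) ≫ F'.shape Y = d.toA' := by
      rw [Category.assoc, hms, Category.comp_id]
    have k₅ : (d.toA' ≫ m) ≫ F'.shape Y = d.toB' ≫ F'.f := by rw [k₄, d.comm]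
    calc d.toB' ≫ s = evalAt (X := Y) (d.toA' ≫ m) d.toB' k₅ :=
          (comp_evalAt _ _ _ _).trans (evalAt_congr _ (by rw [← Category.assoc, d.comm])
            (Category.comp_id _))
      _ = evalAt (X := Y) (d.toA' ≫ m) (d.sel ((d.toA' ≫ m) ≫ F'.shape Y) d.toB k₁)
            (d.sel_f _ _ _).symm :=
          evalAt_congr _ rfl (d.sel_toB.symm.trans (d.sel_congr _ k₄.symm rfl))
      _ = evalAt (X := (Over.map u).obj Y) ((d.toA' ≫ m) ≫ d.domMap Y) d.toB k₂ :=
          (d.evalAt_domMap (d.toA' ≫ m) d.toB k₂ k₁).symm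
      _ = evalAt (X := (Over.map u).obj Y) (d.toA' ≫ q) d.toB k₃ :=
          evalAt_congr _ (by rw [Category.assoc, hm₂]) rfl
      _ = d.isPullback.lift d.toB d.toA' k₀.symm := hq _ _ _ k₀
      _ = 𝟙 d.D := d.isPullback.hom_ext (by simp) (by simp)

theorem StrongSquare.exists_cartDiagram (σ : StrongSquare u v F'.ext F.ext)
    (h : IsCartesianSquare σ) : ∃ d : CartDiagram u v F' F, d.square = σ := by
  rw [← σ.diagram_square] at h
  let d := σ.diagram
  obtain ⟨s, h₁, h₂⟩ := d.exists_inverse_toB' h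
  let i : F'.B ≅ d.D := ⟨s, d.toB', h₁, h₂⟩
  have hA : s ≫ d.toA' = F'.f := by rw [← d.comm, reassoc_of% h₁]
  have hl : F'.s ≫ u = (s ≫ d.toB) ≫ F.s := by
    rw [Category.assoc, ← d.comm_left, reassoc_of% h₁]
  refine ⟨⟨s ≫ d.toB, d.onA, ?_, hl, d.comm_right⟩, ?_⟩
  · exact d.isPullback.of_iso i.symm (Iso.refl _) (Iso.refl _) (Iso.refl _)
      (by simp [i, reassoc_of% h₂]) (by simp [i, d.comm]) (by simp) (by simp)
  · refine Eq.trans ?_ σ.diagram_square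
    exact (SqDiagram.square_eq_square_iff _ _).2 ⟨rfl, i, h₁, rfl⟩

end

section

/-! ### Base change and cobase change -/

section

variable {E : Type u} [Category.{v} E] [HasFiniteLimits E]

theorem counit_left {I J : E} (v : I ⟶ J) (Y : Over J) :
    ((Over.mapPullbackAdj v).counit.app Y).left = pullback.fst Y.hom v := by
  simp

theorem isPullback_pullMap {I J : E} (v : I ⟶ J) {X Y : Over J} (g : X ⟶ Y) :
    IsPullback (pullMap v g) (pullback.fst X.hom v) (pullback.fst Y.hom v) g.left := by
  refine IsPullback.of_right (h₁₂ := pullback.snd Y.hom v) (h₂₂ := Y.hom) (v₁₃ := v) ?_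
    (pullMap_fst v g) (IsPullback.of_hasPullback Y.hom v).flip
  rw [pullMap_snd, Over.w]
  exact (IsPullback.of_hasPullback X.hom v).flip

theorem isPullback_unit {I J : E} (u : I ⟶ J) {X Y : Over I} (g : X ⟶ Y) :
    IsPullback g ((Over.mapPullbackAdj u).unit.app X) ((Over.mapPullbackAdj u).unit.app Y)
      ((Over.pullback u).map ((Over.map u).map g)) := by
  have h (Z : Over I) : ((Over.mapPullbackAdj u).unit.app Z).left ≫
      pullback.fst ((Over.map u).obj Z).hom u = 𝟙 Z.left := by
    rw [← counit_left]
    exact congrArg Over.Hom.left ((Over.mapPullbackAdj u).left_triangle_components Z)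
  refine isPullback_left_iff.2 (IsPullback.of_bot (v₂₁ := pullback.fst ((Over.map u).obj X).hom u)
    (v₂₂ := pullback.fst ((Over.map u).obj Y).hom u) (h₃₁ := g.left) ?_
    (congrArg Over.Hom.left ((Over.mapPullbackAdj u).unit.naturality g))
    (isPullback_pullMap u ((Over.map u).map g)))
  rw [h X, h Y]
  exact IsPullback.of_vert_isIso ⟨(Category.comp_id _).trans (Category.id_comp _).symm⟩

theorem isCartesian_baseChangeSquare {I' J' I J : E} (u : I' ⟶ I) (v : J' ⟶ J)
    (P : StrongFunctor I J) : IsCartesianSquare (baseChangeSquare u v P) := by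
  refine (isCartesianSquare_iff _).2 fun {X Y} f => ?_
  have := isPullback_pullMap v (P.functor.map ((Over.map u).map f))
  rw [← counit_left, ← counit_left] at this
  exact this

/-- Cancellation for cartesian squares. -/
theorem isCartesian_of_vcompSquare {I₁ J₁ I₂ J₂ I₃ J₃ : E} {u : I₁ ⟶ I₂} {v : J₁ ⟶ J₂}
    {u' : I₂ ⟶ I₃} {v' : J₂ ⟶ J₃} {L : StrongFunctor I₁ J₁} {M : StrongFunctor I₂ J₂}
    {N : StrongFunctor I₃ J₃} {σ : StrongSquare u v L M} {τ : StrongSquare u' v' M N}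
    (hτ : IsCartesianSquare τ) (h : IsCartesianSquare (vcompSquare σ τ)) :
    IsCartesianSquare σ := by
  refine (isCartesianSquare_iff _).2 fun {X Y} f => ?_
  have h₃ := isPullback_map_mapComp_inv N u u' f
  have h₄ := ((isCartesianSquare_iff _).1 hτ ((Over.map u).map f)).paste_vert h₃
  have h₅ := (isCartesianSquare_iff _).1 h f
  rw [vcompSquare_app, vcompSquare_app] at h₅
  exact IsPullback.of_bot h₅ (nat_left σ.nat f) h₄

section Lift

variable {I₀ J₀ I' J' I J : E} {a : I₀ ⟶ I'} {b : J₀ ⟶ J'} {u : I' ⟶ I} {v : J' ⟶ J}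
  {L : StrongFunctor I₀ J₀} {P : StrongFunctor I J} (τ : StrongSquare (a ≫ u) (b ≫ v) L P)

/-- The component `L X ⟶ P Σ_u Σ_a X` of a square `Σ_v Σ_b L ⟶ P Σ_u Σ_a`. -/
def liftFst (X : Over I₀) :
    (L.functor.obj X).left ⟶ (P.functor.obj ((Over.map u).obj ((Over.map a).obj X))).left :=
  (τ.nat.app X).left ≫ (P.functor.map ((Over.mapComp a u).hom.app X)).left

theorem liftFst_hom (X : Over I₀) :
    liftFst τ X ≫ (P.functor.obj ((Over.map u).obj ((Over.map a).obj X))).hom =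
      ((L.functor.obj X).hom ≫ b) ≫ v := by
  have h : (P.functor.map ((Over.mapComp a u).hom.app X)).left ≫
      (P.functor.obj ((Over.map u).obj ((Over.map a).obj X))).hom =
    (P.functor.obj ((Over.map (a ≫ u)).obj X)).hom := Over.w _
  rw [liftFst, Category.assoc, h, Category.assoc]
  exact Over.w (τ.nat.app X)

theorem liftFst_naturality {X Y : Over I₀} (f : X ⟶ Y) :
    (L.functor.map f).left ≫ liftFst τ Y =
      liftFst τ X ≫ (P.functor.map ((Over.map u).map ((Over.map a).map f))).left := by
  have e : (L.functor.map f).left ≫ (τ.nat.app Y).left =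
    (τ.nat.app X).left ≫ (P.functor.map ((Over.map (a ≫ u)).map f)).left := nat_left τ.nat f
  rw [liftFst, liftFst, reassoc_of% e, Category.assoc]
  congr 1
  apply map_left_comm
  simp

theorem liftFst_strength (K : E) (X : Over I₀) :
    (L.strength.app K X).left ≫ liftFst τ (tens K X) =
      prod.map (𝟙 K) (liftFst τ X) ≫
        (P.strength.app K ((Over.map u).obj ((Over.map a).obj X))).left ≫
        (P.functor.map (sumTens u K ((Over.map a).obj X))).left ≫
          (P.functor.map ((Over.map u).map (sumTens a K X))).left := by
  have h := (isStrong_iff _).1 τ.strong K X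
  rw [liftFst, liftFst, reassoc_of% h, prod_map_id_comp, Category.assoc,
    reassoc_of% (P.strength.naturality_left (𝟙 K) ((Over.mapComp a u).hom.app X))]
  congr 2
  rw [map_left_comp P.functor (sumTens u K ((Over.map a).obj X)) ((Over.map u).map (sumTens a K X))
    (_ ≫ _) rfl]
  apply map_left_comm
  simp [sumTens_left]

/-- A square over `(a ≫ u, b ≫ v)` to `P` factors through the base change of `P` along `(u, v)`:
the transpose of its components along `Σ_v ⊣ v^*`. -/
def baseChangeLift : StrongSquare a b L (baseChange u v P) where
  nat :=
    { app := fun X => Over.homMk (V := (baseChange u v P).functor.obj ((Over.map a).obj X))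
        (pullback.lift (liftFst τ X) ((L.functor.obj X).hom ≫ b) (liftFst_hom τ X))
        (pullback.lift_snd _ _ _)
      naturality := fun X Y f => by
        ext
        change (L.functor.map f).left ≫ pullback.lift (liftFst τ Y) _ (liftFst_hom τ Y) =
          pullback.lift (liftFst τ X) _ (liftFst_hom τ X) ≫
            pullMap v (P.functor.map ((Over.map u).map ((Over.map a).map f)))
        apply pullback.hom_ext
        · rw [Category.assoc, pullback.lift_fst, liftFst_naturality, Category.assoc, pullMap_fst,
            pullback.lift_fst_assoc]
        · rw [Category.assoc, pullback.lift_snd, Category.assoc, pullMap_snd, pullback.lift_snd,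
            Over.w_assoc] }
  strong := (isStrong_iff _).2 fun K X => by
    change (L.strength.app K X).left ≫
        pullback.lift (liftFst τ (tens K X)) _ (liftFst_hom τ (tens K X)) =
      prod.map (𝟙 K) (pullback.lift (liftFst τ X) _ (liftFst_hom τ X)) ≫
        (pullStrength v K (P.functor.obj ((Over.map u).obj ((Over.map a).obj X))) ≫
          pullMap v (P.strength.app K ((Over.map u).obj ((Over.map a).obj X)) ≫
            P.functor.map (sumTens u K ((Over.map a).obj X)))) ≫
        pullMap v (P.functor.map ((Over.map u).map (sumTens a K X)))
    apply pullback.hom_ext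
    · rw [Category.assoc, pullback.lift_fst, liftFst_strength, Category.assoc, Category.assoc,
        Category.assoc, pullMap_fst, reassoc_of% (pullMap_fst v), reassoc_of% (pullStrength_fst v),
        ← reassoc_of% (prod_map_id_comp K), pullback.lift_fst, Over.comp_left, Category.assoc]
    · rw [Category.assoc, pullback.lift_snd, Category.assoc, Category.assoc, Category.assoc,
        pullMap_snd, pullMap_snd, pullStrength_snd, prod.map_snd_assoc, pullback.lift_snd,
        Over.w_assoc]
      exact Category.assoc _ _ _

/-- The universal property of the base change square. -/
theorem vcompSquare_baseChangeSquare_eq_iff (χ : StrongSquare a b L (baseChange u v P)) :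
    vcompSquare χ (baseChangeSquare u v P) = τ ↔ χ = baseChangeLift τ := by
  have key (X : Over I₀) : ((vcompSquare χ (baseChangeSquare u v P)).nat.app X).left =
      ((χ.nat.app X).left ≫ pullback.fst
        (P.functor.obj ((Over.map u).obj ((Over.map a).obj X))).hom v) ≫
        (P.functor.map ((Over.mapComp a u).inv.app X)).left := by
    rw [vcompSquare_app, ← counit_left]
    exact (Category.assoc _ _ _).symm
  have hi (X : Over I₀) : (P.functor.map ((Over.mapComp a u).inv.app X)).left ≫
      (P.functor.map ((Over.mapComp a u).hom.app X)).left = 𝟙 _ := by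
    rw [← Over.comp_left, ← Functor.map_comp, Iso.inv_hom_id_app, CategoryTheory.Functor.map_id]
    rfl
  have hi' (X : Over I₀) : (P.functor.map ((Over.mapComp a u).hom.app X)).left ≫
      (P.functor.map ((Over.mapComp a u).inv.app X)).left = 𝟙 _ := by
    rw [← Over.comp_left, ← Functor.map_comp, Iso.hom_inv_id_app, CategoryTheory.Functor.map_id]
    rfl
  constructor
  · rintro rfl
    refine StrongSquare.ext _ _ fun X => ?_
    apply pullback.hom_ext
    · refine Eq.trans ?_ (pullback.lift_fst _ _ _).symm
      rw [liftFst, key, Category.assoc, hi]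
      exact (Category.comp_id _).symm
    · exact (Over.w (χ.nat.app X)).trans (pullback.lift_snd _ _ _).symm
  · rintro rfl
    refine StrongSquare.ext _ _ fun X => ?_
    rw [key]
    refine (congrArg (· ≫ _) (pullback.lift_fst _ _ _)).trans ?_
    rw [liftFst, Category.assoc, hi']
    exact Category.comp_id _

end Lift

section Colift

variable {I' J' I J I₀ J₀ : E} {u : I' ⟶ I} {v : J' ⟶ J} {a : I ⟶ I₀} {b : J ⟶ J₀}
  {P' : StrongFunctor I' J'} {L : StrongFunctor I₀ J₀}

variable (u a) in
/-- The map `Σ_a Σ_u u^* X ⟶ Σ_a X` given by the counit of `Σ_u ⊣ u^*`. -/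
def counitMap (X : Over I) :
    (Over.map (u ≫ a)).obj ((Over.pullback u).obj X) ⟶ (Over.map a).obj X :=
  (Over.mapComp u a).hom.app ((Over.pullback u).obj X) ≫
    (Over.map a).map ((Over.mapPullbackAdj u).counit.app X)

theorem counitMap_left (X : Over I) : (counitMap u a X).left = pullback.fst X.hom u :=
  (Category.id_comp _).trans (counit_left u X)

theorem isPullback_counitMap {X Y : Over I} (f : X ⟶ Y) :
    IsPullback ((Over.map (u ≫ a)).map ((Over.pullback u).map f)) (counitMap u a X)
      (counitMap u a Y) ((Over.map a).map f) := by
  refine isPullback_left_iff.2 ?_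
  rw [counitMap_left, counitMap_left]
  exact isPullback_pullMap u f

variable (τ : StrongSquare (u ≫ a) (v ≫ b) P' L)

/-- A square over `(u ≫ a, v ≫ b)` from `P'` factors through the cobase change of `P'` along
`(u, v)`: the component at `X` is that at `u^* X`, followed by the counit of `Σ_u ⊣ u^*`. -/
def cobaseChangeDesc : StrongSquare a b (cobaseChange u v P') L where
  nat :=
    { app := fun X => Over.homMk (U := (Over.map b).obj ((cobaseChange u v P').functor.obj X))
        ((τ.nat.app ((Over.pullback u).obj X)).left ≫ (L.functor.map (counitMap u a X)).left)
        (by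
          refine (Category.assoc _ _ _).trans ((congrArg (_ ≫ ·)
            (Over.w (L.functor.map (counitMap u a X)))).trans ?_)
          exact (Over.w (τ.nat.app ((Over.pullback u).obj X))).trans (Category.assoc _ _ _).symm)
      naturality := fun X Y f => by
        ext
        have e : (P'.functor.map ((Over.pullback u).map f)).left ≫
            (τ.nat.app ((Over.pullback u).obj Y)).left =
          (τ.nat.app ((Over.pullback u).obj X)).left ≫
            (L.functor.map ((Over.map (u ≫ a)).map ((Over.pullback u).map f))).left :=
          nat_left τ.nat ((Over.pullback u).map f)
        change (P'.functor.map ((Over.pullback u).map f)).left ≫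
            (τ.nat.app ((Over.pullback u).obj Y)).left ≫ (L.functor.map (counitMap u a Y)).left =
          ((τ.nat.app ((Over.pullback u).obj X)).left ≫ (L.functor.map (counitMap u a X)).left) ≫
            (L.functor.map ((Over.map a).map f)).left
        rw [reassoc_of% e, Category.assoc]
        congr 1
        apply map_left_comm
        exact congrArg Over.Hom.left (isPullback_counitMap f).w }
  strong := (isStrong_iff _).2 fun K X => by
    let st : tens K ((Over.pullback u).obj X) ⟶ (Over.pullback u).obj (tens K X) :=
      (pullS u).strength.app K X
    have h := (isStrong_iff _).1 τ.strong K ((Over.pullback u).obj X)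
    have e : (P'.functor.map st).left ≫ (τ.nat.app ((Over.pullback u).obj (tens K X))).left =
      (τ.nat.app (tens K ((Over.pullback u).obj X))).left ≫
        (L.functor.map ((Over.map (u ≫ a)).map st)).left := nat_left τ.nat st
    change (𝟙 _ ≫ (P'.strength.app K ((Over.pullback u).obj X)).left ≫ (P'.functor.map st).left) ≫
        (τ.nat.app ((Over.pullback u).obj (tens K X))).left ≫
          (L.functor.map (counitMap u a (tens K X))).left =
      prod.map (𝟙 K) ((τ.nat.app ((Over.pullback u).obj X)).left ≫
        (L.functor.map (counitMap u a X)).left) ≫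
        (L.strength.app K ((Over.map a).obj X)).left ≫ (L.functor.map (sumTens a K X)).left
    rw [Category.id_comp, Category.assoc, reassoc_of% e, reassoc_of% h, prod_map_id_comp,
      Category.assoc, reassoc_of% (L.strength.naturality_left (𝟙 K) (counitMap u a X))]
    congr 2
    rw [map_left_comp L.functor ((Over.map (u ≫ a)).map st) (counitMap u a (tens K X)) (_ ≫ _) rfl]
    apply map_left_comm
    rw [sumTens_left, sumTens_left, Over.comp_left, counitMap_left]
    refine (Category.id_comp _).trans ((pullStrength_fst u K X).trans ?_)
    refine Eq.trans ?_ (Category.comp_id _).symm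
    change _ = prod.map (𝟙 K) (counitMap u a X).left
    rw [counitMap_left]

/-- The universal property of the cobase change square. -/
theorem vcompSquare_cobaseChangeSquare_eq_iff (χ : StrongSquare a b (cobaseChange u v P') L) :
    vcompSquare (cobaseChangeSquare u v P') χ = τ ↔ χ = cobaseChangeDesc τ := by
  let adj := Over.mapPullbackAdj u
  have key (χ : StrongSquare a b (cobaseChange u v P') L) (X : Over I') :
      ((vcompSquare (cobaseChangeSquare u v P') χ).nat.app X).left =
        (P'.functor.map (adj.unit.app X)).left ≫ (χ.nat.app ((Over.map u).obj X)).left ≫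
          (L.functor.map ((Over.mapComp u a).inv.app X)).left := vcompSquare_app _ _ _
  constructor
  · rintro rfl
    refine StrongSquare.ext _ _ fun X => ?_
    have e : (P'.functor.map ((Over.pullback u).map (adj.counit.app X))).left ≫
        (χ.nat.app X).left = (χ.nat.app ((Over.map u).obj ((Over.pullback u).obj X))).left ≫
          (L.functor.map ((Over.map a).map (adj.counit.app X))).left :=
      nat_left χ.nat (adj.counit.app X)
    have h₁ : (P'.functor.map (adj.unit.app ((Over.pullback u).obj X))).left ≫
        (P'.functor.map ((Over.pullback u).map (adj.counit.app X))).left = 𝟙 _ :=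
      (map_left_comp _ _ _ (𝟙 ((Over.pullback u).obj X))
        (congrArg Over.Hom.left (adj.right_triangle_components X))).trans (map_left_id _ _ rfl)
    have h₂ : (L.functor.map ((Over.mapComp u a).inv.app ((Over.pullback u).obj X))).left ≫
        (L.functor.map (counitMap u a X)).left =
          (L.functor.map ((Over.map a).map (adj.counit.app X))).left :=
      map_left_comp _ _ _ _ ((Category.id_comp _).trans (Category.id_comp _))
    refine Eq.trans ?_ (congrArg (· ≫ (L.functor.map (counitMap u a X)).left)
      (key χ ((Over.pullback u).obj X)).symm)
    have h₃ := congrArg ((χ.nat.app ((Over.map u).obj ((Over.pullback u).obj X))).left ≫ ·) h₂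
    refine Eq.trans ?_ ((congrArg ((P'.functor.map (adj.unit.app ((Over.pullback u).obj X))).left
      ≫ ·) (e.trans (h₃.symm.trans (Category.assoc _ _ _).symm))).trans (Category.assoc _ _ _).symm)
    exact (Category.id_comp _).symm.trans ((congrArg (· ≫ (χ.nat.app X).left) h₁.symm).trans
      (Category.assoc _ _ _))
  · rintro rfl
    refine StrongSquare.ext _ _ fun X => ?_
    have e : (P'.functor.map (adj.unit.app X)).left ≫
        (τ.nat.app ((Over.pullback u).obj ((Over.map u).obj X))).left =
      (τ.nat.app X).left ≫ (L.functor.map ((Over.map (u ≫ a)).map (adj.unit.app X))).left :=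
      nat_left τ.nat (adj.unit.app X)
    have h : (adj.unit.app X).left ≫ pullback.fst ((Over.map u).obj X).hom u = 𝟙 X.left := by
      rw [← counit_left]
      exact congrArg Over.Hom.left (adj.left_triangle_components X)
    rw [key]
    change (P'.functor.map (adj.unit.app X)).left ≫
      ((τ.nat.app ((Over.pullback u).obj ((Over.map u).obj X))).left ≫
        (L.functor.map (counitMap u a ((Over.map u).obj X))).left) ≫
        (L.functor.map ((Over.mapComp u a).inv.app X)).left = _
    rw [Category.assoc, reassoc_of% e, map_left_comp L.functor (counitMap u a _)
      ((Over.mapComp u a).inv.app X) (_ ≫ _) rfl,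
      map_left_comp L.functor _ _ (𝟙 _) ?_, CategoryTheory.Functor.map_id]
    · exact Category.comp_id _
    · rw [Over.comp_left, counitMap_left]
      exact (congrArg ((adj.unit.app X).left ≫ ·) (Category.comp_id _)).trans h

end Colift

end

variable {E : Type u} [Category.{v} E] [HasFiniteLimits E] [IsLCC E]

theorem isCartesian_cobaseChangeSquare {I' J' I J : E} (u : I' ⟶ I) (v : J' ⟶ J)
    {P' : StrongFunctor I' J'} (hP : IsPolyFunctor P') :
    IsCartesianSquare (cobaseChangeSquare u v P') :=
  (isCartesianSquare_iff _).2 fun f =>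
    isPullback_left_iff.1 (hP.map_isPullback (isPullback_unit u f))

/-- The factorisation through the cobase change pastes `τ` at `u^* X` with the image of the counit
of `Σ_u ⊣ u^*`, which is cartesian and preserved by the polynomial functor `L`. -/
theorem isCartesian_cobaseChangeDesc {I' J' I J I₀ J₀ : E} {u : I' ⟶ I} {v : J' ⟶ J} {a : I ⟶ I₀}
    {b : J ⟶ J₀} {P' : StrongFunctor I' J'} {L : StrongFunctor I₀ J₀} (hL : IsPolyFunctor L)
    {τ : StrongSquare (u ≫ a) (v ≫ b) P' L} (hτ : IsCartesianSquare τ) :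
    IsCartesianSquare (cobaseChangeDesc τ) :=
  (isCartesianSquare_iff _).2 fun f =>
    ((isCartesianSquare_iff _).1 hτ ((Over.pullback u).map f)).paste_vert
      (isPullback_left_iff.1 (hL.map_isPullback (isPullback_counitMap f)))

/-! ### The framed bicategories of polynomial functors -/

theorem polyFun_isTransporter {I' J' I J : E} (u : I' ⟶ I) (v : J' ⟶ J) (P : StrongFunctor I J)
    (h : IsPolyFunctor P) :
    (polyFun_isSub E).doubleCat.IsTransporter (u := u) (v := v)
      (M := ⟨baseChange u v P, isPolyFunctor_baseChange u v h⟩) (N := ⟨P, h⟩)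
      ⟨baseChangeSquare u v P, trivial⟩ :=
  DoubleCat.isTransporter_of_existsUnique (polyFun_isSub E).doubleCat _ fun _ _ _ τ =>
    ⟨⟨baseChangeLift τ.1, trivial⟩,
      Subtype.ext ((vcompSquare_baseChangeSquare_eq_iff τ.1 _).2 rfl),
      fun χ hχ => Subtype.ext
        ((vcompSquare_baseChangeSquare_eq_iff τ.1 χ.1).1 (congrArg Subtype.val hχ))⟩

theorem polyFun_isCotransporter {I' J' I J : E} (u : I' ⟶ I) (v : J' ⟶ J)
    (P' : StrongFunctor I' J') (h : IsPolyFunctor P') :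
    (polyFun_isSub E).doubleCat.IsCotransporter (u := u) (v := v) (M := ⟨P', h⟩)
      (N := ⟨cobaseChange u v P', isPolyFunctor_cobaseChange u v h⟩)
      ⟨cobaseChangeSquare u v P', trivial⟩ :=
  DoubleCat.isCotransporter_of_existsUnique (polyFun_isSub E).doubleCat _ fun _ _ _ τ =>
    ⟨⟨cobaseChangeDesc τ.1, trivial⟩,
      Subtype.ext ((vcompSquare_cobaseChangeSquare_eq_iff τ.1 _).2 rfl),
      fun χ hχ => Subtype.ext
        ((vcompSquare_cobaseChangeSquare_eq_iff τ.1 χ.1).1 (congrArg Subtype.val hχ))⟩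

theorem polyFunCart_isTransporter {I' J' I J : E} (u : I' ⟶ I) (v : J' ⟶ J)
    (P : StrongFunctor I J) (h : IsPolyFunctor P) :
    (polyFun_isSub_cartesian E).doubleCat.IsTransporter (u := u) (v := v)
      (M := ⟨baseChange u v P, isPolyFunctor_baseChange u v h⟩) (N := ⟨P, h⟩)
      ⟨baseChangeSquare u v P, isCartesian_baseChangeSquare u v P⟩ :=
  DoubleCat.isTransporter_of_existsUnique (polyFun_isSub_cartesian E).doubleCat _ fun _ _ _ τ => by
    have e := (vcompSquare_baseChangeSquare_eq_iff (P := P) τ.1 (baseChangeLift τ.1)).2 rfl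
    refine ⟨⟨baseChangeLift τ.1, isCartesian_of_vcompSquare (isCartesian_baseChangeSquare u v P)
      (e.symm ▸ τ.2)⟩, Subtype.ext e, fun χ hχ => Subtype.ext
        ((vcompSquare_baseChangeSquare_eq_iff τ.1 χ.1).1 (congrArg Subtype.val hχ))⟩

theorem polyFunCart_isCotransporter {I' J' I J : E} (u : I' ⟶ I) (v : J' ⟶ J)
    (P' : StrongFunctor I' J') (h : IsPolyFunctor P') :
    (polyFun_isSub_cartesian E).doubleCat.IsCotransporter (u := u) (v := v) (M := ⟨P', h⟩)
      (N := ⟨cobaseChange u v P', isPolyFunctor_cobaseChange u v h⟩)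
      ⟨cobaseChangeSquare u v P', isCartesian_cobaseChangeSquare u v h⟩ :=
  DoubleCat.isCotransporter_of_existsUnique (polyFun_isSub_cartesian E).doubleCat _ fun _ _ L τ =>
    ⟨⟨cobaseChangeDesc τ.1, isCartesian_cobaseChangeDesc L.2 τ.2⟩,
      Subtype.ext ((vcompSquare_cobaseChangeSquare_eq_iff τ.1 _).2 rfl),
      fun χ hχ => Subtype.ext
        ((vcompSquare_cobaseChangeSquare_eq_iff τ.1 χ.1).1 (congrArg Subtype.val hχ))⟩

end

section

/-! ### The framed bicategories of polynomials -/

variable {E : Type u} [Category.{v} E] [HasFiniteLimits E]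

section Glob

variable {I J : E} {P Q : StrongFunctor I J} (e : P.functor ≅ Q.functor)
  (he : IsStrong (P := P) (Q := Q) e.hom)

theorem isCartesian_globSquare : IsCartesianSquare (globSquare e.hom he) := by
  have (X : Over I) : IsIso ((globSquare e.hom he).nat.app X) :=
    inferInstanceAs (IsIso ((Over.mapId J).hom.app (P.functor.obj X) ≫ e.hom.app X ≫
      Q.functor.map ((Over.mapId I).inv.app X)))
  have : IsIso (globSquare e.hom he).nat := NatIso.isIso_of_isIso_app _
  exact NatTrans.Equifibered.of_isIso _

variable {p : ∀ {I J : E}, (strongGraph E).Hor I J → Prop}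
  {q : ∀ {I' J' I J : E} {u : I' ⟶ I} {v : J' ⟶ J} {M : (strongGraph E).Hor I' J'}
    {N : (strongGraph E).Hor I J}, (strongGraph E).Sq u v M N → Prop}
  (h : (strongDouble E).IsSub p q) (hP : p P) (hQ : p Q)

theorem vcomp_globSquare_inv (h₁ : q (globSquare e.hom he)) (h₂ : q (globSquare e.inv he.inv)) :
    h.doubleCat.vcomp (L := ⟨P, hP⟩) (M := ⟨Q, hQ⟩) (N := ⟨P, hP⟩) ⟨globSquare e.hom he, h₁⟩
      ⟨globSquare e.inv he.inv, h₂⟩ ≍ h.doubleCat.vid ⟨P, hP⟩ :=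
  h.sq_heq (Category.comp_id _) (Category.comp_id _) _ _
    (globSquare_heq_vid _ he _ he.inv e.hom_inv_id)

theorem vcomp_inv_globSquare (h₁ : q (globSquare e.hom he)) (h₂ : q (globSquare e.inv he.inv)) :
    h.doubleCat.vcomp (L := ⟨Q, hQ⟩) (M := ⟨P, hP⟩) (N := ⟨Q, hQ⟩) ⟨globSquare e.inv he.inv, h₂⟩
      ⟨globSquare e.hom he, h₁⟩ ≍ h.doubleCat.vid ⟨Q, hQ⟩ :=
  h.sq_heq (Category.comp_id _) (Category.comp_id _) _ _
    (globSquare_heq_vid _ he.inv _ he e.inv_hom_id)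

/-- A strong natural isomorphism is an isomorphism in the category of horizontal arrows. -/
def globIso (h₁ : q (globSquare e.hom he)) (h₂ : q (globSquare e.inv he.inv)) :
    h.doubleCat.horObj ⟨P, hP⟩ ≅ h.doubleCat.horObj ⟨Q, hQ⟩ where
  hom := h.doubleCat.sqHom (M := ⟨P, hP⟩) (N := ⟨Q, hQ⟩) ⟨globSquare e.hom he, h₁⟩
  inv := h.doubleCat.sqHom (M := ⟨Q, hQ⟩) (N := ⟨P, hP⟩) ⟨globSquare e.inv he.inv, h₂⟩
  hom_inv_id := DoubleCat.sqHom_eq_of_heq _ (Category.comp_id _) (Category.comp_id _)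
    (vcomp_globSquare_inv e he h hP hQ h₁ h₂)
  inv_hom_id := DoubleCat.sqHom_eq_of_heq _ (Category.comp_id _) (Category.comp_id _)
    (vcomp_inv_globSquare e he h hP hQ h₁ h₂)

end Glob

variable [IsLCC E]

/-- Two diagrams represent the same square exactly when they differ by the choice of the
pullback, so classes of diagrams are the same as squares. -/
def squareEquiv {I' J' I J : E} {u : I' ⟶ I} {v : J' ⟶ J} {F' : PolyDiagram I' J'}
    {F : PolyDiagram I J} :
    Quotient (SqDiagram.setoid (u := u) (v := v) (F' := F') (F := F)) ≃
      {_σ : StrongSquare u v F'.ext F.ext // True} where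
  toFun := Quotient.lift (fun d => ⟨d.square, trivial⟩) fun d e h =>
    Subtype.ext ((SqDiagram.square_eq_square_iff d e).2 h)
  invFun σ := Quotient.mk _ σ.1.diagram
  left_inv := Quotient.ind fun _ =>
    Quotient.sound ((SqDiagram.square_eq_square_iff _ _).1 (StrongSquare.diagram_square _))
  right_inv _ := Subtype.ext (StrongSquare.diagram_square _)

/-- Cartesian diagrams are the same as cartesian squares. -/
def cartSquareEquiv {I' J' I J : E} {u : I' ⟶ I} {v : J' ⟶ J} {F' : PolyDiagram I' J'}
    {F : PolyDiagram I J} :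
    CartDiagram u v F' F ≃ {σ : StrongSquare u v F'.ext F.ext // IsCartesianSquare σ} :=
  Equiv.ofBijective (fun d => ⟨d.square, d.square_isCartesian⟩)
    ⟨fun _ _ h => CartDiagram.ext_of_square_eq (congrArg Subtype.val h), fun σ => by
      obtain ⟨d, hd⟩ := σ.1.exists_cartDiagram σ.2
      exact ⟨d, Subtype.ext hd⟩⟩

variable (E) in
/-- Polynomials and classes of diagrams, compared with `PolyFun` by extension. -/
def polyTransport : Transport (polyGraph E) (polyFun_isSub E).doubleCat
    (fun F => ⟨F.ext, isPoly_ext F⟩) where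
  e := squareEquiv
  comp F G := ⟨globSquare (compIso F G).hom (compIso_isStrong F G), trivial⟩
  compInv F G := ⟨globSquare (compIso F G).inv (compIso_isStrong F G).inv, trivial⟩
  comp_compInv F G := vcomp_globSquare_inv (compIso F G) (compIso_isStrong F G) _ _ _ _ _
  compInv_comp F G := vcomp_inv_globSquare (compIso F G) (compIso_isStrong F G) _ _ _ _ _
  unit I := ⟨globSquare (idIso I).hom (idIso_isStrong I), trivial⟩
  unitInv I := ⟨globSquare (idIso I).inv (idIso_isStrong I).inv, trivial⟩
  unit_unitInv I := vcomp_globSquare_inv (idIso I) (idIso_isStrong I) _ _ _ _ _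
  unitInv_unit I := vcomp_inv_globSquare (idIso I) (idIso_isStrong I) _ _ _ _ _

variable (E) in
/-- Polynomials and cartesian diagrams, compared with the cartesian fragment of `PolyFun` by
extension. -/
def polyCartTransport : Transport (cartGraph E) (polyFun_isSub_cartesian E).doubleCat
    (fun F => ⟨F.ext, isPoly_ext F⟩) where
  e := cartSquareEquiv
  comp F G := ⟨globSquare (compIso F G).hom (compIso_isStrong F G), isCartesian_globSquare _ _⟩
  compInv F G := ⟨globSquare (compIso F G).inv (compIso_isStrong F G).inv,
    isCartesian_globSquare (compIso F G).symm _⟩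
  comp_compInv F G := vcomp_globSquare_inv (compIso F G) (compIso_isStrong F G) _ _ _ _ _
  compInv_comp F G := vcomp_inv_globSquare (compIso F G) (compIso_isStrong F G) _ _ _ _ _
  unit I := ⟨globSquare (idIso I).hom (idIso_isStrong I), isCartesian_globSquare _ _⟩
  unitInv I := ⟨globSquare (idIso I).inv (idIso_isStrong I).inv,
    isCartesian_globSquare (idIso I).symm _⟩
  unit_unitInv I := vcomp_globSquare_inv (idIso I) (idIso_isStrong I) _ _ _ _ _
  unitInv_unit I := vcomp_inv_globSquare (idIso I) (idIso_isStrong I) _ _ _ _ _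

theorem horSurjective_polyFun : Transport.HorSurjective (G := polyGraph E)
    (polyFun_isSub E).doubleCat (fun F => ⟨F.ext, isPoly_ext F⟩) := fun P => by
  obtain ⟨F, e, he⟩ := P.2
  exact ⟨F, globIso e he _ (isPoly_ext F) P.2 trivial trivial, ⟨rfl, rfl⟩, rfl, rfl⟩

theorem horSurjective_polyFunCart : Transport.HorSurjective (G := cartGraph E)
    (polyFun_isSub_cartesian E).doubleCat (fun F => ⟨F.ext, isPoly_ext F⟩) := fun P => by
  obtain ⟨F, e, he⟩ := P.2
  exact ⟨F, globIso e he _ (isPoly_ext F) P.2 (isCartesian_globSquare _ _)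
    (isCartesian_globSquare e.symm _), ⟨rfl, rfl⟩, rfl, rfl⟩

theorem polyTransport_vcomp {I₁ J₁ I₂ J₂ I₃ J₃ : E} {u : I₁ ⟶ I₂} {v : J₁ ⟶ J₂} {u' : I₂ ⟶ I₃}
    {v' : J₂ ⟶ J₃} {F₁ : PolyDiagram I₁ J₁} {F₂ : PolyDiagram I₂ J₂} {F₃ : PolyDiagram I₃ J₃}
    (d : SqDiagram u v F₁ F₂) (e : SqDiagram u' v' F₂ F₃) :
    (polyTransport E).doubleCat.vcomp d.cls e.cls = (d.comp e).cls := by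
  refine (polyTransport E).e.injective (((polyTransport E).e_vcomp d.cls e.cls).trans ?_)
  exact Subtype.ext (SqDiagram.comp_square d e).symm

theorem polyCartTransport_vcomp {I₁ J₁ I₂ J₂ I₃ J₃ : E} {u : I₁ ⟶ I₂} {v : J₁ ⟶ J₂}
    {u' : I₂ ⟶ I₃} {v' : J₂ ⟶ J₃} {F₁ : PolyDiagram I₁ J₁} {F₂ : PolyDiagram I₂ J₂}
    {F₃ : PolyDiagram I₃ J₃} (d : CartDiagram u v F₁ F₂) (e : CartDiagram u' v' F₂ F₃) :
    (polyCartTransport E).doubleCat.vcomp (L := F₁) (M := F₂) (N := F₃) d e = d.comp e := by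
  refine (polyCartTransport E).e.injective
    (((polyCartTransport E).e_vcomp (L := F₁) (M := F₂) (N := F₃) d e).trans ?_)
  exact Subtype.ext (CartDiagram.comp_square d e).symm

end

end

end PolyDouble

theorem mainTheorem2 {E : Type u} [Category.{v} E] [HasFiniteLimits E] [IsLCC E] :
    -- Polynomial functors and strong natural transformations, and polynomial functors and cartesian
    -- strong natural transformations, form double categories.
    ∃ (hP : (strongDouble E).IsSub (fun P => IsPolyFunctor P) (fun _ => True))
      (hC : (strongDouble E).IsSub (fun P => IsPolyFunctor P) (fun σ => IsCartesianSquare σ)),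
    -- `PolyFun` is a framed bicategory,
    hP.doubleCat.IsFramed ∧
    -- with base change `v^* P Σ_u`
    (∀ {I' J' I J : E} (u : I' ⟶ I) (v : J' ⟶ J) (P : StrongFunctor I J) (h : IsPolyFunctor P),
      ∃ h' : IsPolyFunctor (baseChange u v P),
        hP.doubleCat.IsTransporter (u := u) (v := v) (M := ⟨baseChange u v P, h'⟩) (N := ⟨P, h⟩)
          ⟨baseChangeSquare u v P, trivial⟩) ∧
    -- and cobase change `Σ_v P' u^*`.
    (∀ {I' J' I J : E} (u : I' ⟶ I) (v : J' ⟶ J) (P' : StrongFunctor I' J') (h : IsPolyFunctor P'),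
      ∃ h' : IsPolyFunctor (cobaseChange u v P'),
        hP.doubleCat.IsCotransporter (u := u) (v := v) (M := ⟨P', h⟩)
          (N := ⟨cobaseChange u v P', h'⟩) ⟨cobaseChangeSquare u v P', trivial⟩) ∧
    -- Every square is represented by a diagram, uniquely up to the choice of the pullback.
    (∀ {I' J' I J : E} (u : I' ⟶ I) (v : J' ⟶ J) (F' : PolyDiagram I' J') (F : PolyDiagram I J),
      (∀ σ : StrongSquare u v F'.ext F.ext, ∃ d : SqDiagram u v F' F, d.square = σ) ∧
      ∀ d e : SqDiagram u v F' F, d.square = e.square ↔ d.Equivalent e) ∧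
    -- Extension is a framed biequivalence from a framed bicategory of polynomials to `PolyFun`.
    (∃ (Poly : DoubleCat (polyGraph E))
      (Ext : DoubleFunctor Poly hP.doubleCat (fun F => ⟨F.ext, isPoly_ext F⟩)),
      (∀ {I₁ J₁ I₂ J₂ I₃ J₃ : E} {u : I₁ ⟶ I₂} {v : J₁ ⟶ J₂} {u' : I₂ ⟶ I₃} {v' : J₂ ⟶ J₃}
        {F₁ : PolyDiagram I₁ J₁} {F₂ : PolyDiagram I₂ J₂} {F₃ : PolyDiagram I₃ J₃}
        (d : SqDiagram u v F₁ F₂) (e : SqDiagram u' v' F₂ F₃),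
        Poly.vcomp d.cls e.cls = (d.comp e).cls) ∧
      (∀ {I' J' I J : E} {u : I' ⟶ I} {v : J' ⟶ J} {F' : PolyDiagram I' J'}
        {F : PolyDiagram I J} (d : SqDiagram u v F' F), (Ext.sq d.cls).1 = d.square) ∧
      (∀ {I J K : E} (F : PolyDiagram I J) (G : PolyDiagram J K),
        StrongSquare.HasComponents (P := (F.comp G).ext) (Q := F.ext.comp G.ext)
          (Ext.mapComp F G).1 (compMap F G)) ∧
      (∀ I : E, StrongSquare.HasComponents (P := (PolyDiagram.id I).ext) (Q := StrongFunctor.id I)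
          (Ext.mapId I).1 idMap) ∧
      Poly.IsFramed ∧
      Ext.IsFramedBiequivalence) ∧
    -- The cartesian fragment of `PolyFun` is a framed bicategory,
    hC.doubleCat.IsFramed ∧
    -- with the same base change
    (∀ {I' J' I J : E} (u : I' ⟶ I) (v : J' ⟶ J) (P : StrongFunctor I J) (h : IsPolyFunctor P),
      ∃ (h' : IsPolyFunctor (baseChange u v P)) (hc : IsCartesianSquare (baseChangeSquare u v P)),
        hC.doubleCat.IsTransporter (u := u) (v := v) (M := ⟨baseChange u v P, h'⟩) (N := ⟨P, h⟩)
          ⟨baseChangeSquare u v P, hc⟩) ∧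
    -- and cobase change.
    (∀ {I' J' I J : E} (u : I' ⟶ I) (v : J' ⟶ J) (P' : StrongFunctor I' J') (h : IsPolyFunctor P'),
      ∃ (h' : IsPolyFunctor (cobaseChange u v P')) (hc : IsCartesianSquare (cobaseChangeSquare u v P')),
        hC.doubleCat.IsCotransporter (u := u) (v := v) (M := ⟨P', h⟩)
          (N := ⟨cobaseChange u v P', h'⟩) ⟨cobaseChangeSquare u v P', hc⟩) ∧
    -- The cartesian squares are uniquely represented by cartesian diagrams.
    (∀ {I' J' I J : E} (u : I' ⟶ I) (v : J' ⟶ J) (F' : PolyDiagram I' J') (F : PolyDiagram I J),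
      (∀ d : CartDiagram u v F' F, IsCartesianSquare d.square) ∧
      ∀ σ : StrongSquare u v F'.ext F.ext, IsCartesianSquare σ →
        ∃! d : CartDiagram u v F' F, d.square = σ) ∧
    -- Extension is a framed biequivalence from a framed bicategory of polynomials and cartesian
    -- diagrams to the cartesian fragment of `PolyFun`.
    (∃ (PolyCart : DoubleCat (cartGraph E))
      (Ext : DoubleFunctor PolyCart hC.doubleCat (fun F => ⟨F.ext, isPoly_ext F⟩)),
      (∀ {I₁ J₁ I₂ J₂ I₃ J₃ : E} {u : I₁ ⟶ I₂} {v : J₁ ⟶ J₂} {u' : I₂ ⟶ I₃} {v' : J₂ ⟶ J₃}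
        {F₁ : PolyDiagram I₁ J₁} {F₂ : PolyDiagram I₂ J₂} {F₃ : PolyDiagram I₃ J₃}
        (d : CartDiagram u v F₁ F₂) (e : CartDiagram u' v' F₂ F₃),
        PolyCart.vcomp (L := F₁) (M := F₂) (N := F₃) d e = d.comp e) ∧
      (∀ {I' J' I J : E} {u : I' ⟶ I} {v : J' ⟶ J} {F' : PolyDiagram I' J'}
        {F : PolyDiagram I J} (d : CartDiagram u v F' F),
        (Ext.sq (M := F') (N := F) d).1 = d.square) ∧
      (∀ {I J K : E} (F : PolyDiagram I J) (G : PolyDiagram J K),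
        StrongSquare.HasComponents (P := (F.comp G).ext) (Q := F.ext.comp G.ext)
          (Ext.mapComp F G).1 (compMap F G)) ∧
      (∀ I : E, StrongSquare.HasComponents (P := (PolyDiagram.id I).ext) (Q := StrongFunctor.id I)
          (Ext.mapId I).1 idMap) ∧
      PolyCart.IsFramed ∧
      Ext.IsFramedBiequivalence) := by
  refine ⟨polyFun_isSub E, polyFun_isSub_cartesian E, ?_, ?_, ?_, ?_, ?_, ?_, ?_, ?_, ?_, ?_⟩
  · exact DoubleCat.isFramed_of_lifts _
      (fun u v P => ⟨_, _, polyFun_isTransporter u v P.1 P.2⟩)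
      (fun u v P => ⟨_, _, polyFun_isCotransporter u v P.1 P.2⟩)
  · exact fun u v P h => ⟨_, polyFun_isTransporter u v P h⟩
  · exact fun u v P h => ⟨_, polyFun_isCotransporter u v P h⟩
  · exact fun u v F' F => ⟨fun σ => ⟨σ.diagram, σ.diagram_square⟩, SqDiagram.square_eq_square_iff⟩
  · exact ⟨(polyTransport E).doubleCat, (polyTransport E).doubleFunctor, polyTransport_vcomp,
      fun _ => rfl, fun F G => globSquare_app _ (compIso_isStrong F G),
      fun I => globSquare_app _ (idIso_isStrong I),
      (polyTransport E).isFramed horSurjective_polyFun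
        (fun u v P => ⟨_, _, polyFun_isTransporter u v P.1 P.2⟩)
        (fun u v P => ⟨_, _, polyFun_isCotransporter u v P.1 P.2⟩),
      (polyTransport E).isFramedBiequivalence horSurjective_polyFun⟩
  · exact DoubleCat.isFramed_of_lifts _
      (fun u v P => ⟨_, _, polyFunCart_isTransporter u v P.1 P.2⟩)
      (fun u v P => ⟨_, _, polyFunCart_isCotransporter u v P.1 P.2⟩)
  · exact fun u v P h => ⟨_, _, polyFunCart_isTransporter u v P h⟩
  · exact fun u v P h => ⟨_, _, polyFunCart_isCotransporter u v P h⟩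
  · refine fun u v F' F => ⟨fun d => d.square_isCartesian, fun σ hσ => ?_⟩
    obtain ⟨d, hd⟩ := σ.exists_cartDiagram hσ
    exact ⟨d, hd, fun e he => CartDiagram.ext_of_square_eq (he.trans hd.symm)⟩
  · exact ⟨(polyCartTransport E).doubleCat, (polyCartTransport E).doubleFunctor,
      polyCartTransport_vcomp, fun _ => rfl, fun F G => globSquare_app _ (compIso_isStrong F G),
      fun I => globSquare_app _ (idIso_isStrong I),
      (polyCartTransport E).isFramed horSurjective_polyFunCart
        (fun u v P => ⟨_, _, polyFunCart_isTransporter u v P.1 P.2⟩)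
        (fun u v P => ⟨_, _, polyFunCart_isCotransporter u v P.1 P.2⟩),
      (polyCartTransport E).isFramedBiequivalence horSurjective_polyFunCart⟩
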